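/- Let $d\in\{1,2,3\}$ and let $\Omega=([0,1]|_{\{0,1\}})^d$ be the flat torus. **Mesh.** A mesh divides $\Omega$ into uniform rectangular elements $K$ with edge lengths $h_i=1/n_i$ ($n_i\in\mathbb N$, $n_i\ge1$), $h=\max_i h_i$; it is $\eta$-regular if $\max_i h/h_i\le\eta$. $Q_h$ is the space of functions that are constant on each element, $\Pi_{\mathcal T}$ the projection onto $Q_h$ by element means (vector functions are treated componentwise). For a face $\sigma$ with unit normal $\mathbf n$ let $v^{\rm in},v^{\rm out}$ be the one-sided values of $v$, $\overline v=\frac12(v^{\rm in}+v^{\rm out})$, $[\![v]\!]=v^{\rm out}-v^{\rm in}$, and $d_\sigma=h_i$ if $\sigma\perp\mathbf e_i$. Put $[f]^\pm=\frac12(f\pm|f|)$ and $$F_h(r,\mathbf v)=r^{\rm in}[\overline{\mathbf v}\cdot\mathbf n]^++r^{\rm out}[\overline{\mathbf v}\cdot\mathbf n]^--h^\varepsilon[\![r]\!],$$ componentwise ($\mathbf F_h$) for vector functions $r$. Let $({\rm div}_h\mathbf v)_K=\frac1{|K|}\sum_{\sigma\subset\partial K}|\sigma|\,\overline{\mathbf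 v}\cdot\mathbf n$ with $\mathbf n$ outward, and let the $i$-th component of $\nabla_{\mathcal E}r$ equal $(r_L-r_K)/h_i$ on the dual element (the two adjacent half-elements) of the face between $K$ and its neighbour $L$ in direction $+\mathbf e_i$ (periodically). **Scheme.** Let $T,a,\mu>0$, $\lambda\ge-\mu$, $p(\varrho)=a\varrho^\gamma$, $\varrho_0\in L^\gamma(\Omega)$, $\varrho_0>0$ a.e., $\mathbf u_0\in L^2(\Omega;\mathbb R^d)$, $\Delta t=T/N$ with $N\ge1$ an integer. A numerical solution is a family $(\varrho_h^k,\mathbf u_h^k)\in Q_h\times Q_h^d$, $0\le k\le N$, with $(\varrho_h^0,\mathbf u_h^0)=(\Pi_{\mathcal T}\varrho_0,\Pi_{\mathcal T}\mathbf u_0)$ and, for $k=1,\dots,N$, with $D_tv^k=(v^k-v^{k-1})/\Delta t$ and $p_h^k=p(\varrho_h^k)$, $$\int_\Omega D_t\varrho_h^k\,\phi_h\,dx-\sum_\sigma\int_\sigma F_h(\varrho_h^k,\mathbf u_h^k)[\![\phi_h]\!]\,dS=0\quad\text{for all }\phi_h\in Q_h,$$ $$\int_\Omega D_t(\varrho_h^k\mathbf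 u_h^k)\cdot\boldsymbol\phi_h\,dx-\sum_\sigma\int_\sigma\mathbf F_h(\varrho_h^k\mathbf u_h^k,\mathbf u_h^k)\cdot[\![\boldsymbol\phi_h]\!]\,dS-\sum_\sigma\int_\sigma\overline{p_h^k}\,\mathbf n\cdot[\![\boldsymbol\phi_h]\!]\,dS$$ $$=-\mu\sum_\sigma\int_\sigma\frac1{d_\sigma}[\![\mathbf u_h^k]\!]\cdot[\![\boldsymbol\phi_h]\!]\,dS-(\mu+\lambda)\int_\Omega{\rm div}_h\mathbf u_h^k\,{\rm div}_h\boldsymbol\phi_h\,dx\quad\text{for all }\boldsymbol\phi_h\in Q_h^d.$$ Let $\varrho_h(t)=\varrho_h^0$, $\mathbf u_h(t)=\mathbf u_h^0$ for $t<\Delta t$, $\varrho_h(t)=\varrho_h^k$, $\mathbf u_h(t)=\mathbf u_h^k$ for $t\in[k\Delta t,(k+1)\Delta t)$, and $p_h=p(\varrho_h)$. **Theorem (consistency).** Let $1<\gamma<2$ and $0<\varepsilon<\min\{1,2(\gamma-1)\}$. There is $\beta>0$, depending only on $d,\gamma,\varepsilon$, such that for all $T,a,\mu,\lambda,\varrho_0,\mathbf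 u_0$ as above and all $\eta,E_0\in\mathbb R$, $c_1,c_2>0$ there is a constant $C>0$ with the following property. For every $\eta$-regular mesh, every $\Delta t=T/N$ with $c_1h\le\Delta t\le c_2h$, and every numerical solution $(\varrho_h,\mathbf u_h)$ whose initial kinetic energy satisfies $\int_\Omega\varrho_h^0|\mathbf u_h^0|^2dx\le E_0$, there are residuals $e_{1,h}(\cdot,\phi),e_{2,h}(\cdot,\boldsymbol\phi)\in L^1(0,T)$ such that $$-\int_\Omega\varrho_h^0\phi(0,\cdot)\,dx=\int_0^T\!\!\int_\Omega\big[\varrho_h\partial_t\phi+\varrho_h\mathbf u_h\cdot\nabla_x\phi\big]dx\,dt+\int_0^Te_{1,h}(t,\phi)\,dt$$ for all $\phi\in C^3_c([0,T)\times\Omega)$, $$-\int_\Omega\varrho_h^0\mathbf u_h^0\cdot\boldsymbol\phi(0,\cdot)\,dx=\int_0^T\!\!\int_\Omega\big[\varrho_h\mathbf u_h\cdot\partial_t\boldsymbol\phi+\varrho_h\mathbf u_h\otimes\mathbf u_h:\nabla_x\boldsymbol\phi+p_h\,{\rm div}_x\boldsymbol\phi\big]dx\,dt$$ $$-\mu\int_0^T\!\!\int_\Omega\nabla_{\mathcal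 E}\mathbf u_h:\nabla_x\boldsymbol\phi\,dx\,dt-(\mu+\lambda)\int_0^T\!\!\int_\Omega{\rm div}_h\mathbf u_h\,{\rm div}_x\boldsymbol\phi\,dx\,dt+\int_0^Te_{2,h}(t,\boldsymbol\phi)\,dt$$ for all $\boldsymbol\phi\in C^3_c([0,T)\times\Omega;\mathbb R^d)$, and $$\|e_{j,h}(\cdot,\phi)\|_{L^1(0,T)}\le C\,h^\beta\big(\|\phi\|_{C^2}+h\|\phi\|_{C^3}\big),\qquad j=1,2,$$ for all these test functions, where $\|\cdot\|_{C^k}$ is the $C^k$ norm on $[0,T)\times\Omega$ in space and time. -/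

import Mathlib

open MeasureTheory Set

noncomputable section

namespace FVNS

/-- Points and vectors of `ℝ^d`, in coordinates. Functions on the flat torus are functions on the
unit cube, or `ℤ^d`-periodic functions on `ℝ^d`. -/
abbrev Pt (d : ℕ) : Type := Fin d → ℝ

/-- The fundamental cell `[0,1)^d` of the flat torus. -/
def cube (d : ℕ) : Set (Pt d) := {x | ∀ i, 0 ≤ x i ∧ x i < 1}

/-! ### Mesh -/

/-- A uniform rectangular mesh of the flat torus with `n i` cells in the `i`-th direction. -/
structure Mesh (d : ℕ) where
  n : Fin d → ℕ
  pos : ∀ i, 0 < n i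

namespace Mesh

variable {d : ℕ} (M : Mesh d)

instance instNeZero (i : Fin d) : NeZero (M.n i) := ⟨(M.pos i).ne'⟩

/-- The elements of the mesh, indexed periodically. -/
abbrev Cell : Type := (i : Fin d) → ZMod (M.n i)

/-- The mesh size `h_i` in the `i`-th direction. -/
def step (i : Fin d) : ℝ := 1 / (M.n i : ℝ)

/-- The mesh size `h = max_i h_i`. -/
def size : ℝ := ⨆ i, M.step i

/-- The mesh regularity `max_i h / h_i ≤ η`. -/
def IsRegular (η : ℝ) : Prop := ∀ i, M.size / M.step i ≤ η

/-- The volume `|K|` of an element. -/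
def vol : ℝ := ∏ i, M.step i

/-- The area `|σ|` of a face orthogonal to the `i`-th basis vector. -/
def area (i : Fin d) : ℝ := ∏ j ∈ Finset.univ.erase i, M.step j

/-- The region of space (in the fundamental cell) occupied by the element `K`. -/
def region (K : M.Cell) : Set (Pt d) :=
  {x | ∀ i, ((K i).val : ℝ) * M.step i ≤ x i ∧ x i < (((K i).val : ℝ) + 1) * M.step i}

/-- The element that contains the point `x` of the torus (`x` any point of `ℝ^d`, taken modulo
`ℤ^d`). -/
def cellAt (x : Pt d) : M.Cell := fun i => ((⌊x i / M.step i⌋ : ℤ) : ZMod (M.n i))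

/-- The neighbour of `K` in the positive `i`-th direction, periodically. -/
def next (i : Fin d) (K : M.Cell) : M.Cell := K + Pi.single i 1

/-- The neighbour of `K` in the negative `i`-th direction, periodically. -/
def prev (i : Fin d) (K : M.Cell) : M.Cell := K - Pi.single i 1

/-! ### Discrete functions

A scalar function of `Q_h` is given by its values on the elements, `r : M.Cell → ℝ`, a vector
function by `v : M.Cell → Pt d`. Each face orthogonal to the `i`-th basis vector `e_i` is
`K | M.next i K` for exactly one `K`; it is indexed by `(i, K)` and given the normal `e_i`, so
that the inner value is the one on `K` and the outer value the one on `M.next i K`. -/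

/-- The projection onto piecewise constant functions (mean values on the elements). -/
def proj (f : Pt d → ℝ) (K : M.Cell) : ℝ := (1 / M.vol) * ∫ x in M.region K, f x

/-- The average of `r` on the face `(i, K)`. -/
def avg (i : Fin d) (r : M.Cell → ℝ) (K : M.Cell) : ℝ := (r K + r (M.next i K)) / 2

/-- The jump of `r` on the face `(i, K)`. -/
def jump (i : Fin d) (r : M.Cell → ℝ) (K : M.Cell) : ℝ := r (M.next i K) - r K

/-- The average normal velocity on the face `(i, K)`. -/
def normalVel (i : Fin d) (v : M.Cell → Pt d) (K : M.Cell) : ℝ := M.avg i (fun L => v L i) K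

/-- The upwind flux `r^in [v·n]^+ + r^out [v·n]^-` on the face `(i, K)`, where
`[f]^± = (f ± |f|)/2`. -/
def upwind (i : Fin d) (r : M.Cell → ℝ) (v : M.Cell → Pt d) (K : M.Cell) : ℝ :=
  r K * ((M.normalVel i v K + |M.normalVel i v K|) / 2)
    + r (M.next i K) * ((M.normalVel i v K - |M.normalVel i v K|) / 2)

/-- The diffusive upwind flux `Up[r, v] - h^ε ⟦r⟧` on the face `(i, K)`. -/
def flux (ε : ℝ) (i : Fin d) (r : M.Cell → ℝ) (v : M.Cell → Pt d) (K : M.Cell) : ℝ :=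
  M.upwind i r v K - M.size ^ ε * M.jump i r K

/-- The discrete divergence: `1/|K|` times the sum over the faces of `K` of `|σ|` times the
average outward normal velocity. -/
def divh (v : M.Cell → Pt d) (K : M.Cell) : ℝ :=
  (1 / M.vol) * ∑ i, M.area i * (M.normalVel i v K - M.normalVel i v (M.prev i K))

/-- The `i`-th component of the discrete gradient on the dual grid, at the point `x`. The dual
element of the face `K | M.next i K` consists of the adjacent halves of the two elements, so `x`
lies in it if and only if `x - (h_i/2) e_i` lies in `K`. -/
def dualGrad (i : Fin d) (r : M.Cell → ℝ) (x : Pt d) : ℝ :=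
  M.jump i r (M.cellAt (x - Pi.single i (M.step i / 2))) / M.step i

/-! ### The scheme -/

/-- The discrete continuity equation for one time step from `(ϱ')` to `(ϱ, u)`. -/
def ContinuityStep (ε dt : ℝ) (ϱ' ϱ : M.Cell → ℝ) (u : M.Cell → Pt d) : Prop :=
  ∀ φ : M.Cell → ℝ,
    ∑ K, M.vol * ((ϱ K - ϱ' K) / dt * φ K)
      - ∑ i, ∑ K, M.area i * (M.flux ε i ϱ u K * M.jump i φ K) = 0

/-- The discrete momentum equation for one time step from `(ϱ', u')` to `(ϱ, u)`, with the
pressure law `p(ϱ) = a ϱ^γ`. -/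
def MomentumStep (a γ μ lam ε dt : ℝ) (ϱ' : M.Cell → ℝ) (u' : M.Cell → Pt d)
    (ϱ : M.Cell → ℝ) (u : M.Cell → Pt d) : Prop :=
  ∀ φ : M.Cell → Pt d,
    ∑ K, M.vol * ∑ j, (ϱ K * u K j - ϱ' K * u' K j) / dt * φ K j
      - ∑ i, ∑ K, M.area i *
          ∑ j, M.flux ε i (fun L => ϱ L * u L j) u K * M.jump i (fun L => φ L j) K
      - ∑ i, ∑ K, M.area i *
          (M.avg i (fun L => a * ϱ L ^ γ) K * M.jump i (fun L => φ L i) K)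
    = - μ * ∑ i, ∑ K, M.area i *
          ((1 / M.step i) * ∑ j, M.jump i (fun L => u L j) K * M.jump i (fun L => φ L j) K)
      - (μ + lam) * ∑ K, M.vol * (M.divh u K * M.divh φ K)

/-- `(ϱ^k, u^k)`, `k = 0, …, N`, is a solution of the implicit finite volume scheme with `N` time
steps of length `dt` and initial values the projections of `ϱ₀`, `u₀`. -/
structure IsNumericalSolution (a γ μ lam ε dt : ℝ) (N : ℕ) (ϱ₀ : Pt d → ℝ) (u₀ : Pt d → Pt d)
    (ϱ : ℕ → M.Cell → ℝ) (u : ℕ → M.Cell → Pt d) : Prop where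
  init_density : ∀ K, ϱ 0 K = M.proj ϱ₀ K
  init_velocity : ∀ K i, u 0 K i = M.proj (fun x => u₀ x i) K
  continuity : ∀ k, 1 ≤ k → k ≤ N → M.ContinuityStep ε dt (ϱ (k - 1)) (ϱ k) (u k)
  momentum : ∀ k, 1 ≤ k → k ≤ N →
    M.MomentumStep a γ μ lam ε dt (ϱ (k - 1)) (u (k - 1)) (ϱ k) (u k)

/-- The integral `∫_Ω ϱ |u|^2` for discrete functions `ϱ`, `u`. -/
def momentumEnergy (ϱ : M.Cell → ℝ) (u : M.Cell → Pt d) : ℝ :=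
  ∑ K, M.vol * (ϱ K * ∑ i, u K i ^ 2)

end Mesh

/-- The piecewise constant extension in time: `v^k` on `[k dt, (k+1) dt)`, and `v^0` for
`t < dt`. -/
def timeExt {α : Type} (dt : ℝ) (v : ℕ → α) (t : ℝ) : α := v ⌊t / dt⌋₊

/-! ### Test functions -/

/-- `φ(t, x)` is of class `C_c^3([0,T) × Ω)`, `Ω` the flat torus: three times continuously
differentiable up to `t = 0`, periodic in `x`, and zero for `t` near `T`. -/
structure IsTest {d : ℕ} {F : Type} [NormedAddCommGroup F] [NormedSpace ℝ F]
    (T : ℝ) (φ : ℝ → Pt d → F) : Prop where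
  smooth : ContDiffOn ℝ 3 (fun z : ℝ × Pt d => φ z.1 z.2) (Ico 0 T ×ˢ univ)
  periodic : ∀ t ∈ Ico 0 T, ∀ (x : Pt d) (m : Fin d → ℤ), φ t (x + fun i => (m i : ℝ)) = φ t x
  support : ∃ T' < T, ∀ t ∈ Ico 0 T, T' ≤ t → ∀ x, φ t x = 0

/-- The norm of `C^k([0,T) × Ω)`: the sum over `m ≤ k` of the supremum of the norm of the `m`-th
space-time derivative. -/
def cNorm {d : ℕ} {F : Type} [NormedAddCommGroup F] [NormedSpace ℝ F]
    (T : ℝ) (k : ℕ) (φ : ℝ → Pt d → F) : ℝ :=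
  ∑ m ∈ Finset.range (k + 1), ⨆ z : (Ico (0 : ℝ) T ×ˢ (univ : Set (Pt d)) : Set (ℝ × Pt d)),
    ‖iteratedFDerivWithin ℝ m (fun z : ℝ × Pt d => φ z.1 z.2) (Ico 0 T ×ˢ univ) z‖

/-- The partial derivative in the `j`-th space direction of a scalar function. -/
def pd {d : ℕ} (j : Fin d) (f : Pt d → ℝ) (x : Pt d) : ℝ := fderiv ℝ f x (Pi.single j 1)

/-! ### The weak formulations with a residual -/

/-- The weak continuity equation for the numerical solution and the test function `φ`, with the
residual `e(t)`. -/
def WeakContinuity {d : ℕ} (M : Mesh d) (T dt : ℝ) (ϱ : ℕ → M.Cell → ℝ) (u : ℕ → M.Cell → Pt d)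
    (φ : ℝ → Pt d → ℝ) (e : ℝ → ℝ) : Prop :=
  - ∫ x in cube d, ϱ 0 (M.cellAt x) * φ 0 x
    = (∫ t in (0 : ℝ)..T, ∫ x in cube d,
        (timeExt dt ϱ t (M.cellAt x) * deriv (fun s => φ s x) t
          + ∑ j, timeExt dt ϱ t (M.cellAt x) * timeExt dt u t (M.cellAt x) j * pd j (φ t) x))
      + ∫ t in (0 : ℝ)..T, e t

/-- The weak momentum equation for the numerical solution and the test function `φ`, with the
residual `e(t)`. -/
def WeakMomentum {d : ℕ} (M : Mesh d) (a γ μ lam T dt : ℝ)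
    (ϱ : ℕ → M.Cell → ℝ) (u : ℕ → M.Cell → Pt d) (φ : ℝ → Pt d → Pt d) (e : ℝ → ℝ) : Prop :=
  - ∫ x in cube d, ∑ i, ϱ 0 (M.cellAt x) * u 0 (M.cellAt x) i * φ 0 x i
    = (∫ t in (0 : ℝ)..T, ∫ x in cube d,
        (∑ i, timeExt dt ϱ t (M.cellAt x) * timeExt dt u t (M.cellAt x) i
            * deriv (fun s => φ s x i) t
          + ∑ i, ∑ j, timeExt dt ϱ t (M.cellAt x) * timeExt dt u t (M.cellAt x) i
              * timeExt dt u t (M.cellAt x) j * pd j (fun y => φ t y i) x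
          + a * timeExt dt ϱ t (M.cellAt x) ^ γ * ∑ i, pd i (fun y => φ t y i) x))
      - μ * (∫ t in (0 : ℝ)..T, ∫ x in cube d,
          ∑ i, ∑ j, M.dualGrad j (fun K => timeExt dt u t K i) x * pd j (fun y => φ t y i) x)
      - (μ + lam) * (∫ t in (0 : ℝ)..T, ∫ x in cube d,
          M.divh (timeExt dt u t) (M.cellAt x) * ∑ i, pd i (fun y => φ t y i) x)
      + ∫ t in (0 : ℝ)..T, e t

end FVNS

end

noncomputable section

namespace FVNS
namespace Mesh

variable {d : ℕ} (M : Mesh d)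

theorem step_pos (i : Fin d) : 0 < M.step i := by
  have := M.pos i
  unfold step; positivity

theorem step_le_one (i : Fin d) : M.step i ≤ 1 := by
  have h : (1 : ℝ) ≤ M.n i := by exact_mod_cast M.pos i
  unfold step
  rw [div_le_one (by linarith)]; exact h

theorem vol_pos : 0 < M.vol := Finset.prod_pos fun i _ => M.step_pos i

theorem area_eq (i : Fin d) : M.area i = M.vol / M.step i := by
  rw [eq_div_iff (M.step_pos i).ne', area, vol, mul_comm]
  exact Finset.mul_prod_erase Finset.univ M.step (Finset.mem_univ i)

theorem step_le_size (i : Fin d) : M.step i ≤ M.size :=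
  le_ciSup (f := M.step) (Set.finite_range _).bddAbove i

theorem size_nonneg : 0 ≤ M.size := Real.iSup_nonneg fun i => (M.step_pos i).le

theorem size_pos (i : Fin d) : 0 < M.size := (M.step_pos i).trans_le (M.step_le_size i)

theorem size_le_one : M.size ≤ 1 := by
  refine Real.iSup_le (fun i => M.step_le_one i) zero_le_one

theorem next_prev (i : Fin d) (K : M.Cell) : M.next i (M.prev i K) = K := by
  simp [next, prev]

theorem prev_next (i : Fin d) (K : M.Cell) : M.prev i (M.next i K) = K := by
  simp [next, prev]

theorem sum_next (i : Fin d) (f : M.Cell → ℝ) : ∑ K, f (M.next i K) = ∑ K, f K :=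
  Equiv.sum_comp (Equiv.addRight (Pi.single i 1 : M.Cell)) f

theorem sum_prev (i : Fin d) (f : M.Cell → ℝ) : ∑ K, f (M.prev i K) = ∑ K, f K :=
  Equiv.sum_comp (Equiv.subRight (Pi.single i 1 : M.Cell)) f

theorem sum_vol : ∑ _K : M.Cell, M.vol = 1 := by
  rw [Finset.sum_const, Finset.card_univ, Fintype.card_pi, nsmul_eq_mul, vol]
  push_cast
  rw [← Finset.prod_mul_distrib]
  refine Finset.prod_eq_one fun i _ => ?_
  have : (0 : ℝ) < M.n i := by exact_mod_cast M.pos i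
  rw [ZMod.card, step]; field_simp

/-- Discrete integration by parts on the faces orthogonal to one direction. -/
theorem sum_jump_mul (i : Fin d) (r D : M.Cell → ℝ) :
    ∑ K, M.jump i r K * D K = ∑ K, r K * (D (M.prev i K) - D K) := by
  have h := M.sum_prev i (fun K => r (M.next i K) * D K)
  simp only [next_prev] at h
  simp only [jump, sub_mul, mul_sub, Finset.sum_sub_distrib]
  rw [h]

theorem sum_avg_mul (i : Fin d) (r D : M.Cell → ℝ) :
    ∑ K, M.avg i r K * D K = ∑ K, r K * ((D (M.prev i K) + D K) / 2) := by
  have h := M.sum_prev i (fun K => r (M.next i K) * D K)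
  simp only [next_prev] at h
  have e1 : ∀ K, M.avg i r K * D K = (r K * D K + r (M.next i K) * D K) / 2 := fun K => by
    unfold avg; ring
  have e2 : ∀ K, r K * ((D (M.prev i K) + D K) / 2)
      = (r K * D K + r K * D (M.prev i K)) / 2 := fun K => by ring
  simp only [e1, e2, ← Finset.sum_div, Finset.sum_add_distrib]
  rw [h]

end Mesh

/-! ### Stability of the scheme -/

theorem rpow_tangent_le {γ x y : ℝ} (hγ : 1 < γ) (hx : 0 ≤ x) (hy : 0 ≤ y) :
    y ^ γ + γ * y ^ (γ - 1) * (x - y) ≤ x ^ γ := by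
  rcases hy.eq_or_lt with rfl | hy
  · rw [Real.zero_rpow (by linarith), Real.zero_rpow (by linarith)]
    have := Real.rpow_nonneg hx γ
    linarith
  · have h := one_add_mul_self_le_rpow_one_add (s := x / y - 1) (p := γ)
      (by have := div_nonneg hx hy.le; linarith) hγ.le
    rw [add_sub_cancel, Real.div_rpow hx hy.le, le_div_iff₀ (Real.rpow_pos_of_pos hy γ)] at h
    refine le_trans (le_of_eq ?_) h
    rw [Real.rpow_sub hy, Real.rpow_one]
    field_simp

namespace Mesh

variable {d : ℕ} (M : Mesh d)

/-- The implicit upwind scheme preserves nonnegativity of the density. -/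
theorem ContinuityStep.nonneg {ε dt : ℝ} {ϱ' ϱ : M.Cell → ℝ} {u : M.Cell → Pt d}
    (hdt : 0 < dt) (h : M.ContinuityStep ε dt ϱ' ϱ u) (hϱ' : ∀ K, 0 ≤ ϱ' K) (K : M.Cell) :
    0 ≤ ϱ K := by
  by_contra! hK
  set χ : M.Cell → ℝ := fun L => if ϱ L < 0 then 1 else 0 with hχ
  have h1 : ∑ L, M.vol * ((ϱ L - ϱ' L) / dt * χ L) < 0 := by
    have hle : ∀ L, M.vol * ((ϱ L - ϱ' L) / dt * χ L) ≤ 0 := fun L => by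
      by_cases hL : ϱ L < 0
      · simp only [hχ, hL, if_true, mul_one]
        exact mul_nonpos_of_nonneg_of_nonpos M.vol_pos.le
          (div_nonpos_of_nonpos_of_nonneg (by linarith [hϱ' L]) hdt.le)
      · simp [hχ, hL]
    refine Finset.sum_neg' (fun L _ => hle L) ⟨K, Finset.mem_univ K, ?_⟩
    simp only [hχ, hK, if_true, mul_one]
    exact mul_neg_of_pos_of_neg M.vol_pos (div_neg_of_neg_of_pos (by linarith [hϱ' K]) hdt)
  have h2 : 0 ≤ ∑ i, ∑ L, M.area i * (M.flux ε i ϱ u L * M.jump i χ L) := by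
    refine Finset.sum_nonneg fun i _ => Finset.sum_nonneg fun L _ => ?_
    refine mul_nonneg (by rw [area_eq]; exact (div_pos M.vol_pos (M.step_pos i)).le) ?_
    have hs : 0 ≤ M.size ^ ε := Real.rpow_nonneg M.size_nonneg ε
    have hp : 0 ≤ (M.normalVel i u L + |M.normalVel i u L|) / 2 := by
      linarith [neg_abs_le (M.normalVel i u L)]
    have hm : (M.normalVel i u L - |M.normalVel i u L|) / 2 ≤ 0 := by
      linarith [le_abs_self (M.normalVel i u L)]
    unfold flux upwind jump
    set p := (M.normalVel i u L + |M.normalVel i u L|) / 2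
    set m := (M.normalVel i u L - |M.normalVel i u L|) / 2
    by_cases hL : ϱ L < 0 <;> by_cases hL' : ϱ (M.next i L) < 0 <;>
      simp only [hχ, hL, hL', if_true, if_false, sub_self, mul_zero, le_refl]
    · push Not at hL'
      nlinarith [mul_nonneg hs hL', mul_nonneg hs (neg_nonneg.2 hL.le),
        mul_nonneg hp (neg_nonneg.2 hL.le), mul_nonneg hL' (neg_nonneg.2 hm)]
    · push Not at hL
      nlinarith [mul_nonneg hs hL, mul_nonneg hs (neg_nonneg.2 hL'.le),
        mul_nonneg hp hL, mul_nonneg (neg_nonneg.2 hL'.le) (neg_nonneg.2 hm)]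
  have h3 := h χ
  linarith

/-- The total (kinetic and potential) energy of a discrete state. -/
def energy (a γ : ℝ) (ϱ : M.Cell → ℝ) (u : M.Cell → Pt d) : ℝ :=
  ∑ K, M.vol * (ϱ K * (∑ i, u K i ^ 2) / 2 + a / (γ - 1) * ϱ K ^ γ)

/-- The rate of dissipation by the artificial and the physical viscosity. -/
def dissipation (μ ε : ℝ) (ϱ : M.Cell → ℝ) (u : M.Cell → Pt d) : ℝ :=
  ∑ i, ∑ K, M.area i * ((M.size ^ ε * M.avg i ϱ K + μ / M.step i)
    * ∑ j, M.jump i (fun L => u L j) K ^ 2)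

/-- Kinetic part of the face balance. -/
theorem flux_momentum_mul_jump (ε : ℝ) (i : Fin d) (ϱ w : M.Cell → ℝ) (u : M.Cell → Pt d)
    (hϱ : ∀ K, 0 ≤ ϱ K) (K : M.Cell) :
    M.flux ε i (fun L => ϱ L * w L) u K * M.jump i w K
      - M.flux ε i ϱ u K * M.jump i (fun L => w L ^ 2 / 2) K
      ≤ - (M.size ^ ε * M.avg i ϱ K * M.jump i w K ^ 2) := by
  have hp : 0 ≤ (M.normalVel i u K + |M.normalVel i u K|) / 2 := by
    linarith [neg_abs_le (M.normalVel i u K)]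
  have hm : (M.normalVel i u K - |M.normalVel i u K|) / 2 ≤ 0 := by
    linarith [le_abs_self (M.normalVel i u K)]
  unfold flux upwind jump avg
  set p := (M.normalVel i u K + |M.normalVel i u K|) / 2
  set m := (M.normalVel i u K - |M.normalVel i u K|) / 2
  have h1 := mul_nonneg (mul_nonneg hp (hϱ K)) (sq_nonneg (w (M.next i K) - w K))
  have h2 := mul_nonneg (mul_nonneg (neg_nonneg.2 hm) (hϱ (M.next i K)))
    (sq_nonneg (w (M.next i K) - w K))
  nlinarith [h1, h2]

/-- Potential part of the face balance. -/
theorem flux_density_mul_jump (ε : ℝ) {a γ : ℝ} (ha : 0 < a) (hγ : 1 < γ) (i : Fin d)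
    (ϱ : M.Cell → ℝ) (u : M.Cell → Pt d) (hϱ : ∀ K, 0 ≤ ϱ K) (K : M.Cell) :
    M.flux ε i ϱ u K * M.jump i (fun L => a * γ / (γ - 1) * ϱ L ^ (γ - 1)) K
      ≤ M.normalVel i u K * M.jump i (fun L => a * ϱ L ^ γ) K := by
  have hp : 0 ≤ (M.normalVel i u K + |M.normalVel i u K|) / 2 := by
    linarith [neg_abs_le (M.normalVel i u K)]
  have hm : (M.normalVel i u K - |M.normalVel i u K|) / 2 ≤ 0 := by
    linarith [le_abs_self (M.normalVel i u K)]
  have hv : M.normalVel i u K = (M.normalVel i u K + |M.normalVel i u K|) / 2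
      + (M.normalVel i u K - |M.normalVel i u K|) / 2 := by ring
  have hs : 0 ≤ M.size ^ ε := Real.rpow_nonneg M.size_nonneg ε
  simp only [flux, upwind, jump]
  conv_rhs => rw [hv]
  set p := (M.normalVel i u K + |M.normalVel i u K|) / 2
  set m := (M.normalVel i u K - |M.normalVel i u K|) / 2
  set x := ϱ K
  set y := ϱ (M.next i K)
  have hx : 0 ≤ x := hϱ K
  have hy : 0 ≤ y := hϱ _
  have hmul : ∀ z : ℝ, 0 ≤ z → z ^ γ = z * z ^ (γ - 1) := fun z hz => by
    conv_rhs => rw [← Real.rpow_one_add' hz (by linarith)]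
    congr 1; ring
  have t1 := rpow_tangent_le hγ hx hy
  have t2 := rpow_tangent_le hγ hy hx
  rw [hmul x hx, hmul y hy] at t1 t2
  rw [hmul x hx, hmul y hy]
  set X := x ^ (γ - 1)
  set Y := y ^ (γ - 1)
  have hmono : 0 ≤ (y - x) * (Y - X) := by
    rcases le_total x y with hxy | hxy
    · exact mul_nonneg (by linarith) (sub_nonneg.2 (Real.rpow_le_rpow hx hxy (by linarith)))
    · exact mul_nonneg_of_nonpos_of_nonpos (by linarith)
        (sub_nonpos.2 (Real.rpow_le_rpow hy hxy (by linarith)))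
  have hg : 0 < γ - 1 := by linarith
  have e : (x * p + y * m - M.size ^ ε * (y - x)) * (a * γ / (γ - 1) * Y - a * γ / (γ - 1) * X)
      = a / (γ - 1) * (p * (γ * x * (Y - X)) + m * (γ * y * (Y - X))
        - γ * (M.size ^ ε * ((y - x) * (Y - X)))) := by
    field_simp
  have e' : (p + m) * (a * (y * Y) - a * (x * X))
      = a / (γ - 1) * ((p + m) * ((γ - 1) * (y * Y - x * X))) := by
    field_simp
  rw [e, e']
  refine mul_le_mul_of_nonneg_left ?_ (div_pos ha hg).le
  have a1 : p * (γ * x * (Y - X)) ≤ p * ((γ - 1) * (y * Y - x * X)) :=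
    mul_le_mul_of_nonneg_left (by nlinarith) hp
  have a2 : m * (γ * y * (Y - X)) ≤ m * ((γ - 1) * (y * Y - x * X)) :=
    mul_le_mul_of_nonpos_left (by nlinarith) hm
  have a3 := mul_nonneg (by linarith : (0:ℝ) ≤ γ) (mul_nonneg hs hmono)
  linarith

/-- The discrete energy inequality. -/
theorem energy_step {a γ μ lam ε dt : ℝ} (ha : 0 < a) (hγ : 1 < γ) (hlam : -μ ≤ lam)
    (hdt : 0 < dt) {ϱ' ϱ : M.Cell → ℝ} {u' u : M.Cell → Pt d} (hϱ' : ∀ K, 0 ≤ ϱ' K)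
    (hϱ : ∀ K, 0 ≤ ϱ K) (hC : M.ContinuityStep ε dt ϱ' ϱ u)
    (hM : M.MomentumStep a γ μ lam ε dt ϱ' u' ϱ u) :
    M.energy a γ ϱ u + dt * M.dissipation μ ε ϱ u ≤ M.energy a γ ϱ' u' := by
  have hg : 0 < γ - 1 := by linarith
  have hm := hM u
  have h1 := hC (fun K => ∑ j, u K j ^ 2 / 2)
  have h2 := hC (fun K => a * γ / (γ - 1) * ϱ K ^ (γ - 1))
  set q : M.Cell → ℝ := fun K => a * γ / (γ - 1) * ϱ K ^ (γ - 1) with hq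
  set p : M.Cell → ℝ := fun K => a * ϱ K ^ γ with hp
  -- time derivative
  have hT : M.energy a γ ϱ u - M.energy a γ ϱ' u' ≤
      dt * (∑ K, M.vol * ∑ j, (ϱ K * u K j - ϱ' K * u' K j) / dt * u K j
        - ∑ K, M.vol * ((ϱ K - ϱ' K) / dt * ∑ j, u K j ^ 2 / 2)
        + ∑ K, M.vol * ((ϱ K - ϱ' K) / dt * q K)) := by
    unfold energy
    rw [← Finset.sum_sub_distrib, ← Finset.sum_sub_distrib, ← Finset.sum_add_distrib,
      Finset.mul_sum]
    refine Finset.sum_le_sum fun K _ => ?_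
    rw [← mul_sub, ← mul_sub, ← mul_add, mul_left_comm]
    refine mul_le_mul_of_nonneg_left ?_ M.vol_pos.le
    have t := rpow_tangent_le hγ (hϱ' K) (hϱ K)
    have e1 : dt * (∑ j, (ϱ K * u K j - ϱ' K * u' K j) / dt * u K j
        - (ϱ K - ϱ' K) / dt * ∑ j, u K j ^ 2 / 2 + (ϱ K - ϱ' K) / dt * q K)
        = ∑ j, ((ϱ K * u K j - ϱ' K * u' K j) * u K j - (ϱ K - ϱ' K) * (u K j ^ 2 / 2))
          + (ϱ K - ϱ' K) * q K := by
      rw [Finset.sum_sub_distrib, mul_add, mul_sub, Finset.mul_sum, Finset.mul_sum,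
        Finset.mul_sum]
      congr 1
      · congr 1 <;> refine Finset.sum_congr rfl fun j _ => ?_ <;> field_simp
      · field_simp
    rw [e1]
    have e2 : ϱ K * (∑ i, u K i ^ 2) / 2 - ϱ' K * (∑ i, u' K i ^ 2) / 2
        ≤ ∑ j, ((ϱ K * u K j - ϱ' K * u' K j) * u K j - (ϱ K - ϱ' K) * (u K j ^ 2 / 2)) := by
      rw [Finset.mul_sum, Finset.mul_sum, Finset.sum_div, Finset.sum_div,
        ← Finset.sum_sub_distrib]
      refine Finset.sum_le_sum fun j _ => ?_
      nlinarith [mul_nonneg (hϱ' K) (sq_nonneg (u K j - u' K j))]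
    have e3 : a / (γ - 1) * ϱ K ^ γ - a / (γ - 1) * ϱ' K ^ γ ≤ (ϱ K - ϱ' K) * q K := by
      have e4 : (ϱ K - ϱ' K) * q K
          = a / (γ - 1) * (γ * ϱ K ^ (γ - 1) * (ϱ K - ϱ' K)) := by
        simp only [hq]; ring
      rw [e4, ← mul_sub]
      refine mul_le_mul_of_nonneg_left ?_ (div_pos ha hg).le
      linarith
    linarith
  -- faces
  have hF : ∑ i, ∑ K, M.area i * ∑ j, M.flux ε i (fun L => ϱ L * u L j) u K
          * M.jump i (fun L => u L j) K
      - ∑ i, ∑ K, M.area i * (M.flux ε i ϱ u K * M.jump i (fun L => ∑ j, u L j ^ 2 / 2) K)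
      + ∑ i, ∑ K, M.area i * (M.flux ε i ϱ u K * M.jump i q K)
      + ∑ i, ∑ K, M.area i * (M.avg i p K * M.jump i (fun L => u L i) K)
      ≤ - ∑ i, ∑ K, M.area i * (M.size ^ ε * M.avg i ϱ K
        * ∑ j, M.jump i (fun L => u L j) K ^ 2) := by
    rw [← Finset.sum_sub_distrib, ← Finset.sum_add_distrib, ← Finset.sum_add_distrib,
      ← Finset.sum_neg_distrib]
    refine Finset.sum_le_sum fun i _ => ?_
    have hz : ∑ K, (M.normalVel i u K * M.jump i p K + M.avg i p K * M.jump i (fun L => u L i) K)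
        = 0 := by
      have e : ∀ K, M.normalVel i u K * M.jump i p K + M.avg i p K * M.jump i (fun L => u L i) K
          = p (M.next i K) * u (M.next i K) i - p K * u K i := fun K => by
        unfold normalVel avg jump; ring
      simp only [e, Finset.sum_sub_distrib]
      rw [M.sum_next i (fun K => p K * u K i), sub_self]
    have hA : 0 ≤ M.area i := by rw [area_eq]; exact (div_pos M.vol_pos (M.step_pos i)).le
    simp only [← Finset.mul_sum]
    rw [← mul_sub, ← mul_add, ← mul_add, ← mul_neg]
    refine mul_le_mul_of_nonneg_left ?_ hA
    rw [← Finset.sum_sub_distrib, ← Finset.sum_add_distrib, ← Finset.sum_add_distrib,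
      ← Finset.sum_neg_distrib]
    rw [← add_zero (∑ K, - _), ← hz, ← Finset.sum_add_distrib]
    refine Finset.sum_le_sum fun K _ => ?_
    have f1 := M.flux_density_mul_jump ε ha hγ i ϱ u hϱ K
    have f2 : ∑ j, M.flux ε i (fun L => ϱ L * u L j) u K * M.jump i (fun L => u L j) K
        - M.flux ε i ϱ u K * M.jump i (fun L => ∑ j, u L j ^ 2 / 2) K
        ≤ - (M.size ^ ε * M.avg i ϱ K * ∑ j, M.jump i (fun L => u L j) K ^ 2) := by
      have : M.jump i (fun L => ∑ j, u L j ^ 2 / 2) K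
          = ∑ j, M.jump i (fun L => u L j ^ 2 / 2) K := by
        simp only [jump, Finset.sum_sub_distrib]
      rw [this, Finset.mul_sum, Finset.mul_sum, ← Finset.sum_sub_distrib,
        ← Finset.sum_neg_distrib]
      exact Finset.sum_le_sum fun j _ => M.flux_momentum_mul_jump ε i ϱ (fun L => u L j) u hϱ K
    linarith
  have hdiv : 0 ≤ (μ + lam) * ∑ K, M.vol * (M.divh u K * M.divh u K) :=
    mul_nonneg (by linarith) (Finset.sum_nonneg fun K _ =>
      mul_nonneg M.vol_pos.le (mul_self_nonneg _))
  have hD : M.dissipation μ ε ϱ u = ∑ i, ∑ K, M.area i * (M.size ^ ε * M.avg i ϱ K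
        * ∑ j, M.jump i (fun L => u L j) K ^ 2)
      + μ * ∑ i, ∑ K, M.area i * ((1 / M.step i) * ∑ j, M.jump i (fun L => u L j) K
        * M.jump i (fun L => u L j) K) := by
    unfold dissipation
    rw [Finset.mul_sum, ← Finset.sum_add_distrib]
    refine Finset.sum_congr rfl fun i _ => ?_
    rw [Finset.mul_sum, ← Finset.sum_add_distrib]
    refine Finset.sum_congr rfl fun K _ => ?_
    simp only [← pow_two]
    ring
  have : M.energy a γ ϱ u - M.energy a γ ϱ' u' ≤ dt * (- M.dissipation μ ε ϱ u) :=
    hT.trans (mul_le_mul_of_nonneg_left (by rw [hD]; linarith) hdt.le)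
  linarith

end Mesh
end FVNS

namespace FVNS
namespace Mesh

variable {d : ℕ} (M : Mesh d)

/-! ### Consistency of the numerical fluxes -/

theorem abs_sum_mul_le {ι : Type*} [Fintype ι] {f g : ι → ℝ} {c : ℝ} (hg : ∀ i, |g i| ≤ c) :
    |∑ i, f i * g i| ≤ c * ∑ i, |f i| := by
  refine (Finset.abs_sum_le_sum_abs _ _).trans ?_
  rw [Finset.mul_sum]
  refine Finset.sum_le_sum fun i _ => ?_
  rw [abs_mul, mul_comm]
  exact mul_le_mul_of_nonneg_right (hg i) (abs_nonneg _)

/-- `∑ (|q_K| + |q_L|) |⟦w⟧|` over the faces `K | L` in the `i`-th direction. -/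
def jumpWeight (i : Fin d) (q w : M.Cell → ℝ) : ℝ :=
  ∑ K, (|q K| + |q (M.next i K)|) * |M.jump i w K|

theorem jumpWeight_nonneg (i : Fin d) (q w : M.Cell → ℝ) : 0 ≤ M.jumpWeight i q w :=
  Finset.sum_nonneg fun _ _ => by positivity

theorem jumpWeight_eq (i : Fin d) (q w : M.Cell → ℝ) :
    M.jumpWeight i q w = ∑ K, |q K| * (|M.jump i w K| + |M.jump i w (M.prev i K)|) := by
  have h := M.sum_prev i (fun K => |q (M.next i K)| * |M.jump i w K|)
  simp only [next_prev] at h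
  unfold jumpWeight
  simp only [add_mul, mul_add, Finset.sum_add_distrib]
  rw [h]

theorem sum_avg_sub_le (i : Fin d) (s D : M.Cell → ℝ) {δ : ℝ}
    (hD : ∀ K, |D K - D (M.prev i K)| ≤ δ) :
    |∑ K, M.avg i s K * D K - ∑ K, s K * D K| ≤ δ * ∑ K, |s K| := by
  rw [sum_avg_mul, ← Finset.sum_sub_distrib]
  simp only [← mul_sub]
  refine abs_sum_mul_le fun K => ?_
  have e : (D (M.prev i K) + D K) / 2 - D K = -((D K - D (M.prev i K)) / 2) := by ring
  rw [e, abs_neg, abs_div, abs_two]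
  linarith [hD K, abs_nonneg (D K - D (M.prev i K))]

theorem flux_consistency {ε : ℝ} (hε : 0 < ε) (i : Fin d) (q : M.Cell → ℝ) (u : M.Cell → Pt d)
    (D : M.Cell → ℝ) {B δ : ℝ} (hB : ∀ K, |D K| ≤ B) (hD : ∀ K, |D K - D (M.prev i K)| ≤ δ) :
    |∑ K, M.flux ε i q u K * D K - ∑ K, q K * u K i * D K|
      ≤ δ * ∑ K, |q K| + 2 * δ * ∑ K, |q K * u K i|
        + (B + δ) * M.jumpWeight i q (fun L => u L i) := by
  set w : M.Cell → ℝ := fun L => u L i with hw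
  set v := M.normalVel i u with hv
  have hB0 : 0 ≤ B ∨ IsEmpty M.Cell := by
    by_cases h : Nonempty M.Cell
    · exact Or.inl ((abs_nonneg _).trans (hB h.some))
    · exact Or.inr (not_nonempty_iff.1 h)
  rcases hB0 with hB0 | hE
  swap
  · simp [jumpWeight]
  have hδ0 : 0 ≤ δ := (abs_nonneg _).trans (hD (fun _ => 0))
  have hs1 : M.size ^ ε ≤ 1 := Real.rpow_le_one M.size_nonneg M.size_le_one hε.le
  have hs0 : 0 ≤ M.size ^ ε := Real.rpow_nonneg M.size_nonneg ε
  have hsplit : ∑ K, M.flux ε i q u K * D K = ∑ K, M.avg i (fun L => q L * w L) K * D K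
      - ∑ K, (M.jump i q K * M.jump i w K) * (D K / 4)
      - ∑ K, M.jump i q K * (|v K| * D K / 2)
      - ∑ K, M.jump i q K * (M.size ^ ε * D K) := by
    rw [← Finset.sum_sub_distrib, ← Finset.sum_sub_distrib, ← Finset.sum_sub_distrib]
    refine Finset.sum_congr rfl fun K _ => ?_
    simp only [flux, upwind, ← hv]
    have : v K = (w K + w (M.next i K)) / 2 := rfl
    simp only [avg, jump]
    rw [this]; ring
  have h1 := M.sum_avg_sub_le i (fun L => q L * w L) D hD
  have h2 : |∑ K, (M.jump i q K * M.jump i w K) * (D K / 4)| ≤ B / 4 * M.jumpWeight i q w := by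
    refine (abs_sum_mul_le (c := B / 4) fun K => ?_).trans ?_
    · rw [abs_div, abs_of_pos (by norm_num : (0:ℝ) < 4)]; linarith [hB K]
    · refine mul_le_mul_of_nonneg_left (Finset.sum_le_sum fun K _ => ?_) (by linarith)
      rw [abs_mul]
      refine mul_le_mul_of_nonneg_right ?_ (abs_nonneg _)
      rw [add_comm]
      exact abs_sub _ _
  have h3 : |∑ K, M.jump i q K * (|v K| * D K / 2)|
      ≤ δ / 2 * ∑ K, |q K * w K| + (B + δ) / 4 * M.jumpWeight i q w := by
    rw [sum_jump_mul, jumpWeight_eq, Finset.mul_sum, Finset.mul_sum, ← Finset.sum_add_distrib]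
    refine (Finset.abs_sum_le_sum_abs _ _).trans (Finset.sum_le_sum fun K _ => ?_)
    rw [abs_mul, abs_mul]
    have e : δ / 2 * (|q K| * |w K|)
        + (B + δ) / 4 * (|q K| * (|M.jump i w K| + |M.jump i w (M.prev i K)|))
        = |q K| * (δ / 2 * |w K| + (B + δ) / 4 * (|M.jump i w K| + |M.jump i w (M.prev i K)|)) := by
      ring
    rw [e]
    refine mul_le_mul_of_nonneg_left ?_ (abs_nonneg _)
    set J := |M.jump i w K|
    set J' := |M.jump i w (M.prev i K)|
    have j1 : v (M.prev i K) = w K - M.jump i w (M.prev i K) / 2 := by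
      simp only [hv, normalVel, avg, jump, next_prev, hw]; ring
    have j2 : v K = w K + M.jump i w K / 2 := by
      simp only [hv, normalVel, avg, jump, hw]; ring
    have b1 : |v (M.prev i K)| ≤ |w K| + J' / 2 := by
      rw [j1]
      refine (abs_sub _ _).trans ?_
      rw [abs_div, abs_two]
    have b2 : |(|v (M.prev i K)| - |v K|)| ≤ (J + J') / 2 := by
      refine (abs_abs_sub_abs_le _ _).trans ?_
      rw [j1, j2]
      have : w K - M.jump i w (M.prev i K) / 2 - (w K + M.jump i w K / 2)
        = -((M.jump i w K + M.jump i w (M.prev i K)) / 2) := by ring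
      rw [this, abs_neg, abs_div, abs_two]
      have := abs_add_le (M.jump i w K) (M.jump i w (M.prev i K))
      linarith
    have e2 : |v (M.prev i K)| * D (M.prev i K) / 2 - |v K| * D K / 2
        = (-(|v (M.prev i K)| * (D K - D (M.prev i K))) + (|v (M.prev i K)| - |v K|) * D K) / 2 := by
      ring
    rw [e2, abs_div, abs_two]
    have b3 := abs_add_le (-(|v (M.prev i K)| * (D K - D (M.prev i K))))
      ((|v (M.prev i K)| - |v K|) * D K)
    rw [abs_neg, abs_mul, abs_mul, abs_abs] at b3
    have b4 : |v (M.prev i K)| * |D K - D (M.prev i K)| ≤ (|w K| + J' / 2) * δ :=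
      mul_le_mul b1 (hD K) (abs_nonneg _) (by positivity)
    have b5 : |(|v (M.prev i K)| - |v K|)| * |D K| ≤ (J + J') / 2 * B :=
      mul_le_mul b2 (hB K) (abs_nonneg _) (by positivity)
    have b6 : 0 ≤ δ * J := mul_nonneg hδ0 (abs_nonneg _)
    linarith
  have h4 : |∑ K, M.jump i q K * (M.size ^ ε * D K)| ≤ δ * ∑ K, |q K| := by
    rw [sum_jump_mul]
    refine abs_sum_mul_le fun K => ?_
    rw [← mul_sub, abs_mul, abs_of_nonneg hs0, abs_sub_comm]
    calc _ ≤ 1 * |D K - D (M.prev i K)| := mul_le_mul_of_nonneg_right hs1 (abs_nonneg _)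
      _ ≤ δ := by rw [one_mul]; exact hD K
  rw [hsplit]
  have hJ := mul_nonneg hB0 (M.jumpWeight_nonneg i q w)
  have hJ' := mul_nonneg hδ0 (M.jumpWeight_nonneg i q w)
  have hQ : 0 ≤ δ * ∑ K, |q K * w K| := mul_nonneg hδ0 (Finset.sum_nonneg fun _ _ => abs_nonneg _)
  simp only [abs_le] at h1 h2 h3 h4 ⊢
  constructor <;> linarith [h1.1, h1.2, h2.1, h2.2, h3.1, h3.2, h4.1, h4.2]

/-- Replacing cell integrals `Θ K` by `|K| D K`. -/
theorem sum_mul_sub_le (r D Θ : M.Cell → ℝ) {c δ : ℝ} (h : ∀ K, |c * D K - Θ K| ≤ δ) :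
    |c * ∑ K, r K * D K - ∑ K, r K * Θ K| ≤ δ * ∑ K, |r K| := by
  have e : c * ∑ K, r K * D K - ∑ K, r K * Θ K = ∑ K, r K * (c * D K - Θ K) := by
    rw [Finset.mul_sum, ← Finset.sum_sub_distrib]
    exact Finset.sum_congr rfl fun K _ => by ring
  rw [e]
  exact abs_sum_mul_le h

theorem sum_abs_jump_le (i : Fin d) (r : M.Cell → ℝ) :
    ∑ K, |M.jump i r K| ≤ 2 * ∑ K, |r K| := by
  have h := M.sum_next i (fun K => |r K|)
  rw [two_mul]
  nth_rw 1 [← h]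
  rw [← Finset.sum_add_distrib]
  exact Finset.sum_le_sum fun K _ => abs_sub _ _

/-- The integral of the dual gradient against a function whose integrals over the lower and upper
halves of the elements are `Θ₁` and `Θ₂`. -/
def dualSum (i : Fin d) (r Θ₁ Θ₂ : M.Cell → ℝ) : ℝ :=
  ∑ K, (M.jump i r (M.prev i K) / M.step i * Θ₁ K + M.jump i r K / M.step i * Θ₂ K)

theorem dualSum_consistency (i : Fin d) (r D Θ₁ Θ₂ : M.Cell → ℝ) {δ : ℝ}
    (hD : ∀ K, |D K - D (M.prev i K)| ≤ δ)
    (h₁ : ∀ K, |M.vol / 2 * D K - Θ₁ K| ≤ M.vol * δ)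
    (h₂ : ∀ K, |M.vol / 2 * D K - Θ₂ K| ≤ M.vol * δ) :
    |M.vol * ∑ K, M.jump i r K / M.step i * D K - M.dualSum i r Θ₁ Θ₂|
      ≤ 3 * δ * (M.vol * ∑ K, |M.jump i r K / M.step i|) := by
  set g : M.Cell → ℝ := fun K => M.jump i r K / M.step i with hg
  have e1 : M.dualSum i r Θ₁ Θ₂ = ∑ K, g (M.prev i K) * Θ₁ K + ∑ K, g K * Θ₂ K := by
    rw [← Finset.sum_add_distrib]; rfl
  have e2 : ∑ K, g (M.prev i K) * D K = ∑ K, g K * D (M.next i K) := by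
    have h := M.sum_prev i (fun K => g K * D (M.next i K))
    simp only [next_prev] at h
    exact h
  have e3 : ∑ K, |g (M.prev i K)| = ∑ K, |g K| := M.sum_prev i (fun K => |g K|)
  have b1 := M.sum_mul_sub_le (fun K => g (M.prev i K)) D Θ₁ h₁
  have b2 := M.sum_mul_sub_le g D Θ₂ h₂
  have b3 : |∑ K, g K * (D (M.next i K) - D K)| ≤ δ * ∑ K, |g K| := by
    refine abs_sum_mul_le fun K => ?_
    have := hD (M.next i K)
    rwa [prev_next] at this
  have e4 : ∑ K, g K * (D (M.next i K) - D K)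
      = ∑ K, g K * D (M.next i K) - ∑ K, g K * D K := by
    rw [← Finset.sum_sub_distrib]
    exact Finset.sum_congr rfl fun K _ => by ring
  rw [e4] at b3
  simp only [e2, e3] at b1
  have b3' := mul_le_mul_of_nonneg_left b3 M.vol_pos.le
  rw [← abs_of_pos M.vol_pos, ← abs_mul, abs_of_pos M.vol_pos] at b3'
  rw [e1]
  have h0 : 0 ≤ M.vol * (δ * ∑ K, |g K|) := (abs_nonneg _).trans b3'
  simp only [abs_le] at b1 b2 b3' ⊢
  constructor <;> linarith [b1.1, b1.2, b2.1, b2.2, b3'.1, b3'.2]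

theorem abs_dualSum_le (i : Fin d) (r D Θ₁ Θ₂ : M.Cell → ℝ) {δ : ℝ}
    (hD : ∀ K, |D K - D (M.prev i K)| ≤ δ)
    (h₁ : ∀ K, |M.vol / 2 * D K - Θ₁ K| ≤ M.vol * δ)
    (h₂ : ∀ K, |M.vol / 2 * D K - Θ₂ K| ≤ M.vol * δ) :
    |M.dualSum i r Θ₁ Θ₂| ≤ 7 * (δ / M.step i) * (M.vol * ∑ K, |r K|) := by
  have hs := M.step_pos i
  have b := M.dualSum_consistency i r D Θ₁ Θ₂ hD h₁ h₂
  have hδ0 : 0 ≤ δ := (abs_nonneg _).trans (hD (fun _ => 0))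
  have e : ∑ K, |M.jump i r K / M.step i| = (∑ K, |M.jump i r K|) / M.step i := by
    simp only [abs_div, abs_of_pos hs, Finset.sum_div]
  have e' : ∑ K, M.jump i r K / M.step i * D K = (∑ K, M.jump i r K * D K) / M.step i := by
    rw [Finset.sum_div]; exact Finset.sum_congr rfl fun K _ => by ring
  rw [e, e'] at b
  have b1 : |∑ K, M.jump i r K * D K| ≤ δ * ∑ K, |r K| := by
    rw [sum_jump_mul]
    exact abs_sum_mul_le fun K => by rw [abs_sub_comm]; exact hD K
  have b2 : |M.vol * ((∑ K, M.jump i r K * D K) / M.step i)|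
      ≤ (δ / M.step i) * (M.vol * ∑ K, |r K|) := by
    rw [abs_mul, abs_div, abs_of_pos hs, abs_of_pos M.vol_pos]
    calc _ ≤ M.vol * ((δ * ∑ K, |r K|) / M.step i) := by have := M.vol_pos; gcongr
      _ = _ := by ring
  have b3 : 3 * δ * (M.vol * ((∑ K, |M.jump i r K|) / M.step i))
      ≤ 6 * (δ / M.step i) * (M.vol * ∑ K, |r K|) := by
    have := M.sum_abs_jump_le i r
    have hv := M.vol_pos
    calc _ ≤ 3 * δ * (M.vol * ((2 * ∑ K, |r K|) / M.step i)) := by gcongr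
      _ = _ := by ring
  simp only [abs_le] at b b2 ⊢
  constructor <;> linarith [b.1, b.2, b2.1, b2.2]

theorem divh_eq (u : M.Cell → Pt d) (K : M.Cell) :
    M.divh u K = ∑ i, (M.jump i (fun L => u L i) K + M.jump i (fun L => u L i) (M.prev i K))
      / (2 * M.step i) := by
  rw [divh, Finset.mul_sum]
  refine Finset.sum_congr rfl fun i _ => ?_
  have := M.vol_pos.ne'
  have := (M.step_pos i).ne'
  rw [area_eq, normalVel, normalVel]
  simp only [avg, jump, next_prev]
  field_simp
  ring

theorem sum_abs_divh_le (u : M.Cell → Pt d) :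
    ∑ K, |M.divh u K| ≤ ∑ i, ∑ K, |M.jump i (fun L => u L i) K / M.step i| := by
  have h : ∀ K, |M.divh u K| ≤ ∑ i, (|M.jump i (fun L => u L i) K / M.step i|
      + |M.jump i (fun L => u L i) (M.prev i K) / M.step i|) / 2 := fun K => by
    rw [divh_eq]
    refine (Finset.abs_sum_le_sum_abs _ _).trans (Finset.sum_le_sum fun i _ => ?_)
    have hs := M.step_pos i
    rw [abs_div, abs_div, abs_div, abs_of_pos hs, abs_of_pos (by linarith : 0 < 2 * M.step i),
      ← add_div, div_div, mul_comm 2]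
    have := abs_add_le (M.jump i (fun L => u L i) K) (M.jump i (fun L => u L i) (M.prev i K))
    gcongr
  refine (Finset.sum_le_sum fun K _ => h K).trans ?_
  rw [Finset.sum_comm]
  refine (Finset.sum_congr rfl fun i _ => ?_).le
  rw [← Finset.sum_div, Finset.sum_add_distrib,
    M.sum_prev i (fun K => |M.jump i (fun L => u L i) K / M.step i|)]
  ring

/-- The discrete divergence tested with a slowly varying function. -/
theorem abs_sum_divh_mul_le (u : M.Cell → Pt d) (D Θ : M.Cell → ℝ) {δ : ℝ}
    (hD : ∀ j K, |D K - D (M.prev j K)| ≤ δ) (hΘ : ∀ K, |M.vol * D K - Θ K| ≤ M.vol * δ) :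
    |∑ K, M.divh u K * Θ K| ≤ 3 * ∑ j, (δ / M.step j) * (M.vol * ∑ K, |u K j|) := by
  have hv := M.vol_pos
  rcases isEmpty_or_nonempty (Fin d) with hd | ⟨⟨j₀⟩⟩
  · simp [divh]
  have hδ0 : 0 ≤ δ := (abs_nonneg _).trans (hD j₀ (fun _ => 0))
  have b := M.sum_mul_sub_le (M.divh u) D Θ hΘ
  have b1 : M.vol * δ * ∑ K, |M.divh u K|
      ≤ 2 * ∑ j, (δ / M.step j) * (M.vol * ∑ K, |u K j|) := by
    calc _ ≤ M.vol * δ * ∑ i, ∑ K, |M.jump i (fun L => u L i) K / M.step i| := by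
          gcongr; exact M.sum_abs_divh_le u
      _ ≤ M.vol * δ * ∑ i, (2 * ∑ K, |u K i|) / M.step i := by
          gcongr with i _
          have hs := M.step_pos i
          simp only [abs_div, abs_of_pos hs, ← Finset.sum_div]
          have := M.sum_abs_jump_le i (fun L => u L i)
          gcongr
      _ = _ := by
          rw [Finset.mul_sum, Finset.mul_sum]
          exact Finset.sum_congr rfl fun i _ => by ring
  have b2 : |M.vol * ∑ K, M.divh u K * D K|
      ≤ ∑ j, (δ / M.step j) * (M.vol * ∑ K, |u K j|) := by
    have e : M.vol * ∑ K, M.divh u K * D K = ∑ j, M.vol *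
        ((∑ K, u K j * ((D (M.prev j K) - D K) + (D K - D (M.next j K)))) / (2 * M.step j)) := by
      rw [← Finset.mul_sum]
      congr 1
      simp only [divh_eq, Finset.sum_mul]
      rw [Finset.sum_comm]
      refine Finset.sum_congr rfl fun j _ => ?_
      simp only [mul_add, Finset.sum_add_distrib]
      rw [← sum_jump_mul]
      have e2 : ∑ K, u K j * (D K - D (M.next j K))
          = ∑ K, M.jump j (fun L => u L j) K * D (M.next j K) := by
        rw [sum_jump_mul]; simp only [next_prev]
      have e3 : ∑ K, M.jump j (fun L => u L j) (M.prev j K) * D K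
          = ∑ K, M.jump j (fun L => u L j) K * D (M.next j K) := by
        have h := M.sum_prev j (fun K => M.jump j (fun L => u L j) K * D (M.next j K))
        simp only [next_prev] at h
        exact h
      rw [e2, ← e3, ← Finset.sum_add_distrib, Finset.sum_div]
      exact Finset.sum_congr rfl fun K _ => by ring
    rw [e]
    refine (Finset.abs_sum_le_sum_abs _ _).trans (Finset.sum_le_sum fun j _ => ?_)
    have hs := M.step_pos j
    have b3 : |∑ K, u K j * ((D (M.prev j K) - D K) + (D K - D (M.next j K)))|
        ≤ (2 * δ) * ∑ K, |u K j| := by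
      refine abs_sum_mul_le fun K => ?_
      have h1 := hD j K
      have h2 := hD j (M.next j K)
      rw [prev_next] at h2
      rw [abs_sub_comm] at h1 h2
      linarith [abs_add_le (D (M.prev j K) - D K) (D K - D (M.next j K))]
    rw [abs_mul, abs_div, abs_of_pos hv, abs_of_pos (by linarith : 0 < 2 * M.step j)]
    calc _ ≤ M.vol * ((2 * δ * ∑ K, |u K j|) / (2 * M.step j)) := by gcongr
      _ = _ := by field_simp
  simp only [abs_le] at b b2 ⊢
  constructor <;> linarith [b.1, b.2, b2.1, b2.2]

end Mesh
end FVNS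

namespace FVNS

variable {d : ℕ}

/-! ### Integrals over boxes -/

theorem integrableOn_pi_Ico {g : Pt d → ℝ} (hg : Continuous g) (a b : Pt d) :
    IntegrableOn g (pi univ fun i => Ico (a i) (b i)) :=
  (hg.integrableOn_Icc (a := a) (b := b)).mono_set fun _ hx =>
    ⟨fun i => (hx i trivial).1, fun i => (hx i trivial).2.le⟩

theorem measurableSet_pi_Ico (a b : Pt d) :
    MeasurableSet (pi univ fun i => Ico (a i) (b i)) :=
  MeasurableSet.univ_pi fun _ => measurableSet_Ico

theorem volume_pi_Ico_lt_top (a b : Pt d) : volume (pi univ fun i => Ico (a i) (b i)) < ⊤ := by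
  rw [Real.volume_pi_Ico]
  exact ENNReal.prod_lt_top fun i _ => ENNReal.ofReal_lt_top

/-- A continuous function `δ`-close to a constant has an integral close to that of the constant. -/
theorem abs_setIntegral_sub_le {g : Pt d → ℝ} {s : Set (Pt d)} (hg : IntegrableOn g s)
    (hs : volume s < ⊤) {θ δ : ℝ} (h : ∀ x ∈ s, |g x - θ| ≤ δ) :
    |(∫ x in s, g x) - volume.real s * θ| ≤ volume.real s * δ := by
  have e : ∫ x in s, (g x - θ) = (∫ x in s, g x) - volume.real s * θ := by
    rw [integral_sub hg (integrableOn_const hs.ne), setIntegral_const, smul_eq_mul]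
  rw [← e, mul_comm]
  exact norm_setIntegral_le_of_norm_le_const (f := fun x => g x - θ) hs h

theorem continuous_setIntegral_pi_Ico {f : ℝ → Pt d → ℝ}
    (hf : Continuous fun z : ℝ × Pt d => f z.1 z.2) (a b : Pt d) :
    Continuous fun t => ∫ x in pi univ fun i => Ico (a i) (b i), f t x := by
  have h := continuous_parametric_integral_of_continuous (μ := (volume : Measure (Pt d)))
    (f := f) hf (isCompact_Icc (a := a) (b := b))
  convert h using 2
  exact setIntegral_congr_set Measure.univ_pi_Ico_ae_eq_Icc

theorem intervalIntegral_setIntegral_eq_sub {ψ Dt : ℝ → Pt d → ℝ} {t₁ t₂ : ℝ} (ht : t₁ ≤ t₂)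
    (hψ : Continuous fun z : ℝ × Pt d => ψ z.1 z.2)
    (hDt : Continuous fun z : ℝ × Pt d => Dt z.1 z.2)
    (h : ∀ t ∈ Ioo t₁ t₂, ∀ x, HasDerivAt (fun s => ψ s x) (Dt t x) t) (a b : Pt d) :
    ∫ t in t₁..t₂, ∫ x in pi univ fun i => Ico (a i) (b i), Dt t x
      = (∫ x in pi univ fun i => Ico (a i) (b i), ψ t₂ x)
        - ∫ x in pi univ fun i => Ico (a i) (b i), ψ t₁ x := by
  have hi : Integrable (Function.uncurry Dt) ((volume.restrict (Ioc t₁ t₂)).prod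
      (volume.restrict (pi univ fun i => Ico (a i) (b i)))) := by
    rw [Measure.prod_restrict]
    refine IntegrableOn.mono_set (t := Icc (t₁, a) (t₂, b)) ?_ ?_
    · exact (show Continuous (Function.uncurry Dt) from hDt).continuousOn.integrableOn_compact
        isCompact_Icc
    · rintro ⟨t, x⟩ ⟨h1, h2⟩
      exact ⟨⟨h1.1.le, fun i => (h2 i trivial).1⟩, ⟨h1.2, fun i => (h2 i trivial).2.le⟩⟩
  have hc : ∀ t, Continuous (ψ t) := fun t => hψ.comp (by fun_prop : Continuous fun x => (t, x))
  rw [intervalIntegral.integral_of_le ht, integral_integral_swap hi,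
    ← integral_sub (integrableOn_pi_Ico (hc _) a b) (integrableOn_pi_Ico (hc _) a b)]
  refine integral_congr_ae (Filter.Eventually.of_forall fun x => ?_)
  simp only
  rw [← intervalIntegral.integral_of_le ht]
  refine intervalIntegral.integral_eq_sub_of_hasDerivAt_of_le ht ?_ (fun t ht => h t ht x) ?_
  · exact (hψ.comp (by fun_prop : Continuous fun t : ℝ => (t, x))).continuousOn
  · exact (hDt.comp (by fun_prop : Continuous fun t : ℝ => (t, x))).intervalIntegrable _ _

namespace Mesh

variable (M : Mesh d)

/-! ### Geometry of the elements -/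

/-- The lower corner of an element. -/
def corner (K : M.Cell) : Pt d := fun i => ((K i).val : ℝ) * M.step i

/-- The part of an element below its midplane in the `i`-th direction. -/
def lowerHalf (i : Fin d) (K : M.Cell) : Set (Pt d) :=
  pi univ fun j => Ico (M.corner K j)
    ((M.corner K + Function.update M.step i (M.step i / 2)) j)

/-- The part of an element above its midplane in the `i`-th direction. -/
def upperHalf (i : Fin d) (K : M.Cell) : Set (Pt d) :=
  pi univ fun j => Ico ((M.corner K + (Pi.single i (M.step i / 2) : Pt d)) j)
    ((M.corner K + M.step) j)

theorem region_eq (K : M.Cell) :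
    M.region K = pi univ fun i => Ico (M.corner K i) ((M.corner K + M.step) i) := by
  ext x
  simp only [region, corner, mem_ofPred_eq, mem_pi, mem_univ, true_imp_iff, mem_Ico, Pi.add_apply]
  refine forall_congr' fun i => ?_
  rw [add_mul, one_mul]

theorem measurableSet_region (K : M.Cell) : MeasurableSet (M.region K) := by
  rw [region_eq]; exact measurableSet_pi_Ico _ _

theorem volume_region_lt_top (K : M.Cell) : volume (M.region K) < ⊤ := by
  rw [region_eq]; exact volume_pi_Ico_lt_top _ _

theorem volume_region (K : M.Cell) : volume.real (M.region K) = M.vol := by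
  rw [region_eq, Measure.real, Real.volume_pi_Ico_toReal]
  · simp [vol]
  · intro i; simp [(M.step_pos i).le]

theorem volume_lowerHalf (i : Fin d) (K : M.Cell) :
    volume.real (M.lowerHalf i K) = M.vol / 2 := by
  rw [lowerHalf, Measure.real, Real.volume_pi_Ico_toReal]
  · simp only [Pi.add_apply, add_sub_cancel_left]
    rw [Finset.prod_update_of_mem (Finset.mem_univ i), vol,
      ← Finset.mul_prod_erase Finset.univ M.step (Finset.mem_univ i), Finset.sdiff_singleton_eq_erase]
    ring
  · intro j
    simp only [Pi.add_apply, le_add_iff_nonneg_right]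
    by_cases h : j = i
    · subst h; simpa using (half_pos (M.step_pos j)).le
    · simp [h, (M.step_pos j).le]

theorem volume_upperHalf (i : Fin d) (K : M.Cell) :
    volume.real (M.upperHalf i K) = M.vol / 2 := by
  have e : ∀ j, (M.corner K + M.step) j - (M.corner K + (Pi.single i (M.step i / 2) : Pt d)) j
      = Function.update M.step i (M.step i / 2) j := fun j => by
    by_cases h : j = i
    · subst h; simp only [Pi.add_apply, Pi.single_eq_same, Function.update_self]; ring
    · simp [h]
  rw [upperHalf, Measure.real, Real.volume_pi_Ico_toReal]
  · simp only [e]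
    rw [Finset.prod_update_of_mem (Finset.mem_univ i), vol,
      ← Finset.mul_prod_erase Finset.univ M.step (Finset.mem_univ i), Finset.sdiff_singleton_eq_erase]
    ring
  · intro j
    rw [← sub_nonneg, e]
    by_cases h : j = i
    · subst h; simpa using (half_pos (M.step_pos j)).le
    · simp [h, (M.step_pos j).le]

theorem lowerHalf_union_upperHalf (i : Fin d) (K : M.Cell) :
    M.lowerHalf i K ∪ M.upperHalf i K = M.region K := by
  have hs := M.step_pos i
  ext x
  simp only [region_eq, lowerHalf, upperHalf, mem_union, mem_pi, mem_univ, true_imp_iff, mem_Ico,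
    Pi.add_apply]
  constructor
  · rintro (h | h) <;> intro j <;> have hj := h j <;> by_cases hji : j = i
    · subst hji; simp at hj; constructor <;> linarith [hj.1, hj.2]
    · simpa [hji] using hj
    · subst hji; simp at hj; constructor <;> linarith [hj.1, hj.2]
    · simpa [hji] using hj
  · intro h
    rcases lt_or_ge (x i) (M.corner K i + M.step i / 2) with hx | hx
    · left; intro j; by_cases hji : j = i
      · subst hji; simpa using ⟨(h j).1, hx⟩
      · simpa [hji] using h j
    · right; intro j; by_cases hji : j = i
      · subst hji; simpa using ⟨hx, (h j).2⟩
      · simpa [hji] using h j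

theorem disjoint_halves (i : Fin d) (K : M.Cell) :
    Disjoint (M.lowerHalf i K) (M.upperHalf i K) := by
  rw [Set.disjoint_left]
  intro x h1 h2
  have a := (h1 i trivial).2
  have b := (h2 i trivial).1
  simp at a b
  linarith

theorem cellAt_of_mem {x : Pt d} {K : M.Cell} (h : x ∈ M.region K) : M.cellAt x = K := by
  funext i
  have hs := M.step_pos i
  have : ⌊x i / M.step i⌋ = ((K i).val : ℤ) := by
    rw [Int.floor_eq_iff]
    push_cast
    rw [le_div_iff₀ hs, div_lt_iff₀ hs]
    exact h i
  simp [cellAt, this]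

theorem cellAt_sub_of_mem_upperHalf {i : Fin d} {x : Pt d} {K : M.Cell}
    (h : x ∈ M.upperHalf i K) : M.cellAt (x - Pi.single i (M.step i / 2)) = K := by
  apply cellAt_of_mem
  rw [region_eq]
  intro j _
  have hj := h j trivial
  have hs := M.step_pos j
  by_cases hji : j = i
  · subst hji; simp at hj ⊢; constructor <;> linarith [hj.1, hj.2]
  · simpa [hji] using hj

theorem cellAt_sub_of_mem_lowerHalf {i : Fin d} {x : Pt d} {K : M.Cell}
    (h : x ∈ M.lowerHalf i K) :
    M.cellAt (x - Pi.single i (M.step i / 2)) = M.prev i K := by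
  have hK : x ∈ M.region K := by
    rw [← M.lowerHalf_union_upperHalf i K]; exact Or.inl h
  funext j
  by_cases hji : j = i
  · subst hji
    have hs := M.step_pos j
    have hj := h j trivial
    simp only [corner, Pi.add_apply, Function.update_self, mem_Ico] at hj
    have : ⌊(x - (Pi.single j (M.step j / 2) : Pt d)) j / M.step j⌋ = ((K j).val : ℤ) - 1 := by
      rw [Int.floor_eq_iff]
      push_cast
      rw [le_div_iff₀ hs, div_lt_iff₀ hs]
      simp only [Pi.sub_apply, Pi.single_eq_same]
      constructor <;> linarith [hj.1, hj.2]
    simp only [cellAt, this, prev]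
    simp
  · have := congrFun (M.cellAt_of_mem hK) j
    simp [cellAt, prev, hji] at this ⊢
    exact this

theorem region_subset_cube (K : M.Cell) : M.region K ⊆ cube d := by
  intro x hx i
  have hs := M.step_pos i
  refine ⟨le_trans (by positivity) (hx i).1, (hx i).2.trans_le ?_⟩
  have h1 : ((K i).val : ℝ) + 1 ≤ M.n i := by exact_mod_cast ZMod.val_lt (K i)
  have h2 : (0 : ℝ) < M.n i := by exact_mod_cast M.pos i
  rw [step, mul_one_div, div_le_one h2]
  exact h1

theorem iUnion_region : ⋃ K, M.region K = cube d := by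
  refine subset_antisymm (iUnion_subset M.region_subset_cube) fun x hx => ?_
  refine mem_iUnion.2 ⟨M.cellAt x, fun i => ?_⟩
  have hs := M.step_pos i
  have h2 : (0 : ℝ) < M.n i := by exact_mod_cast M.pos i
  have h0 : 0 ≤ ⌊x i / M.step i⌋ := Int.floor_nonneg.2 (div_nonneg (hx i).1 hs.le)
  have h1 : ⌊x i / M.step i⌋ < M.n i := by
    rw [Int.floor_lt, div_lt_iff₀ hs, step]
    push_cast
    rw [mul_one_div_cancel h2.ne']
    exact (hx i).2
  have hv : (((M.cellAt x i).val : ℕ) : ℝ) = ((⌊x i / M.step i⌋ : ℤ) : ℝ) := by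
    have : (((M.cellAt x i).val : ℕ) : ℤ) = ⌊x i / M.step i⌋ := by
      rw [cellAt, ZMod.val_intCast, Int.emod_eq_of_lt h0 h1]
    exact_mod_cast this
  rw [hv, ← le_div_iff₀ hs, ← div_lt_iff₀ hs]
  exact ⟨Int.floor_le _, Int.lt_floor_add_one _⟩

theorem pairwise_disjoint_region : Pairwise (Function.onFun Disjoint M.region) := by
  intro K L hKL
  rw [Function.onFun, Set.disjoint_left]
  intro x hK hL
  exact hKL ((M.cellAt_of_mem hK).symm.trans (M.cellAt_of_mem hL))

theorem integrableOn_region {g : Pt d → ℝ} (hg : Continuous g) (K : M.Cell) :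
    IntegrableOn g (M.region K) := by
  rw [region_eq]; exact integrableOn_pi_Ico hg _ _

theorem integrableOn_cube_iff {G : Pt d → ℝ} :
    IntegrableOn G (cube d) ↔ ∀ K, IntegrableOn G (M.region K) := by
  rw [← M.iUnion_region, integrableOn_finite_iUnion]

theorem setIntegral_cube_eq_sum {G : Pt d → ℝ} (h : IntegrableOn G (cube d)) :
    ∫ x in cube d, G x = ∑ K, ∫ x in M.region K, G x := by
  conv_lhs => rw [← M.iUnion_region]
  exact integral_iUnion_fintype M.measurableSet_region M.pairwise_disjoint_region
    (M.integrableOn_cube_iff.1 h)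

/-- A discrete function times a continuous function. -/
theorem integrableOn_cellAt_mul (r : M.Cell → ℝ) {g : Pt d → ℝ} (hg : Continuous g) :
    IntegrableOn (fun x => r (M.cellAt x) * g x) (cube d) := by
  rw [M.integrableOn_cube_iff]
  intro K
  refine IntegrableOn.congr_fun (f := fun x => r K * g x)
    ((M.integrableOn_region hg K).const_mul (r K)) (fun x hx => ?_) (M.measurableSet_region K)
  simp only [M.cellAt_of_mem hx]

theorem setIntegral_cellAt_mul (r : M.Cell → ℝ) {g : Pt d → ℝ} (hg : Continuous g) :
    ∫ x in cube d, r (M.cellAt x) * g x = ∑ K, r K * ∫ x in M.region K, g x := by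
  rw [M.setIntegral_cube_eq_sum (M.integrableOn_cellAt_mul r hg)]
  refine Finset.sum_congr rfl fun K _ => ?_
  rw [← integral_const_mul]
  refine setIntegral_congr_fun (M.measurableSet_region K) fun x hx => ?_
  simp only [M.cellAt_of_mem hx]

theorem measurableSet_lowerHalf (i : Fin d) (K : M.Cell) : MeasurableSet (M.lowerHalf i K) :=
  measurableSet_pi_Ico _ _

theorem measurableSet_upperHalf (i : Fin d) (K : M.Cell) : MeasurableSet (M.upperHalf i K) :=
  measurableSet_pi_Ico _ _

theorem dualGrad_of_mem_lowerHalf (i : Fin d) (r : M.Cell → ℝ) {K : M.Cell} {x : Pt d}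
    (h : x ∈ M.lowerHalf i K) : M.dualGrad i r x = M.jump i r (M.prev i K) / M.step i := by
  rw [dualGrad, M.cellAt_sub_of_mem_lowerHalf h]

theorem dualGrad_of_mem_upperHalf (i : Fin d) (r : M.Cell → ℝ) {K : M.Cell} {x : Pt d}
    (h : x ∈ M.upperHalf i K) : M.dualGrad i r x = M.jump i r K / M.step i := by
  rw [dualGrad, M.cellAt_sub_of_mem_upperHalf h]

theorem integrableOn_dualGrad_mul_lowerHalf (i : Fin d) (r : M.Cell → ℝ) {g : Pt d → ℝ}
    (hg : Continuous g) (K : M.Cell) :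
    IntegrableOn (fun x => M.dualGrad i r x * g x) (M.lowerHalf i K) := by
  refine IntegrableOn.congr_fun (f := fun x => M.jump i r (M.prev i K) / M.step i * g x)
    ((integrableOn_pi_Ico hg _ _).const_mul _) (fun x hx => ?_) (M.measurableSet_lowerHalf i K)
  simp only [M.dualGrad_of_mem_lowerHalf i r hx]

theorem integrableOn_dualGrad_mul_upperHalf (i : Fin d) (r : M.Cell → ℝ) {g : Pt d → ℝ}
    (hg : Continuous g) (K : M.Cell) :
    IntegrableOn (fun x => M.dualGrad i r x * g x) (M.upperHalf i K) := by
  refine IntegrableOn.congr_fun (f := fun x => M.jump i r K / M.step i * g x)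
    ((integrableOn_pi_Ico hg _ _).const_mul _) (fun x hx => ?_) (M.measurableSet_upperHalf i K)
  simp only [M.dualGrad_of_mem_upperHalf i r hx]

theorem integrableOn_dualGrad_mul (i : Fin d) (r : M.Cell → ℝ) {g : Pt d → ℝ}
    (hg : Continuous g) : IntegrableOn (fun x => M.dualGrad i r x * g x) (cube d) := by
  rw [M.integrableOn_cube_iff]
  intro K
  rw [← M.lowerHalf_union_upperHalf i K]
  exact (M.integrableOn_dualGrad_mul_lowerHalf i r hg K).union
    (M.integrableOn_dualGrad_mul_upperHalf i r hg K)

theorem setIntegral_dualGrad_mul (i : Fin d) (r : M.Cell → ℝ) {g : Pt d → ℝ}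
    (hg : Continuous g) :
    ∫ x in cube d, M.dualGrad i r x * g x = M.dualSum i r
      (fun K => ∫ x in M.lowerHalf i K, g x) (fun K => ∫ x in M.upperHalf i K, g x) := by
  rw [M.setIntegral_cube_eq_sum (M.integrableOn_dualGrad_mul i r hg)]
  refine Finset.sum_congr rfl fun K _ => ?_
  rw [← M.lowerHalf_union_upperHalf i K, setIntegral_union (M.disjoint_halves i K)
    (M.measurableSet_upperHalf i K) (M.integrableOn_dualGrad_mul_lowerHalf i r hg K)
    (M.integrableOn_dualGrad_mul_upperHalf i r hg K), ← integral_const_mul, ← integral_const_mul]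
  congr 1
  · refine setIntegral_congr_fun (M.measurableSet_lowerHalf i K) fun x hx => ?_
    simp only [M.dualGrad_of_mem_lowerHalf i r hx]
  · refine setIntegral_congr_fun (M.measurableSet_upperHalf i K) fun x hx => ?_
    simp only [M.dualGrad_of_mem_upperHalf i r hx]

/-! ### Differences of mean values -/

/-- The corners of neighbouring elements differ by a step, up to an integer vector. -/
theorem corner_next (i : Fin d) (K : M.Cell) : ∃ m : Fin d → ℤ,
    M.corner (M.next i K) = M.corner K + Pi.single i (M.step i) + fun j => (m j : ℝ) := by
  refine ⟨Pi.single i (-(((K i).val + 1) / M.n i : ℕ) : ℤ), ?_⟩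
  funext j
  by_cases hji : j = i
  · subst hji
    have h2 : (0 : ℝ) < M.n j := by exact_mod_cast M.pos j
    have hv : (M.next j K j).val = ((K j).val + 1) % M.n j := by
      simp only [next, Pi.add_apply, Pi.single_eq_same]
      rw [ZMod.val_add, ZMod.val_one_eq_one_mod, Nat.add_mod_mod]
    have hd : ((((K j).val + 1) % M.n j : ℕ) : ℝ)
        = (K j).val + 1 - M.n j * (((K j).val + 1) / M.n j : ℕ) := by
      rw [eq_sub_iff_add_eq]
      exact_mod_cast Nat.mod_add_div ((K j).val + 1) (M.n j)
    simp only [corner, hv, hd, Pi.add_apply, Pi.single_eq_same, Int.cast_neg, Int.cast_natCast]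
    rw [step]
    field_simp
    ring
  · simp [corner, next, hji]

theorem setIntegral_region_eq_translate (K L : M.Cell) (ψ : Pt d → ℝ) :
    ∫ x in M.region L, ψ x = ∫ x in M.region K, ψ (x + (M.corner L - M.corner K)) := by
  have h := (measurePreserving_add_right (volume : Measure (Pt d))
    (M.corner L - M.corner K)).setIntegral_preimage_emb
    (measurableEmbedding_addRight _) ψ (M.region L)
  rw [← h]
  congr 2
  ext x
  simp only [region_eq, mem_preimage, mem_pi, mem_univ, true_imp_iff, mem_Ico, Pi.add_apply,
    Pi.sub_apply]
  refine forall_congr' fun j => ?_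
  constructor <;> rintro ⟨h1, h2⟩ <;> constructor <;> linarith

theorem jump_proj_div_step_sub_le {ψ θ : Pt d → ℝ} (hψ : Continuous ψ) (i : Fin d)
    (hper : ∀ (x : Pt d) (m : Fin d → ℤ), ψ (x + fun i => (m i : ℝ)) = ψ x)
    (hderiv : ∀ (x : Pt d) (s : ℝ),
      HasDerivAt (fun s => ψ (x + Pi.single i s)) (θ (x + Pi.single i s)) s)
    (K : M.Cell) {c δ : ℝ}
    (h : ∀ x ∈ M.region K, ∀ s ∈ Ioo 0 (M.step i), |θ (x + Pi.single i s) - c| ≤ δ) :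
    |M.jump i (M.proj ψ) K / M.step i - c| ≤ δ := by
  have hs := M.step_pos i
  have hv := M.vol_pos
  obtain ⟨m, hm⟩ := M.corner_next i K
  have e1 : ∫ x in M.region (M.next i K), ψ x
      = ∫ x in M.region K, ψ (x + Pi.single i (M.step i)) := by
    rw [M.setIntegral_region_eq_translate K]
    refine integral_congr_ae (Filter.Eventually.of_forall fun x => ?_)
    simp only
    rw [hm, ← hper (x + (Pi.single i (M.step i) : Pt d)) m]
    congr 1
    abel
  have hi1 : IntegrableOn (fun x => ψ (x + Pi.single i (M.step i))) (M.region K) :=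
    M.integrableOn_region (hψ.comp (by fun_prop)) K
  have e2 : M.jump i (M.proj ψ) K / M.step i
      = (1 / M.vol) * ∫ x in M.region K, (ψ (x + Pi.single i (M.step i)) - ψ x) / M.step i := by
    rw [integral_div, integral_sub hi1 (M.integrableOn_region hψ K), jump, proj, proj, e1]
    ring
  have hi2 : IntegrableOn (fun x => (ψ (x + Pi.single i (M.step i)) - ψ x) / M.step i)
      (M.region K) := M.integrableOn_region (by fun_prop) K
  have hp : ∀ x ∈ M.region K, |(ψ (x + Pi.single i (M.step i)) - ψ x) / M.step i - c| ≤ δ := by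
    intro x hx
    obtain ⟨s, hs', he⟩ := exists_hasDerivAt_eq_slope (fun s => ψ (x + Pi.single i s))
      (fun s => θ (x + Pi.single i s)) hs
      (fun s _ => (hderiv x s).continuousAt.continuousWithinAt) (fun s _ => hderiv x s)
    simp only [Pi.single_zero, add_zero, sub_zero] at he
    rw [← he]
    exact h x hx s hs'
  have hfin := abs_setIntegral_sub_le hi2 (M.volume_region_lt_top K) hp
  rw [volume_region] at hfin
  rw [e2]
  have e3 : (1 / M.vol) * ∫ x in M.region K, (ψ (x + Pi.single i (M.step i)) - ψ x) / M.step i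
      = (∫ x in M.region K, (ψ (x + Pi.single i (M.step i)) - ψ x) / M.step i) / M.vol := by ring
  rw [e3]
  have e4 : (∫ x in M.region K, (ψ (x + Pi.single i (M.step i)) - ψ x) / M.step i) / M.vol - c
      = ((∫ x in M.region K, (ψ (x + Pi.single i (M.step i)) - ψ x) / M.step i) - M.vol * c)
        / M.vol := by field_simp
  rw [e4, abs_div, abs_of_pos hv, div_le_iff₀ hv, mul_comm δ]
  exact hfin

theorem norm_sub_corner_le {K : M.Cell} {x : Pt d} (hx : x ∈ M.region K) :
    ‖x - M.corner K‖ ≤ M.size := by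
  rw [pi_norm_le_iff_of_nonneg M.size_nonneg]
  intro i
  have h := hx i
  rw [Real.norm_eq_abs, Pi.sub_apply, corner, abs_of_nonneg (by linarith [h.1])]
  linarith [h.2, M.step_le_size i]

theorem corner_mem_region (K : M.Cell) : M.corner K ∈ M.region K := fun i => by
  have := M.step_pos i
  simp only [corner]
  constructor <;> linarith

end Mesh
end FVNS

namespace FVNS

variable {d : ℕ}

/-! ### Test functions -/

/-- A scalar function on `ℝ × Ω` that vanishes at time `T`, with its derivatives in time (on
`(0,T)`) and space, the latter bounded and Lipschitz with constant `B`. -/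
structure TestData (T B : ℝ) (ψ Dt : ℝ → Pt d → ℝ) (Dx : Fin d → ℝ → Pt d → ℝ) : Prop where
  cont : Continuous fun z : ℝ × Pt d => ψ z.1 z.2
  cont_dt : Continuous fun z : ℝ × Pt d => Dt z.1 z.2
  cont_dx : ∀ j, Continuous fun z : ℝ × Pt d => Dx j z.1 z.2
  final : ∀ x, ψ T x = 0
  periodic : ∀ (t : ℝ) (x : Pt d) (m : Fin d → ℤ), ψ t (x + fun i => (m i : ℝ)) = ψ t x
  deriv_time : ∀ t ∈ Ioo 0 T, ∀ x, HasDerivAt (fun s => ψ s x) (Dt t x) t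
  deriv_space : ∀ (j : Fin d) (t : ℝ) (x : Pt d) (s : ℝ),
    HasDerivAt (fun s => ψ t (x + Pi.single j s)) (Dx j t (x + Pi.single j s)) s
  bound : ∀ j t x, |Dx j t x| ≤ B
  lip : ∀ j t s x y, |Dx j t x - Dx j s y| ≤ B * (|t - s| + ‖x - y‖)

namespace TestData

variable {T B : ℝ} {ψ Dt : ℝ → Pt d → ℝ} {Dx : Fin d → ℝ → Pt d → ℝ}

theorem continuous_slice (h : TestData T B ψ Dt Dx) (t : ℝ) : Continuous (ψ t) :=
  h.cont.comp (by fun_prop : Continuous fun x => (t, x))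

theorem continuous_dt_slice (h : TestData T B ψ Dt Dx) (t : ℝ) : Continuous (Dt t) :=
  h.cont_dt.comp (by fun_prop : Continuous fun x => (t, x))

theorem continuous_dx_slice (h : TestData T B ψ Dt Dx) (j : Fin d) (t : ℝ) :
    Continuous (Dx j t) :=
  (h.cont_dx j).comp (by fun_prop : Continuous fun x => (t, x))

theorem periodic_dx (h : TestData T B ψ Dt Dx) (j : Fin d) (t : ℝ) (x : Pt d) (m : Fin d → ℤ) :
    Dx j t (x + fun i => (m i : ℝ)) = Dx j t x := by
  have h1 := h.deriv_space j t (x + fun i => (m i : ℝ)) 0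
  have h2 := h.deriv_space j t x 0
  have e : (fun s => ψ t ((x + fun i => (m i : ℝ)) + Pi.single j s))
      = fun s => ψ t (x + Pi.single j s) := by
    funext s
    rw [← h.periodic t (x + (Pi.single j s : Pt d)) m]
    congr 1
    abel
  rw [e] at h1
  simpa using h1.unique h2

end TestData

section

variable {F : Type} [NormedAddCommGroup F] [NormedSpace ℝ F] {T : ℝ} {φ : ℝ → Pt d → F}

theorem uniqueDiffOn_cylinder (T : ℝ) :
    UniqueDiffOn ℝ (Ico 0 T ×ˢ (univ : Set (Pt d))) :=
  (uniqueDiffOn_Ico 0 T).prod uniqueDiffOn_univ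

open scoped Pointwise in
/-- The derivatives of a test function of order at most three are bounded. -/
theorem IsTest.bddAbove (h : IsTest T φ) {m : ℕ} (hm : m ≤ 3) :
    BddAbove (range fun z : (Ico (0 : ℝ) T ×ˢ (univ : Set (Pt d)) : Set (ℝ × Pt d)) =>
      ‖iteratedFDerivWithin ℝ m (fun z : ℝ × Pt d => φ z.1 z.2) (Ico 0 T ×ˢ univ) z‖) := by
  obtain ⟨T', hT', hz⟩ := h.support
  set f : ℝ × Pt d → F := fun z => φ z.1 z.2 with hf
  set S : Set (ℝ × Pt d) := Ico (0 : ℝ) T ×ˢ univ with hS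
  have hc : ContinuousOn (iteratedFDerivWithin ℝ m f S) S :=
    h.smooth.continuousOn_iteratedFDerivWithin (by exact_mod_cast hm) (uniqueDiffOn_cylinder T)
  set T₁ := (T' + T) / 2 with hT₁
  have hT₁1 : T' < T₁ := by rw [hT₁]; linarith
  have hT₁2 : T₁ < T := by rw [hT₁]; linarith
  have hcomp : IsCompact (Icc (0 : ℝ) T₁ ×ˢ Icc (0 : Pt d) 1) := isCompact_Icc.prod isCompact_Icc
  have hsub : Icc (0 : ℝ) T₁ ×ˢ Icc (0 : Pt d) 1 ⊆ S := fun z hz' =>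
    ⟨⟨hz'.1.1, hz'.1.2.trans_lt hT₁2⟩, trivial⟩
  obtain ⟨C, hC⟩ := (hcomp.image_of_continuousOn (hc.mono hsub).norm).bddAbove
  refine ⟨max C 0, ?_⟩
  rintro _ ⟨⟨⟨t, x⟩, ht, -⟩, rfl⟩
  simp only at ht ⊢
  rcases le_or_gt t T₁ with htT | htT
  · refine le_max_of_le_left ?_
    set a : ℝ × Pt d := (0, fun i => ((-⌊x i⌋ : ℤ) : ℝ)) with ha
    have haS : a +ᵥ S = S := by
      ext ⟨t', y⟩
      simp [hS, ha, mem_vadd_set_iff_neg_vadd_mem]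
    have e1 := iteratedFDerivWithin_comp_add_right (𝕜 := ℝ) (f := f) (s := S) m a (t, x)
    rw [haS] at e1
    have e2 : iteratedFDerivWithin ℝ m (fun z => f (z + a)) S (t, x)
        = iteratedFDerivWithin ℝ m f S (t, x) := by
      refine iteratedFDerivWithin_congr (fun z hz' => ?_) (show (t, x) ∈ S from ⟨ht, trivial⟩) m
      have := h.periodic z.1 hz'.1 z.2 (fun i => -⌊x i⌋)
      simpa [hf, ha] using this
    rw [← e2, e1]
    refine hC ⟨_, ⟨⟨?_, ?_⟩, ?_⟩, rfl⟩
    · simpa [ha] using ht.1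
    · simpa [ha] using htT
    · constructor <;> intro i
      · simpa [ha] using Int.floor_le (x i)
      · have := (Int.lt_floor_add_one (x i)).le
        simp only [ha, Prod.mk_add_mk, Pi.add_apply, Int.cast_neg, Pi.one_apply]
        linarith
  · refine le_max_of_le_right ?_
    have hev : f =ᶠ[nhdsWithin (t, x) S] fun _ => 0 := by
      have : {z : ℝ × Pt d | T' < z.1} ∈ nhds (t, x) :=
        (isOpen_lt continuous_const continuous_fst).mem_nhds (hT₁1.trans htT)
      filter_upwards [mem_nhdsWithin_of_mem_nhds this, self_mem_nhdsWithin] with z hz1 hz2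
      exact hz z.1 hz2.1 (le_of_lt hz1) z.2
    rw [hev.iteratedFDerivWithin_eq (hz t ht (hT₁1.trans htT).le x) m]
    simp

theorem IsTest.norm_iteratedFDerivWithin_le (h : IsTest T φ) {m : ℕ} (hm : m ≤ 2)
    {z : ℝ × Pt d} (hz : z ∈ Ico 0 T ×ˢ (univ : Set (Pt d))) :
    ‖iteratedFDerivWithin ℝ m (fun z : ℝ × Pt d => φ z.1 z.2) (Ico 0 T ×ˢ univ) z‖
      ≤ cNorm T 2 φ := by
  refine (le_ciSup (h.bddAbove (hm.trans (by norm_num))) ⟨z, hz⟩).trans ?_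
  exact Finset.single_le_sum (f := fun m => ⨆ z : (Ico (0 : ℝ) T ×ˢ (univ : Set (Pt d)) :
      Set (ℝ × Pt d)),
    ‖iteratedFDerivWithin ℝ m (fun z : ℝ × Pt d => φ z.1 z.2) (Ico 0 T ×ˢ univ) z‖)
    (fun m _ => Real.iSup_nonneg fun _ => norm_nonneg _)
    (Finset.mem_range.2 (Nat.lt_succ_of_le hm))

theorem cNorm_nonneg (T : ℝ) (k : ℕ) (φ : ℝ → Pt d → F) : 0 ≤ cNorm T k φ :=
  Finset.sum_nonneg fun _ _ => Real.iSup_nonneg fun _ => norm_nonneg _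

/-- The scalar components of a test function, extended continuously in time. -/
theorem IsTest.exists_testData (h : IsTest T φ) (hT : 0 < T) (L : F →L[ℝ] ℝ) (hL : ‖L‖ ≤ 1) :
    ∃ (ψ Dt : ℝ → Pt d → ℝ) (Dx : Fin d → ℝ → Pt d → ℝ),
      TestData T (cNorm T 2 φ) ψ Dt Dx ∧ (∀ t ∈ Ico 0 T, ∀ x, L (φ t x) = ψ t x) ∧
      (∀ t ∈ Ioo 0 T, ∀ x, deriv (fun s => L (φ s x)) t = Dt t x) ∧
      (∀ t ∈ Ico 0 T, ∀ x j, pd j (fun y => L (φ t y)) x = Dx j t x) := by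
  obtain ⟨T', hT', hz⟩ := h.support
  set f : ℝ × Pt d → F := fun z => φ z.1 z.2 with hf
  set S : Set (ℝ × Pt d) := Ico (0 : ℝ) T ×ˢ univ with hS
  set B := cNorm T 2 φ with hB
  have hB0 : 0 ≤ B := cNorm_nonneg T 2 φ
  have hU : UniqueDiffOn ℝ S := uniqueDiffOn_cylinder T
  set T₁ := max ((T' + T) / 2) 0 with hT₁
  have hT₁0 : 0 ≤ T₁ := le_max_right _ _
  have hT₁1 : T' < T₁ := lt_of_lt_of_le (by linarith) (le_max_left _ _)
  have hT₁2 : T₁ < T := max_lt (by linarith) hT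
  set c : ℝ → ℝ := fun t => max 0 (min t T₁) with hc
  have hcc : Continuous c := by fun_prop
  have hcS : ∀ t x, (c t, x) ∈ S := fun t x =>
    ⟨⟨le_max_left _ _, (max_le hT₁0 (min_le_right _ _)).trans_lt hT₁2⟩, trivial⟩
  have hc_eq : ∀ t, 0 ≤ t → t ≤ T₁ → c t = t := fun t h0 h1 => by
    simp [hc, min_eq_left h1, max_eq_right h0]
  have hc_eq' : ∀ t, T₁ ≤ t → c t = T₁ := fun t h1 => by
    simp [hc, min_eq_right h1, max_eq_right hT₁0]
  have hclip : ∀ s t, |c t - c s| ≤ |t - s| := fun s t => by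
    refine (abs_max_sub_max_le_max _ _ _ _).trans ?_
    simp only [sub_self, abs_zero]
    refine max_le (abs_nonneg _) ((abs_min_sub_min_le_max _ _ _ _).trans ?_)
    simp
  set f' : ℝ × Pt d → (ℝ × Pt d →L[ℝ] F) := fderivWithin ℝ f S with hf'
  have hfd : ∀ z ∈ S, HasFDerivWithinAt f (f' z) S z := fun z hzS =>
    ((h.smooth.differentiableOn (by norm_num)) z hzS).hasFDerivWithinAt
  have hf'd : ContDiffOn ℝ 2 f' S := h.smooth.fderivWithin hU (by norm_num)
  have hbound : ∀ z ∈ S, ‖f' z‖ ≤ B := fun z hzS => by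
    rw [hf', ← norm_iteratedFDerivWithin_one f (hU z hzS)]
    exact h.norm_iteratedFDerivWithin_le (by norm_num) hzS
  have hlip : ∀ z ∈ S, ∀ w ∈ S, ‖f' w - f' z‖ ≤ B * ‖w - z‖ := fun z hzS w hwS => by
    refine Convex.norm_image_sub_le_of_norm_fderivWithin_le (𝕜 := ℝ)
      (hf'd.differentiableOn (by norm_num)) (fun y hy => ?_)
      ((convex_Ico 0 T).prod convex_univ) hzS hwS
    rw [← norm_iteratedFDerivWithin_one f' (hU y hy), norm_iteratedFDerivWithin_fderivWithin hU hy]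
    exact h.norm_iteratedFDerivWithin_le (by norm_num) hy
  have hzero : ∀ t, T' < t → t < T → 0 ≤ t → ∀ x, f' (t, x) = 0 := fun t h1 h2 h0 x => by
    have hev : f =ᶠ[nhdsWithin (t, x) S] fun _ => 0 := by
      have : {z : ℝ × Pt d | T' < z.1} ∈ nhds (t, x) :=
        (isOpen_lt continuous_const continuous_fst).mem_nhds h1
      filter_upwards [mem_nhdsWithin_of_mem_nhds this, self_mem_nhdsWithin] with z hz1 hz2
      exact hz z.1 hz2.1 (le_of_lt hz1) z.2
    rw [hf', hev.fderivWithin_eq (hz t ⟨h0, h2⟩ h1.le x)]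
    simp
  have hφc : ∀ t ∈ Ico 0 T, ∀ x, φ (c t) x = φ t x := fun t ht x => by
    rcases le_or_gt t T₁ with h1 | h1
    · rw [hc_eq t ht.1 h1]
    · rw [hc_eq' t h1.le, hz t ht (hT₁1.trans h1).le, hz T₁ ⟨hT₁0, hT₁2⟩ hT₁1.le]
  have hf'c : ∀ t ∈ Ico 0 T, ∀ x, f' (c t, x) = f' (t, x) := fun t ht x => by
    rcases le_or_gt t T₁ with h1 | h1
    · rw [hc_eq t ht.1 h1]
    · rw [hc_eq' t h1.le, hzero t (hT₁1.trans h1) ht.2 ht.1, hzero T₁ hT₁1 hT₁2 hT₁0]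
  have hcz : Continuous fun z : ℝ × Pt d => (c z.1, z.2) := by fun_prop
  have hf'cont : Continuous fun z : ℝ × Pt d => f' (c z.1, z.2) :=
    hf'd.continuousOn.comp_continuous hcz fun z => hcS _ _
  have hspace : ∀ (t : ℝ), t ∈ Ico 0 T → ∀ y : Pt d, HasFDerivAt (fun y => L (φ t y))
      (L ∘L (f' (t, y)) ∘L (ContinuousLinearMap.inr ℝ ℝ (Pt d))) y := fun t ht y => by
    have hmaps : MapsTo (fun y : Pt d => (t, y)) univ S := fun _ _ => ⟨ht, trivial⟩
    have h1 := HasFDerivWithinAt.comp (f := fun y : Pt d => (t, y)) (s := univ) y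
      (hfd (t, y) ⟨ht, trivial⟩)
      (hasFDerivAt_prodMk_right (𝕜 := ℝ) t y).hasFDerivWithinAt hmaps
    exact L.hasFDerivAt.comp y (hasFDerivWithinAt_univ.1 h1)
  have htime : ∀ t ∈ Ioo 0 T, ∀ x, HasDerivAt (fun s => L (φ s x)) (L (f' (t, x) (1, 0))) t :=
    fun t ht x => by
    have hn : S ∈ nhds (t, x) := prod_mem_nhds (Ico_mem_nhds ht.1 ht.2) Filter.univ_mem
    have h1 := ((hfd (t, x) ⟨⟨ht.1.le, ht.2⟩, trivial⟩).hasFDerivAt hn).comp_hasDerivAt t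
      ((hasDerivAt_id t).prodMk (hasDerivAt_const t x))
    exact L.hasFDerivAt.comp_hasDerivAt t h1
  have he : ∀ j : Fin d, ‖((0 : ℝ), (Pi.single j 1 : Pt d))‖ ≤ 1 := fun j => by
    simp [Prod.norm_def, Pi.norm_single]
  have happly : ∀ (A : ℝ × Pt d →L[ℝ] F) (j : Fin d), |L (A (0, Pi.single j 1))| ≤ ‖A‖ :=
    fun A j => by
    calc |L (A (0, Pi.single j 1))| ≤ ‖L‖ * ‖A (0, Pi.single j 1)‖ := L.le_opNorm _
      _ ≤ 1 * (‖A‖ * 1) := by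
        gcongr
        exact A.le_opNorm_of_le (he j)
      _ = ‖A‖ := by ring
  refine ⟨fun t x => L (φ (c t) x), fun t x => L (f' (c t, x) (1, 0)),
    fun j t x => L (f' (c t, x) (0, Pi.single j 1)), ?_, ?_, ?_, ?_⟩
  · refine ⟨?_, ?_, ?_, ?_, ?_, ?_, ?_, ?_, ?_⟩
    · exact L.continuous.comp (h.smooth.continuousOn.comp_continuous hcz fun z => hcS _ _)
    · exact L.continuous.comp (hf'cont.clm_apply continuous_const)
    · exact fun j => L.continuous.comp (hf'cont.clm_apply continuous_const)
    · intro x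
      rw [hc_eq' T hT₁2.le, hz T₁ ⟨hT₁0, hT₁2⟩ hT₁1.le, map_zero]
    · intro t x m
      rw [h.periodic (c t) (hcS t x).1]
    · intro t ht x
      rw [hf'c t ⟨ht.1.le, ht.2⟩]
      refine (htime t ht x).congr_of_eventuallyEq ?_
      filter_upwards [Ioo_mem_nhds ht.1 ht.2] with s hs
      rw [hφc s ⟨hs.1.le, hs.2⟩]
    · intro j t x s
      have h1 := (hspace (c t) (hcS t x).1 (x + Pi.single j s)).comp_hasDerivAt s
        ((hasDerivAt_const s x).add (hasDerivAt_single j s))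
      simp only [ContinuousLinearMap.comp_apply, ContinuousLinearMap.inr_apply, zero_add] at h1
      exact h1
    · exact fun j t x => (happly _ j).trans (hbound _ (hcS t x))
    · intro j t s x y
      rw [← map_sub, ← sub_apply]
      refine (happly _ j).trans ((hlip _ (hcS s y) _ (hcS t x)).trans ?_)
      refine mul_le_mul_of_nonneg_left ?_ hB0
      rw [Prod.mk_sub_mk, Prod.norm_def]
      refine max_le ?_ ?_
      · exact (hclip s t).trans (le_add_of_nonneg_right (norm_nonneg _))
      · exact le_add_of_nonneg_left (abs_nonneg _)
  · intro t ht x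
    simp only
    rw [hφc t ht]
  · intro t ht x
    simp only
    rw [hf'c t ⟨ht.1.le, ht.2⟩]
    exact (htime t ht x).deriv
  · intro t ht x j
    simp only
    rw [hf'c t ht, pd, (hspace t ht x).fderiv]
    simp

end

end FVNS

namespace FVNS

variable {d : ℕ}

/-! ### The residual of a discrete balance law -/

/-- Splitting a time integral into the time steps. -/
theorem intervalIntegral_eq_sum_steps {T dt : ℝ} {N : ℕ} (hdt : 0 ≤ dt) (hT : N * dt = T)
    {f : ℝ → ℝ} {H : ℕ → ℝ → ℝ} (hH : ∀ k, Continuous (H k))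
    (h : ∀ k < N, ∀ t ∈ Ioo (k * dt) ((k + 1 : ℕ) * dt), f t = H k t) :
    ∫ t in (0 : ℝ)..T, f t
      = ∑ k ∈ Finset.range N, ∫ t in (k * dt)..((k + 1 : ℕ) * dt), H k t := by
  have hle : ∀ k : ℕ, (k : ℝ) * dt ≤ (k + 1 : ℕ) * dt := fun k => by
    push_cast; nlinarith
  have hi : ∀ k < N, IntervalIntegrable f volume (k * dt) ((k + 1 : ℕ) * dt) := fun k hk => by
    rw [intervalIntegrable_iff_integrableOn_Ioo_of_le (hle k)]
    refine IntegrableOn.congr_fun (f := H k) ?_ (fun t ht => (h k hk t ht).symm) measurableSet_Ioo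
    exact ((hH k).integrableOn_Icc).mono_set Ioo_subset_Icc_self
  have hs := intervalIntegral.sum_integral_adjacent_intervals (a := fun k : ℕ => (k : ℝ) * dt) hi
  simp only [Nat.cast_zero, zero_mul] at hs
  rw [← hT, ← hs]
  refine Finset.sum_congr rfl fun k hk => ?_
  rw [intervalIntegral.integral_of_le (hle k), intervalIntegral.integral_of_le (hle k),
    integral_Ioc_eq_integral_Ioo, integral_Ioc_eq_integral_Ioo]
  exact setIntegral_congr_fun measurableSet_Ioo fun t ht => h k (Finset.mem_range.1 hk) t ht

/-- Summation by parts in time. -/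
theorem abel_sum {ι : Type*} [Fintype ι] (q A : ℕ → ι → ℝ) (n : ℕ) :
    - ∑ K, q 0 K * A 0 K - ∑ k ∈ Finset.range (n + 1), ∑ K, q k K * (A (k + 1) K - A k K)
      = ∑ k ∈ Finset.range n, ∑ K, (q (k + 1) K - q k K) * A (k + 1) K
        - ∑ K, q n K * A (n + 1) K := by
  induction n with
  | zero =>
    simp only [zero_add, Finset.range_one, Finset.sum_singleton, mul_sub, Finset.sum_sub_distrib,
      Finset.range_zero, Finset.sum_empty]
    ring
  | succ n ih =>
    rw [Finset.sum_range_succ _ (n + 1), ← sub_sub, ih, Finset.sum_range_succ _ n]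
    simp only [mul_sub, sub_mul, Finset.sum_sub_distrib]
    ring

/-- The residual of a balance law in terms of the residuals of the single time steps. -/
theorem abs_balance_residual_le {ι : Type*} [Fintype ι] {dt : ℝ} {N : ℕ} (hN : 0 < N)
    (hdt : 0 < dt) (q A : ℕ → ι → ℝ) (hA : ∀ K, A N K = 0) {Φ : ℕ → ℝ → ℝ}
    (hΦ : ∀ k, Continuous (Φ k)) {E : ℕ → ℝ}
    (h0 : ∀ t ∈ Icc 0 dt, |Φ 0 t| ≤ E 0)
    (h : ∀ k, 1 ≤ k → k < N → ∀ t ∈ Icc (k * dt) ((k + 1 : ℕ) * dt),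
      |∑ K, (q k K - q (k - 1) K) / dt * A k K - Φ k t| ≤ E k) :
    |- ∑ K, q 0 K * A 0 K - ∑ k ∈ Finset.range N, ∑ K, q k K * (A (k + 1) K - A k K)
      - ∑ k ∈ Finset.range N, ∫ t in (k * dt)..((k + 1 : ℕ) * dt), Φ k t|
      ≤ dt * ∑ k ∈ Finset.range N, E k := by
  obtain ⟨n, rfl⟩ := Nat.exists_eq_succ_of_ne_zero hN.ne'
  rw [Nat.succ_eq_add_one] at *
  have hA' : ∑ K, q n K * A (n + 1) K = 0 :=
    Finset.sum_eq_zero fun K _ => by rw [hA K, mul_zero]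
  rw [abel_sum, hA', sub_zero, Finset.sum_range_succ' (fun k : ℕ => ∫ t in (k * dt)..((k + 1 : ℕ) * dt), Φ k t),
    ← sub_sub, ← Finset.sum_sub_distrib, Finset.sum_range_succ', mul_add, Finset.mul_sum]
  refine (abs_sub _ _).trans (add_le_add ((Finset.abs_sum_le_sum_abs _ _).trans
    (Finset.sum_le_sum fun k hk => ?_)) ?_)
  · have hk' := h (k + 1) (by omega) (by have := Finset.mem_range.1 hk; omega)
    simp only [Nat.add_sub_cancel] at hk'
    have hlen : ((k + 1 + 1 : ℕ) : ℝ) * dt - (k + 1 : ℕ) * dt = dt := by push_cast; ring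
    have hle : ((k + 1 : ℕ) : ℝ) * dt ≤ (k + 1 + 1 : ℕ) * dt := by linarith
    have e : ∑ K, (q (k + 1) K - q k K) * A (k + 1) K
        = ∫ _t in ((k + 1 : ℕ) * dt)..((k + 1 + 1 : ℕ) * dt),
          ∑ K, (q (k + 1) K - q k K) / dt * A (k + 1) K := by
      rw [intervalIntegral.integral_const, hlen, smul_eq_mul, Finset.mul_sum]
      refine Finset.sum_congr rfl fun K _ => ?_
      field_simp
    rw [e, ← intervalIntegral.integral_sub intervalIntegrable_const
      ((hΦ _).intervalIntegrable _ _)]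
    have := intervalIntegral.norm_integral_le_of_norm_le_const (a := ((k + 1 : ℕ) : ℝ) * dt)
      (b := ((k + 1 + 1 : ℕ) : ℝ) * dt)
      (f := fun t => ∑ K, (q (k + 1) K - q k K) / dt * A (k + 1) K - Φ (k + 1) t)
      (C := E (k + 1)) (fun t ht => by
        rw [uIoc_of_le hle] at ht
        exact hk' t ⟨ht.1.le, ht.2⟩)
    rw [hlen, abs_of_pos hdt, mul_comm (E (k + 1))] at this
    exact this
  · have := intervalIntegral.norm_integral_le_of_norm_le_const (a := ((0 : ℕ) : ℝ) * dt)
      (b := ((0 + 1 : ℕ) : ℝ) * dt) (f := Φ 0) (C := E 0) (fun t ht => by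
        rw [uIoc_of_le (by simpa using hdt.le)] at ht
        exact h0 t ⟨by simpa using ht.1.le, by simpa using ht.2⟩)
    simp only [Nat.cast_zero, zero_mul, zero_add, Nat.cast_one, one_mul, sub_zero,
      abs_of_pos hdt] at this ⊢
    rw [mul_comm]
    exact this

namespace Mesh

variable (M : Mesh d) {T B : ℝ} {ψ Dt : ℝ → Pt d → ℝ} {Dx : Fin d → ℝ → Pt d → ℝ}

/-- The difference quotient of the projected test function. -/
def quot (j : Fin d) (f : Pt d → ℝ) (K : M.Cell) : ℝ := M.jump j (M.proj f) K / M.step j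

theorem abs_quot_le (h : TestData T B ψ Dt Dx) (j : Fin d) (t : ℝ) (K : M.Cell) :
    |M.quot j (ψ t) K| ≤ B := by
  have := M.jump_proj_div_step_sub_le (h.continuous_slice t) j (h.periodic t)
    (h.deriv_space j t) K (c := 0) (δ := B) (fun x _ s _ => by
      rw [sub_zero]; exact h.bound j t _)
  rwa [sub_zero] at this

theorem abs_quot_sub_le (h : TestData T B ψ Dt Dx) (hB : 0 ≤ B) (j : Fin d) (s t : ℝ) {K : M.Cell}
    {x : Pt d} (hx : x ∈ M.region K) :
    |M.quot j (ψ s) K - Dx j t x| ≤ B * (|s - t| + 3 * M.size) := by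
  refine M.jump_proj_div_step_sub_le (h.continuous_slice s) j (h.periodic s)
    (h.deriv_space j s) K (fun y hy r hr => ?_)
  refine (h.lip j s t _ x).trans (mul_le_mul_of_nonneg_left (add_le_add le_rfl ?_) hB)
  have e : y + Pi.single j r - x
      = (y - M.corner K) - (x - M.corner K) + Pi.single j r := by abel
  rw [e]
  have h1 := M.norm_sub_corner_le hx
  have h2 := M.norm_sub_corner_le hy
  have h3 : ‖(Pi.single j r : Pt d)‖ ≤ M.size := by
    rw [Pi.norm_single, Real.norm_eq_abs, abs_of_pos hr.1]
    exact hr.2.le.trans (M.step_le_size j)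
  have h4 := norm_add_le ((y - M.corner K) - (x - M.corner K)) (Pi.single j r)
  have h5 := norm_sub_le (y - M.corner K) (x - M.corner K)
  linarith

theorem abs_quot_sub_prev_le (h : TestData T B ψ Dt Dx) (hB : 0 ≤ B) (i j : Fin d) (t : ℝ)
    (K : M.Cell) :
    |M.quot i (ψ t) K - M.quot i (ψ t) (M.prev j K)| ≤ B * (7 * M.size) := by
  have h1 := M.abs_quot_sub_le h hB i t t (M.corner_mem_region K)
  have h2 := M.abs_quot_sub_le h hB i t t (M.corner_mem_region (M.prev j K))
  obtain ⟨m, hm⟩ := M.corner_next j (M.prev j K)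
  rw [next_prev] at hm
  have h3 := h.lip i t t (M.corner (M.prev j K) + Pi.single j (M.step j)) (M.corner (M.prev j K))
  rw [← h.periodic_dx i t _ m, ← hm, add_sub_cancel_left, Pi.norm_single, Real.norm_eq_abs,
    abs_of_pos (M.step_pos j), sub_self, abs_zero, zero_add] at h3
  rw [sub_self, abs_zero, zero_add] at h1 h2
  have h4 := mul_le_mul_of_nonneg_left (M.step_le_size j) hB
  rw [abs_le] at *
  constructor <;> linarith [h1.1, h1.2, h2.1, h2.2, h3.1, h3.2]

/-- Integrals of a slowly varying function over parts of an element. -/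
theorem abs_mul_quot_sub_setIntegral_le (h : TestData T B ψ Dt Dx) (hB : 0 ≤ B) (j : Fin d)
    (s t : ℝ) {K : M.Cell} {S : Set (Pt d)} (hS : S ⊆ M.region K) :
    |volume.real S * M.quot j (ψ s) K - ∫ x in S, Dx j t x|
      ≤ volume.real S * (B * (|s - t| + 3 * M.size)) := by
  rw [abs_sub_comm]
  refine abs_setIntegral_sub_le
    ((M.integrableOn_region (h.continuous_dx_slice j t) K).mono_set hS)
    ((measure_mono hS).trans_lt (M.volume_region_lt_top K)) fun x hx => ?_
  rw [abs_sub_comm]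
  exact M.abs_quot_sub_le h hB j s t (hS hx)

/-- The flux of a balance law with convective part `q u`, stress `s` in direction `i₀` and
diffusion of `r`, tested with the gradient `Dx` at time `t`. -/
def weakFlux (Dx : Fin d → ℝ → Pt d → ℝ) (i₀ : Fin d) (ν : ℝ) (q s r : M.Cell → ℝ)
    (u : M.Cell → Pt d) (t : ℝ) : ℝ :=
  ∑ j, ∑ K, q K * u K j * (∫ x in M.region K, Dx j t x)
    + ∑ K, s K * (∫ x in M.region K, Dx i₀ t x)
    - ν * ∑ j, M.dualSum j r (fun K => ∫ x in M.lowerHalf j K, Dx j t x)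
      (fun K => ∫ x in M.upperHalf j K, Dx j t x)

theorem continuous_weakFlux (h : TestData T B ψ Dt Dx) (i₀ : Fin d) (ν : ℝ) (q s r : M.Cell → ℝ)
    (u : M.Cell → Pt d) : Continuous (M.weakFlux Dx i₀ ν q s r u) := by
  have h1 : ∀ j K, Continuous fun t => ∫ x in M.region K, Dx j t x := fun j K => by
    simp only [region_eq]
    exact continuous_setIntegral_pi_Ico (h.cont_dx j) _ _
  have h2 : ∀ j K, Continuous fun t => ∫ x in M.lowerHalf j K, Dx j t x := fun j K =>
    continuous_setIntegral_pi_Ico (h.cont_dx j) _ _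
  have h3 : ∀ j K, Continuous fun t => ∫ x in M.upperHalf j K, Dx j t x := fun j K =>
    continuous_setIntegral_pi_Ico (h.cont_dx j) _ _
  unfold weakFlux dualSum
  fun_prop

/-- The numerical flux tested with the discrete gradient of the projected test function. -/
def discreteFlux (ε : ℝ) (i₀ : Fin d) (ν : ℝ) (q s r : M.Cell → ℝ) (u : M.Cell → Pt d)
    (φ : M.Cell → ℝ) : ℝ :=
  ∑ j, ∑ K, M.area j * (M.flux ε j q u K * M.jump j φ K)
    + ∑ K, M.area i₀ * (M.avg i₀ s K * M.jump i₀ φ K)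
    - ν * ∑ j, ∑ K, M.area j * (M.jump j r K / M.step j * M.jump j φ K)

theorem discreteFlux_proj (ε : ℝ) (i₀ : Fin d) (ν : ℝ) (q s r : M.Cell → ℝ) (u : M.Cell → Pt d)
    (f : Pt d → ℝ) : M.discreteFlux ε i₀ ν q s r u (M.proj f)
      = ∑ j, M.vol * ∑ K, M.flux ε j q u K * M.quot j f K
        + M.vol * ∑ K, M.avg i₀ s K * M.quot i₀ f K
        - ν * ∑ j, M.vol * ∑ K, M.jump j r K / M.step j * M.quot j f K := by
  have e : ∀ (j : Fin d) (g : M.Cell → ℝ), ∑ K, M.area j * (g K * M.jump j (M.proj f) K)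
      = M.vol * ∑ K, g K * M.quot j f K := fun j g => by
    rw [Finset.mul_sum]
    refine Finset.sum_congr rfl fun K _ => ?_
    rw [area_eq, quot]
    ring
  simp only [discreteFlux, e]

/-- The consistency error of a balance law. -/
def fluxError (B δ ν : ℝ) (q s r : M.Cell → ℝ) (u : M.Cell → Pt d) : ℝ :=
  ∑ j, (δ * (M.vol * ∑ K, |q K|) + 3 * δ * (M.vol * ∑ K, |q K * u K j|)
      + (B + δ) * (M.vol * M.jumpWeight j q (fun L => u L j)))
    + 2 * δ * (M.vol * ∑ K, |s K|)
    + 3 * ν * δ * ∑ j, M.vol * ∑ K, |M.jump j r K / M.step j|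

theorem discreteFlux_sub_weakFlux_le (h : TestData T B ψ Dt Dx) (hB : 0 ≤ B) {ε : ℝ} (hε : 0 < ε)
    (i₀ : Fin d) {ν : ℝ} (hν : 0 ≤ ν) (q s r : M.Cell → ℝ) (u : M.Cell → Pt d) {t₀ t δ : ℝ}
    (hδ₁ : B * (|t₀ - t| + 3 * M.size) ≤ δ) (hδ₂ : B * (7 * M.size) ≤ δ) :
    |M.discreteFlux ε i₀ ν q s r u (M.proj (ψ t₀)) - M.weakFlux Dx i₀ ν q s r u t|
      ≤ M.fluxError B δ ν q s r u := by
  have hv := M.vol_pos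
  set D : Fin d → M.Cell → ℝ := fun j => M.quot j (ψ t₀) with hDdef
  have hD : ∀ i j K, |D i K - D i (M.prev j K)| ≤ δ := fun i j K =>
    (M.abs_quot_sub_prev_le h hB i j t₀ K).trans hδ₂
  have hΘ : ∀ j K, |M.vol * D j K - ∫ x in M.region K, Dx j t x| ≤ M.vol * δ := fun j K => by
    have := M.abs_mul_quot_sub_setIntegral_le h hB j t₀ t (K := K) subset_rfl
    rw [volume_region] at this
    exact this.trans (mul_le_mul_of_nonneg_left hδ₁ hv.le)
  have hδ0 : 0 ≤ δ := (mul_nonneg hB (by have := M.size_nonneg; positivity)).trans hδ₂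
  have hhalf : M.vol / 2 * δ ≤ M.vol * δ := by nlinarith
  have hΘ₁ : ∀ j K, |M.vol / 2 * D j K - ∫ x in M.lowerHalf j K, Dx j t x| ≤ M.vol * δ :=
    fun j K => by
    have := M.abs_mul_quot_sub_setIntegral_le h hB j t₀ t (K := K) (S := M.lowerHalf j K)
      (by rw [← M.lowerHalf_union_upperHalf j K]; exact subset_union_left)
    rw [volume_lowerHalf] at this
    exact (this.trans (mul_le_mul_of_nonneg_left hδ₁ (by linarith))).trans hhalf
  have hΘ₂ : ∀ j K, |M.vol / 2 * D j K - ∫ x in M.upperHalf j K, Dx j t x| ≤ M.vol * δ :=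
    fun j K => by
    have := M.abs_mul_quot_sub_setIntegral_le h hB j t₀ t (K := K) (S := M.upperHalf j K)
      (by rw [← M.lowerHalf_union_upperHalf j K]; exact subset_union_right)
    rw [volume_upperHalf] at this
    exact (this.trans (mul_le_mul_of_nonneg_left hδ₁ (by linarith))).trans hhalf
  have t1 : |∑ j, M.vol * ∑ K, M.flux ε j q u K * D j K
      - ∑ j, ∑ K, q K * u K j * (∫ x in M.region K, Dx j t x)|
      ≤ ∑ j, (δ * (M.vol * ∑ K, |q K|) + 3 * δ * (M.vol * ∑ K, |q K * u K j|)
      + (B + δ) * (M.vol * M.jumpWeight j q (fun L => u L j))) := by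
    rw [← Finset.sum_sub_distrib]
    refine (Finset.abs_sum_le_sum_abs _ _).trans (Finset.sum_le_sum fun j _ => ?_)
    have a1 := M.flux_consistency hε j q u (D j) (M.abs_quot_le h j t₀) (hD j j)
    have a2 := M.sum_mul_sub_le (fun K => q K * u K j) (D j) _ (hΘ j)
    have a3 := mul_le_mul_of_nonneg_left a1 hv.le
    rw [← abs_of_pos hv, ← abs_mul, abs_of_pos hv] at a3
    rw [abs_le] at *
    constructor <;> linarith [a2.1, a2.2, a3.1, a3.2]
  have t2 : |M.vol * ∑ K, M.avg i₀ s K * D i₀ K - ∑ K, s K * (∫ x in M.region K, Dx i₀ t x)|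
      ≤ 2 * δ * (M.vol * ∑ K, |s K|) := by
    have a1 := M.sum_avg_sub_le i₀ s (D i₀) (hD i₀ i₀)
    have a2 := M.sum_mul_sub_le s (D i₀) _ (hΘ i₀)
    have a3 := mul_le_mul_of_nonneg_left a1 hv.le
    rw [← abs_of_pos hv, ← abs_mul, abs_of_pos hv] at a3
    rw [abs_le] at *
    constructor <;> linarith [a2.1, a2.2, a3.1, a3.2]
  have t3 : |ν * (∑ j, M.vol * ∑ K, M.jump j r K / M.step j * D j K)
      - ν * ∑ j, M.dualSum j r (fun K => ∫ x in M.lowerHalf j K, Dx j t x)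
      (fun K => ∫ x in M.upperHalf j K, Dx j t x)|
      ≤ 3 * ν * δ * ∑ j, M.vol * ∑ K, |M.jump j r K / M.step j| := by
    rw [← mul_sub, abs_mul, abs_of_nonneg hν, ← Finset.sum_sub_distrib, mul_comm 3 ν, mul_assoc ν,
      mul_assoc ν]
    refine mul_le_mul_of_nonneg_left ?_ hν
    rw [Finset.mul_sum]
    refine (Finset.abs_sum_le_sum_abs _ _).trans (Finset.sum_le_sum fun j _ => ?_)
    exact M.dualSum_consistency j r (D j) _ _ (hD j j) (hΘ₁ j) (hΘ₂ j)
  rw [discreteFlux_proj, weakFlux, fluxError]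
  rw [abs_le] at *
  constructor <;> linarith [t1.1, t1.2, t2.1, t2.2, t3.1, t3.2]

theorem abs_weakFlux_le (h : TestData T B ψ Dt Dx) (hB : 0 ≤ B)
    (i₀ : Fin d) {ν η : ℝ} (hν : 0 ≤ ν) (hη : M.IsRegular η) (q p w r : M.Cell → ℝ) (κ : ℝ)
    (hκ : 0 ≤ κ) (u : M.Cell → Pt d) (hw : ∀ K, w K = p K - κ * M.divh u K) (t : ℝ) :
    |M.weakFlux Dx i₀ ν q w r u t|
      ≤ B * (∑ j, M.vol * ∑ K, |q K * u K j| + M.vol * ∑ K, |p K|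
        + 21 * κ * η * (∑ j, M.vol * ∑ K, |u K j|)
        + 49 * ν * η * (d * (M.vol * ∑ K, |r K|))) := by
  have hv := M.vol_pos
  set δ := B * (7 * M.size) with hδ
  have hh := M.size_nonneg
  have hδ0 : 0 ≤ δ := mul_nonneg hB (by linarith)
  have hδ₁ : B * (|t - t| + 3 * M.size) ≤ δ := by
    rw [sub_self, abs_zero]
    exact mul_le_mul_of_nonneg_left (by linarith) hB
  have hδη : ∀ j, δ / M.step j ≤ 7 * B * η := fun j => by
    have := mul_le_mul_of_nonneg_left (hη j) (by linarith : 0 ≤ 7 * B)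
    calc δ / M.step j = 7 * B * (M.size / M.step j) := by rw [hδ]; ring
      _ ≤ _ := this
  set D : Fin d → M.Cell → ℝ := fun j => M.quot j (ψ t) with hDdef
  have hD : ∀ i j K, |D i K - D i (M.prev j K)| ≤ δ := fun i j K =>
    M.abs_quot_sub_prev_le h hB i j t K
  have hΘ : ∀ j K, |M.vol * D j K - ∫ x in M.region K, Dx j t x| ≤ M.vol * δ := fun j K => by
    have := M.abs_mul_quot_sub_setIntegral_le h hB j t t (K := K) subset_rfl
    rw [volume_region] at this
    exact this.trans (mul_le_mul_of_nonneg_left hδ₁ hv.le)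
  have hhalf : M.vol / 2 * δ ≤ M.vol * δ := by nlinarith
  have hΘ₁ : ∀ j K, |M.vol / 2 * D j K - ∫ x in M.lowerHalf j K, Dx j t x| ≤ M.vol * δ :=
    fun j K => by
    have := M.abs_mul_quot_sub_setIntegral_le h hB j t t (K := K) (S := M.lowerHalf j K)
      (by rw [← M.lowerHalf_union_upperHalf j K]; exact subset_union_left)
    rw [volume_lowerHalf] at this
    exact (this.trans (mul_le_mul_of_nonneg_left hδ₁ (by linarith))).trans hhalf
  have hΘ₂ : ∀ j K, |M.vol / 2 * D j K - ∫ x in M.upperHalf j K, Dx j t x| ≤ M.vol * δ :=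
    fun j K => by
    have := M.abs_mul_quot_sub_setIntegral_le h hB j t t (K := K) (S := M.upperHalf j K)
      (by rw [← M.lowerHalf_union_upperHalf j K]; exact subset_union_right)
    rw [volume_upperHalf] at this
    exact (this.trans (mul_le_mul_of_nonneg_left hδ₁ (by linarith))).trans hhalf
  have hΘB : ∀ j K, |∫ x in M.region K, Dx j t x| ≤ M.vol * B := fun j K => by
    have := abs_setIntegral_sub_le (M.integrableOn_region (h.continuous_dx_slice j t) K)
      (M.volume_region_lt_top K) (θ := 0) (δ := B)
      (fun x _ => by rw [sub_zero]; exact h.bound j t x)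
    rwa [volume_region, mul_zero, sub_zero] at this
  have t1 : |∑ j, ∑ K, q K * u K j * (∫ x in M.region K, Dx j t x)|
      ≤ B * ∑ j, M.vol * ∑ K, |q K * u K j| := by
    rw [Finset.mul_sum]
    refine (Finset.abs_sum_le_sum_abs _ _).trans (Finset.sum_le_sum fun j _ => ?_)
    refine (abs_sum_mul_le (hΘB j)).trans (le_of_eq (by ring))
  have t2 : |∑ K, w K * (∫ x in M.region K, Dx i₀ t x)|
      ≤ B * (M.vol * ∑ K, |p K|) + κ * (3 * ∑ j, (7 * B * η) * (M.vol * ∑ K, |u K j|)) := by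
    have e : ∑ K, w K * (∫ x in M.region K, Dx i₀ t x)
        = ∑ K, p K * (∫ x in M.region K, Dx i₀ t x)
          - κ * ∑ K, M.divh u K * (∫ x in M.region K, Dx i₀ t x) := by
      rw [Finset.mul_sum, ← Finset.sum_sub_distrib]
      exact Finset.sum_congr rfl fun K _ => by rw [hw K]; ring
    rw [e]
    refine (abs_sub _ _).trans (add_le_add ?_ ?_)
    · exact (abs_sum_mul_le (hΘB i₀)).trans (le_of_eq (by ring))
    · rw [abs_mul, abs_of_nonneg hκ]
      refine mul_le_mul_of_nonneg_left ((M.abs_sum_divh_mul_le u (D i₀) _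
        (fun j K => hD i₀ j K) (hΘ i₀)).trans ?_) hκ
      gcongr with j _
      exact hδη j
  have t3 : |ν * ∑ j, M.dualSum j r (fun K => ∫ x in M.lowerHalf j K, Dx j t x)
      (fun K => ∫ x in M.upperHalf j K, Dx j t x)|
      ≤ ν * (d * (7 * (7 * B * η) * (M.vol * ∑ K, |r K|))) := by
    rw [abs_mul, abs_of_nonneg hν]
    refine mul_le_mul_of_nonneg_left ((Finset.abs_sum_le_sum_abs _ _).trans ?_) hν
    have : ∀ j ∈ Finset.univ, |M.dualSum j r (fun K => ∫ x in M.lowerHalf j K, Dx j t x)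
      (fun K => ∫ x in M.upperHalf j K, Dx j t x)| ≤ 7 * (7 * B * η) * (M.vol * ∑ K, |r K|) :=
      fun j _ => by
      refine (M.abs_dualSum_le j r (D j) _ _ (hD j j) (hΘ₁ j) (hΘ₂ j)).trans ?_
      gcongr
      exact hδη j
    refine (Finset.sum_le_sum this).trans ?_
    simp
  rw [← Finset.mul_sum] at t2
  rw [weakFlux]
  rw [abs_le] at *
  constructor <;> linarith [t1.1, t1.2, t2.1, t2.2, t3.1, t3.2]

end Mesh
end FVNS

namespace FVNS

variable {d : ℕ}

theorem timeExt_eq {α : Type} {dt t : ℝ} (hdt : 0 < dt) {k : ℕ} (v : ℕ → α)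
    (ht : t ∈ Ioo (k * dt) ((k + 1 : ℕ) * dt)) : timeExt dt v t = v k := by
  have h0 : 0 ≤ t / dt := div_nonneg (le_trans (by positivity) ht.1.le) hdt.le
  have : ⌊t / dt⌋₊ = k := by
    rw [Nat.floor_eq_iff h0, le_div_iff₀ hdt, div_lt_iff₀ hdt]
    refine ⟨ht.1.le, ?_⟩
    have := ht.2
    push_cast at this
    exact this
  rw [timeExt, this]

theorem mem_Ioo_of_mem_step {T dt t : ℝ} {N k : ℕ} (hdt : 0 < dt) (hT : N * dt = T) (hk : k < N)
    (ht : t ∈ Ioo (k * dt) ((k + 1 : ℕ) * dt)) : t ∈ Ioo 0 T := by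
  refine ⟨lt_of_le_of_lt (by positivity) ht.1, ht.2.trans_le ?_⟩
  rw [← hT]
  exact mul_le_mul_of_nonneg_right (by exact_mod_cast hk) hdt.le

namespace Mesh

variable (M : Mesh d) {T B : ℝ} {ψ Dt : ℝ → Pt d → ℝ} {Dx : Fin d → ℝ → Pt d → ℝ}

theorem continuous_timePart (h : TestData T B ψ Dt Dx) (q : M.Cell → ℝ) :
    Continuous fun t => ∑ K, q K * ∫ x in M.region K, Dt t x := by
  have h1 : ∀ K, Continuous fun t => ∫ x in M.region K, Dt t x := fun K => by
    simp only [region_eq]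
    exact continuous_setIntegral_pi_Ico h.cont_dt _ _
  fun_prop

theorem vol_mul_proj (f : Pt d → ℝ) (K : M.Cell) : M.vol * M.proj f K = ∫ x in M.region K, f x := by
  rw [proj, ← mul_assoc, mul_one_div_cancel M.vol_pos.ne', one_mul]

/-- The residual of the weak formulation of a discrete balance law. -/
theorem abs_weak_residual_le (h : TestData T B ψ Dt Dx) (hB : 0 ≤ B) {dt ε ν : ℝ} {N : ℕ}
    (hN : 0 < N) (hdt : 0 < dt) (hT : N * dt = T) (hε : 0 < ε) (hν : 0 ≤ ν) (i₀ : Fin d)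
    (q s r : ℕ → M.Cell → ℝ) (u : ℕ → M.Cell → Pt d)
    (hscheme : ∀ k, 1 ≤ k → k ≤ N → ∀ φ : M.Cell → ℝ,
      ∑ K, M.vol * ((q k K - q (k - 1) K) / dt * φ K)
        = M.discreteFlux ε i₀ ν (q k) (s k) (r k) (u k) φ)
    {E : ℕ → ℝ} (h0 : ∀ t, |M.weakFlux Dx i₀ ν (q 0) (s 0) (r 0) (u 0) t| ≤ E 0)
    (hE : ∀ k, 1 ≤ k → k < N →
      M.fluxError B (B * (dt + 7 * M.size)) ν (q k) (s k) (r k) (u k) ≤ E k) :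
    |- ∑ K, q 0 K * (∫ x in M.region K, ψ 0 x)
      - ∑ k ∈ Finset.range N, ∫ t in (k * dt)..((k + 1 : ℕ) * dt),
        (∑ K, q k K * (∫ x in M.region K, Dt t x)
          + M.weakFlux Dx i₀ ν (q k) (s k) (r k) (u k) t)|
      ≤ dt * ∑ k ∈ Finset.range N, E k := by
  have hsz := M.size_nonneg
  set A : ℕ → M.Cell → ℝ := fun k K => ∫ x in M.region K, ψ (k * dt) x with hA
  have hAN : ∀ K, A N K = 0 := fun K => by
    simp only [hA, hT, h.final, integral_zero]
  have hc := fun k => M.continuous_weakFlux h i₀ ν (q k) (s k) (r k) (u k)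
  have main := abs_balance_residual_le hN hdt q A hAN
    (Φ := fun k t => M.weakFlux Dx i₀ ν (q k) (s k) (r k) (u k) t) hc (E := E)
    (fun t _ => h0 t) (fun k hk1 hkN t ht => by
      have e : ∑ K, (q k K - q (k - 1) K) / dt * A k K
          = M.discreteFlux ε i₀ ν (q k) (s k) (r k) (u k) (M.proj (ψ (k * dt))) := by
        rw [← hscheme k hk1 hkN.le]
        refine Finset.sum_congr rfl fun K _ => ?_
        rw [mul_left_comm, vol_mul_proj]
      rw [e]
      refine (M.discreteFlux_sub_weakFlux_le h hB hε i₀ hν _ _ _ _ ?_ ?_).trans (hE k hk1 hkN)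
      · refine mul_le_mul_of_nonneg_left (add_le_add ?_ (by linarith)) hB
        have h1 := ht.2
        push_cast at h1
        rw [abs_sub_comm, abs_of_nonneg (sub_nonneg.2 ht.1)]
        linarith
      · exact mul_le_mul_of_nonneg_left (by linarith) hB)
  have e0 : ∀ K, A 0 K = ∫ x in M.region K, ψ 0 x := fun K => by simp [hA]
  have ek : ∀ k ∈ Finset.range N, ∫ t in (k * dt)..((k + 1 : ℕ) * dt),
        (∑ K, q k K * (∫ x in M.region K, Dt t x)
          + M.weakFlux Dx i₀ ν (q k) (s k) (r k) (u k) t)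
      = ∑ K, q k K * (A (k + 1) K - A k K) + ∫ t in (k * dt)..((k + 1 : ℕ) * dt),
          M.weakFlux Dx i₀ ν (q k) (s k) (r k) (u k) t := fun k hk => by
    have hle : (k : ℝ) * dt ≤ (k + 1 : ℕ) * dt := by push_cast; nlinarith
    rw [intervalIntegral.integral_add ((M.continuous_timePart h (q k)).intervalIntegrable _ _)
      ((hc k).intervalIntegrable _ _), intervalIntegral.integral_finsetSum]
    · congr 1
      refine Finset.sum_congr rfl fun K _ => ?_
      rw [intervalIntegral.integral_const_mul]
      congr 1
      simp only [hA, region_eq]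
      exact intervalIntegral_setIntegral_eq_sub hle h.cont h.cont_dt (fun t ht x =>
        h.deriv_time t (mem_Ioo_of_mem_step hdt hT (Finset.mem_range.1 hk) ht) x) _ _
    · intro K _
      simp only [region_eq]
      exact ((continuous_setIntegral_pi_Ico h.cont_dt _ _).const_mul _).intervalIntegrable _ _
  rw [Finset.sum_congr rfl ek, Finset.sum_add_distrib, ← sub_sub]
  simp only [e0] at main
  exact main

/-! ### The scheme in terms of the numerical flux -/

theorem ContinuityStep.eq_discreteFlux {ε dt : ℝ} {ϱ' ϱ : M.Cell → ℝ} {u : M.Cell → Pt d}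
    (h : M.ContinuityStep ε dt ϱ' ϱ u) (i₀ : Fin d) (φ : M.Cell → ℝ) :
    ∑ K, M.vol * ((ϱ K - ϱ' K) / dt * φ K)
      = M.discreteFlux ε i₀ 0 ϱ (fun _ => 0) (fun _ => 0) u φ := by
  have := h φ
  simp only [discreteFlux, avg, zero_mul, sub_zero, add_zero, zero_div, mul_zero,
    Finset.sum_const_zero]
  linarith

theorem sum_divh_mul_divh_single (i : Fin d) (w : M.Cell → ℝ) (φ : M.Cell → ℝ) :
    ∑ K, M.vol * (w K * M.divh (fun L => Pi.single i (φ L)) K)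
      = ∑ K, M.area i * (M.avg i w K * M.jump i φ K) := by
  have e : ∀ K, M.divh (fun L => Pi.single i (φ L)) K
      = (M.jump i φ K + M.jump i φ (M.prev i K)) / (2 * M.step i) := fun K => by
    rw [divh_eq, Finset.sum_eq_single i]
    · simp only [Pi.single_eq_same]
    · intro j _ hj
      simp [jump, hj]
    · simp
  rw [← Finset.mul_sum, ← Finset.mul_sum, sum_avg_mul, area_eq]
  have e' : ∀ K, w K * M.divh (fun L => Pi.single i (φ L)) K
      = (w K * ((M.jump i φ (M.prev i K) + M.jump i φ K) / 2)) / M.step i := fun K => by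
    have := (M.step_pos i).ne'
    rw [e]; field_simp; ring
  rw [Finset.sum_congr rfl fun K _ => e' K, ← Finset.sum_div]
  ring

theorem MomentumStep.eq_discreteFlux {a γ μ lam ε dt : ℝ} {ϱ' ϱ : M.Cell → ℝ}
    {u' u : M.Cell → Pt d} (h : M.MomentumStep a γ μ lam ε dt ϱ' u' ϱ u) (i : Fin d)
    (φ : M.Cell → ℝ) :
    ∑ K, M.vol * ((ϱ K * u K i - ϱ' K * u' K i) / dt * φ K)
      = M.discreteFlux ε i μ (fun K => ϱ K * u K i)
        (fun K => a * ϱ K ^ γ - (μ + lam) * M.divh u K) (fun K => u K i) u φ := by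
  have h1 := h (fun K => Pi.single i (φ K))
  have ej : ∀ (j l : Fin d) K, M.jump l (fun L => (Pi.single i (φ L) : Pt d) j) K
      = if j = i then M.jump l φ K else 0 := fun j l K => by
    by_cases hj : j = i
    · subst hj; simp [jump]
    · simp [jump, hj]
  have e1 : ∀ (c : Fin d → ℝ) (l : Fin d) (K : M.Cell),
      ∑ j, c j * M.jump l (fun L => (Pi.single i (φ L) : Pt d) j) K = c i * M.jump l φ K :=
    fun c l K => by simp [ej]
  have e2 : ∀ K, ∑ j, (ϱ K * u K j - ϱ' K * u' K j) / dt * (Pi.single i (φ K) : Pt d) j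
      = (ϱ K * u K i - ϱ' K * u' K i) / dt * φ K := fun K => by
    rw [Finset.sum_eq_single i]
    · simp
    · intro j _ hj; simp [hj]
    · simp
  have e3 : ∑ l, ∑ K, M.area l * (M.avg l (fun L => a * ϱ L ^ γ) K
        * M.jump l (fun L => (Pi.single i (φ L) : Pt d) l) K)
      = ∑ K, M.area i * (M.avg i (fun L => a * ϱ L ^ γ) K * M.jump i φ K) := by
    rw [Finset.sum_eq_single i]
    · simp
    · intro l _ hl; simp [jump, hl]
    · simp
  simp only [e2, e3, M.sum_divh_mul_divh_single i (M.divh u) φ] at h1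
  simp only [e1] at h1
  have e4 : ∑ K, M.area i * (M.avg i (fun K => a * ϱ K ^ γ - (μ + lam) * M.divh u K) K
      * M.jump i φ K) = ∑ K, M.area i * (M.avg i (fun L => a * ϱ L ^ γ) K * M.jump i φ K)
      - (μ + lam) * ∑ K, M.area i * (M.avg i (M.divh u) K * M.jump i φ K) := by
    rw [Finset.mul_sum, ← Finset.sum_sub_distrib]
    refine Finset.sum_congr rfl fun K _ => ?_
    simp only [avg]; ring
  have e5 : ∑ j, ∑ K, M.area j * (M.jump j (fun K => u K i) K / M.step j * M.jump j φ K)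
      = ∑ j, ∑ K, M.area j * (1 / M.step j * (M.jump j (fun K => u K i) K * M.jump j φ K)) := by
    refine Finset.sum_congr rfl fun j _ => Finset.sum_congr rfl fun K _ => ?_
    ring
  rw [discreteFlux, e4, e5]
  linarith

end Mesh

/-! ### The weak formulations -/

section

variable (M : Mesh d) {T dt : ℝ} {N : ℕ}

theorem weakContinuity_integral {B : ℝ} {φ ψ Dt : ℝ → Pt d → ℝ} {Dx : Fin d → ℝ → Pt d → ℝ}
    (h : TestData T B ψ Dt Dx)
    (ht : ∀ t ∈ Ioo 0 T, ∀ x, deriv (fun s => φ s x) t = Dt t x)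
    (hx : ∀ t ∈ Ico 0 T, ∀ x j, pd j (φ t) x = Dx j t x)
    (hdt : 0 < dt) (hT : N * dt = T) (i₀ : Fin d)
    (ϱ : ℕ → M.Cell → ℝ) (u : ℕ → M.Cell → Pt d) :
    ∫ t in (0 : ℝ)..T, ∫ x in cube d,
        (timeExt dt ϱ t (M.cellAt x) * deriv (fun s => φ s x) t
          + ∑ j, timeExt dt ϱ t (M.cellAt x) * timeExt dt u t (M.cellAt x) j * pd j (φ t) x)
      = ∑ k ∈ Finset.range N, ∫ t in (k * dt)..((k + 1 : ℕ) * dt),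
        (∑ K, ϱ k K * (∫ x in M.region K, Dt t x)
          + M.weakFlux Dx i₀ 0 (ϱ k) (fun _ => 0) (fun _ => 0) (u k) t) := by
  refine intervalIntegral_eq_sum_steps hdt.le hT
    (H := fun k t => ∑ K, ϱ k K * (∫ x in M.region K, Dt t x)
          + M.weakFlux Dx i₀ 0 (ϱ k) (fun _ => 0) (fun _ => 0) (u k) t)
    (fun k => (M.continuous_timePart h _).add (M.continuous_weakFlux h _ _ _ _ _ _))
    (fun k hk t htk => ?_)
  have ht0 := mem_Ioo_of_mem_step hdt hT hk htk
  simp only [timeExt_eq hdt _ htk, ht t ht0, hx t ⟨ht0.1.le, ht0.2⟩]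
  have i1 := M.integrableOn_cellAt_mul (ϱ k) (h.continuous_dt_slice t)
  have i2 := fun j => M.integrableOn_cellAt_mul (fun K => ϱ k K * u k K j)
    (h.continuous_dx_slice j t)
  rw [integral_add i1 (integrable_finsetSum _ fun j _ => i2 j),
    integral_finsetSum _ fun j _ => i2 j, M.setIntegral_cellAt_mul _ (h.continuous_dt_slice t)]
  simp only [Mesh.weakFlux, zero_mul, Finset.sum_const_zero, add_zero, sub_zero]
  congr 1
  exact Finset.sum_congr rfl fun j _ =>
    M.setIntegral_cellAt_mul (fun K => ϱ k K * u k K j) (h.continuous_dx_slice j t)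

theorem weakMomentum_integral {B : ℝ} {φ : ℝ → Pt d → Pt d} {ψ Dt : Fin d → ℝ → Pt d → ℝ}
    {Dx : Fin d → Fin d → ℝ → Pt d → ℝ} (h : ∀ i, TestData T B (ψ i) (Dt i) (Dx i))
    (ht : ∀ i, ∀ t ∈ Ioo 0 T, ∀ x, deriv (fun s => φ s x i) t = Dt i t x)
    (hx : ∀ i, ∀ t ∈ Ico 0 T, ∀ x j, pd j (fun y => φ t y i) x = Dx i j t x)
    (hdt : 0 < dt) (hT : N * dt = T) (a γ μ lam : ℝ)
    (ϱ : ℕ → M.Cell → ℝ) (u : ℕ → M.Cell → Pt d) :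
    (∫ t in (0 : ℝ)..T, ∫ x in cube d,
        (∑ i, timeExt dt ϱ t (M.cellAt x) * timeExt dt u t (M.cellAt x) i
            * deriv (fun s => φ s x i) t
          + ∑ i, ∑ j, timeExt dt ϱ t (M.cellAt x) * timeExt dt u t (M.cellAt x) i
              * timeExt dt u t (M.cellAt x) j * pd j (fun y => φ t y i) x
          + a * timeExt dt ϱ t (M.cellAt x) ^ γ * ∑ i, pd i (fun y => φ t y i) x))
      - μ * (∫ t in (0 : ℝ)..T, ∫ x in cube d,
          ∑ i, ∑ j, M.dualGrad j (fun K => timeExt dt u t K i) x * pd j (fun y => φ t y i) x)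
      - (μ + lam) * (∫ t in (0 : ℝ)..T, ∫ x in cube d,
          M.divh (timeExt dt u t) (M.cellAt x) * ∑ i, pd i (fun y => φ t y i) x)
      = ∑ i, ∑ k ∈ Finset.range N, ∫ t in (k * dt)..((k + 1 : ℕ) * dt),
        (∑ K, ϱ k K * u k K i * (∫ x in M.region K, Dt i t x)
          + M.weakFlux (Dx i) i μ (fun K => ϱ k K * u k K i)
            (fun K => a * ϱ k K ^ γ - (μ + lam) * M.divh (u k) K) (fun K => u k K i) (u k) t) := by
  have c1 : ∀ i j K, Continuous fun t => ∫ x in M.region K, Dx i j t x := fun i j K => by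
    simp only [Mesh.region_eq]
    exact continuous_setIntegral_pi_Ico ((h i).cont_dx j) _ _
  have c2 : ∀ i j K, Continuous fun t => ∫ x in M.lowerHalf j K, Dx i j t x := fun i j K =>
    continuous_setIntegral_pi_Ico ((h i).cont_dx j) _ _
  have c3 : ∀ i j K, Continuous fun t => ∫ x in M.upperHalf j K, Dx i j t x := fun i j K =>
    continuous_setIntegral_pi_Ico ((h i).cont_dx j) _ _
  have c4 : ∀ i K, Continuous fun t => ∫ x in M.region K, Dt i t x := fun i K => by
    simp only [Mesh.region_eq]
    exact continuous_setIntegral_pi_Ico (h i).cont_dt _ _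
  set H₁ : ℕ → ℝ → ℝ := fun k t => ∑ i, (∑ K, ϱ k K * u k K i * (∫ x in M.region K, Dt i t x)
    + ∑ j, ∑ K, ϱ k K * u k K i * u k K j * (∫ x in M.region K, Dx i j t x)
    + ∑ K, a * ϱ k K ^ γ * (∫ x in M.region K, Dx i i t x)) with hH₁
  set H₂ : ℕ → ℝ → ℝ := fun k t => ∑ i, ∑ j, M.dualSum j (fun K => u k K i)
    (fun K => ∫ x in M.lowerHalf j K, Dx i j t x)
    (fun K => ∫ x in M.upperHalf j K, Dx i j t x) with hH₂
  set H₃ : ℕ → ℝ → ℝ := fun k t => ∑ i, ∑ K, M.divh (u k) K * (∫ x in M.region K, Dx i i t x)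
    with hH₃
  have hc1 : ∀ k, Continuous (H₁ k) := fun k => by
    simp only [hH₁]; fun_prop
  have hc2 : ∀ k, Continuous (H₂ k) := fun k => by
    simp only [hH₂, Mesh.dualSum]; fun_prop
  have hc3 : ∀ k, Continuous (H₃ k) := fun k => by
    simp only [hH₃]; fun_prop
  rw [intervalIntegral_eq_sum_steps hdt.le hT hc1, intervalIntegral_eq_sum_steps hdt.le hT hc2,
    intervalIntegral_eq_sum_steps hdt.le hT hc3, Finset.mul_sum, Finset.mul_sum,
    ← Finset.sum_sub_distrib, ← Finset.sum_sub_distrib, Finset.sum_comm]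
  · refine Finset.sum_congr rfl fun k _ => ?_
    have hc12 : Continuous fun t => H₁ k t - μ * H₂ k t := (hc1 k).sub ((hc2 k).const_mul _)
    rw [← intervalIntegral.integral_const_mul, ← intervalIntegral.integral_const_mul,
      ← intervalIntegral.integral_sub ((hc1 k).intervalIntegrable _ _)
        (((hc2 k).const_mul _).intervalIntegrable _ _),
      ← intervalIntegral.integral_sub (hc12.intervalIntegrable _ _)
        (((hc3 k).const_mul _).intervalIntegrable _ _),
      ← intervalIntegral.integral_finsetSum]
    · congr 1
      funext t
      simp only [hH₁, hH₂, hH₃, Finset.mul_sum (s := (Finset.univ : Finset (Fin d)))]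
      rw [← Finset.sum_sub_distrib, ← Finset.sum_sub_distrib]
      refine Finset.sum_congr rfl fun i _ => ?_
      rw [Mesh.weakFlux, ← Finset.mul_sum]
      have e : ∑ K, (a * ϱ k K ^ γ - (μ + lam) * M.divh (u k) K) * (∫ x in M.region K, Dx i i t x)
          = ∑ K, a * ϱ k K ^ γ * (∫ x in M.region K, Dx i i t x)
            - (μ + lam) * ∑ K, M.divh (u k) K * (∫ x in M.region K, Dx i i t x) := by
        rw [Finset.mul_sum, ← Finset.sum_sub_distrib]
        exact Finset.sum_congr rfl fun K _ => by ring
      rw [e]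
      ring
    · intro i _
      refine Continuous.intervalIntegrable ?_ _ _
      exact (M.continuous_timePart (h i) fun K => ϱ k K * u k K i).add
        (M.continuous_weakFlux (h i) _ _ _ _ _ _)
  · intro k hk t htk
    have ht0 := mem_Ioo_of_mem_step hdt hT hk htk
    have hx0 := fun i => hx i t ⟨ht0.1.le, ht0.2⟩
    simp only [timeExt_eq hdt _ htk, hx0, Finset.mul_sum]
    have i1 := fun i => M.integrableOn_cellAt_mul (M.divh (u k)) ((h i).continuous_dx_slice i t)
    rw [integral_finsetSum _ fun i _ => i1 i]
    exact Finset.sum_congr rfl fun i _ =>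
      M.setIntegral_cellAt_mul (M.divh (u k)) ((h i).continuous_dx_slice i t)
  · intro k hk t htk
    have ht0 := mem_Ioo_of_mem_step hdt hT hk htk
    have hx0 := fun i => hx i t ⟨ht0.1.le, ht0.2⟩
    simp only [timeExt_eq hdt _ htk, hx0]
    have i1 := fun i j => M.integrableOn_dualGrad_mul j (fun K => u k K i)
      ((h i).continuous_dx_slice j t)
    rw [integral_finsetSum _ fun i _ => integrable_finsetSum _ fun j _ => i1 i j]
    refine Finset.sum_congr rfl fun i _ => ?_
    rw [integral_finsetSum _ fun j _ => i1 i j]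
    exact Finset.sum_congr rfl fun j _ =>
      M.setIntegral_dualGrad_mul j (fun K => u k K i) ((h i).continuous_dx_slice j t)
  · intro k hk t htk
    have ht0 := mem_Ioo_of_mem_step hdt hT hk htk
    have hx0 := fun i => hx i t ⟨ht0.1.le, ht0.2⟩
    simp only [timeExt_eq hdt _ htk, ht _ t ht0, hx0, Finset.mul_sum]
    have i1 := fun i => M.integrableOn_cellAt_mul (fun K => ϱ k K * u k K i)
      ((h i).continuous_dt_slice t)
    have i2 := fun i j => M.integrableOn_cellAt_mul (fun K => ϱ k K * u k K i * u k K j)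
      ((h i).continuous_dx_slice j t)
    have i3 := fun i => M.integrableOn_cellAt_mul (fun K => a * ϱ k K ^ γ)
      ((h i).continuous_dx_slice i t)
    have j1 := integrable_finsetSum Finset.univ fun i _ => i1 i
    have j2 := integrable_finsetSum Finset.univ fun i _ =>
      integrable_finsetSum Finset.univ fun j _ => i2 i j
    have j3 := integrable_finsetSum Finset.univ fun i _ => i3 i
    have j12 := j1.add j2
    simp only [Pi.add_def] at j12
    rw [integral_add j12 j3, integral_add j1 j2, integral_finsetSum _ fun i _ => i1 i,
      integral_finsetSum _ fun i _ => integrable_finsetSum _ fun j _ => i2 i j,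
      integral_finsetSum _ fun i _ => i3 i, ← Finset.sum_add_distrib, ← Finset.sum_add_distrib]
    refine Finset.sum_congr rfl fun i _ => ?_
    rw [integral_finsetSum _ fun j _ => i2 i j]
    congr 1
    · congr 1
      · exact M.setIntegral_cellAt_mul (fun K => ϱ k K * u k K i) ((h i).continuous_dt_slice t)
      · exact Finset.sum_congr rfl fun j _ => M.setIntegral_cellAt_mul
          (fun K => ϱ k K * u k K i * u k K j) ((h i).continuous_dx_slice j t)
    · exact M.setIntegral_cellAt_mul (fun K => a * ϱ k K ^ γ) ((h i).continuous_dx_slice i t)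

end

end FVNS

namespace FVNS

variable {d : ℕ}

namespace Mesh

variable (M : Mesh d)

/-! ### Bounds on the numerical solution -/

theorem volume_cube_lt_top : volume (cube d) < ⊤ := by
  have : cube d ⊆ Icc (0 : Pt d) 1 := fun x hx => ⟨fun i => (hx i).1, fun i => (hx i).2.le⟩
  exact (measure_mono this).trans_lt isCompact_Icc.measure_lt_top

theorem sum_vol_mul_abs_proj_le {f : Pt d → ℝ} (hf : IntegrableOn f (cube d)) :
    M.vol * ∑ K, |M.proj f K| ≤ ∫ x in cube d, |f x| := by
  rw [M.setIntegral_cube_eq_sum hf.abs, Finset.mul_sum]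
  refine Finset.sum_le_sum fun K _ => ?_
  rw [← abs_of_pos M.vol_pos, ← abs_mul, vol_mul_proj]
  exact abs_integral_le_integral_abs

/-- Jensen's inequality for the projection. -/
theorem sum_vol_mul_proj_rpow_le {f : Pt d → ℝ} {γ : ℝ} (hγ : 1 < γ)
    (hf : IntegrableOn f (cube d)) (hfγ : IntegrableOn (fun x => ‖f x‖ ^ γ) (cube d))
    (hpos : ∀ᵐ x ∂(volume.restrict (cube d)), 0 < f x) :
    M.vol * ∑ K, M.proj f K ^ γ ≤ ∫ x in cube d, ‖f x‖ ^ γ := by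
  rw [M.setIntegral_cube_eq_sum hfγ, Finset.mul_sum]
  refine Finset.sum_le_sum fun K _ => ?_
  have hv := M.vol_pos
  have hK := ae_restrict_of_ae_restrict_of_subset (M.region_subset_cube K) hpos
  have e : (fun x => ‖f x‖ ^ γ) =ᵐ[volume.restrict (M.region K)] (fun x => x ^ γ) ∘ f := by
    filter_upwards [hK] with x hx
    rw [Function.comp, Real.norm_of_nonneg hx.le]
  have hi := (M.integrableOn_cube_iff.1 hfγ K).congr e
  have h0 : volume (M.region K) ≠ 0 := by
    intro h
    have := M.volume_region K
    rw [Measure.real, h, ENNReal.toReal_zero] at this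
    linarith
  have hJ := (convexOn_rpow hγ.le).map_set_average_le
    (fun x _ => (Real.continuousAt_rpow_const x γ (Or.inr (by linarith))).continuousWithinAt)
    isClosed_Ici h0 (M.volume_region_lt_top K).ne (hK.mono fun x hx => hx.le)
    (M.integrableOn_cube_iff.1 hf K) hi
  rw [setAverage_eq, setAverage_eq, volume_region, smul_eq_mul, smul_eq_mul,
    ← div_eq_inv_mul, ← div_eq_inv_mul, le_div_iff₀ hv] at hJ
  rw [integral_congr_ae e, proj, one_div, ← div_eq_inv_mul, mul_comm]
  exact hJ

theorem energy_eq (a γ : ℝ) (ϱ : M.Cell → ℝ) (u : M.Cell → Pt d) :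
    M.energy a γ ϱ u = M.momentumEnergy ϱ u / 2 + a / (γ - 1) * (M.vol * ∑ K, ϱ K ^ γ) := by
  rw [energy, momentumEnergy, Finset.mul_sum, Finset.mul_sum, Finset.sum_div,
    ← Finset.sum_add_distrib]
  exact Finset.sum_congr rfl fun K _ => by ring

theorem momentumEnergy_nonneg {ϱ : M.Cell → ℝ} (hϱ : ∀ K, 0 ≤ ϱ K) (u : M.Cell → Pt d) :
    0 ≤ M.momentumEnergy ϱ u :=
  Finset.sum_nonneg fun K _ => mul_nonneg M.vol_pos.le
    (mul_nonneg (hϱ K) (Finset.sum_nonneg fun _ _ => sq_nonneg _))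

theorem energy_nonneg {a γ : ℝ} (ha : 0 < a) (hγ : 1 < γ) {ϱ : M.Cell → ℝ} (hϱ : ∀ K, 0 ≤ ϱ K)
    (u : M.Cell → Pt d) : 0 ≤ M.energy a γ ϱ u := by
  rw [energy_eq]
  have h1 := M.momentumEnergy_nonneg hϱ u
  have h2 : 0 ≤ M.vol * ∑ K, ϱ K ^ γ := mul_nonneg M.vol_pos.le
    (Finset.sum_nonneg fun K _ => Real.rpow_nonneg (hϱ K) γ)
  have h3 : 0 ≤ a / (γ - 1) := div_nonneg ha.le (by linarith)
  have := mul_nonneg h3 h2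
  linarith

theorem avg_nonneg {ϱ : M.Cell → ℝ} (hϱ : ∀ K, 0 ≤ ϱ K) (i : Fin d) (K : M.Cell) :
    0 ≤ M.avg i ϱ K := by
  have h1 := hϱ K
  have h2 := hϱ (M.next i K)
  rw [avg]; linarith

theorem dissipation_term_nonneg {μ : ℝ} (ε : ℝ) (hμ : 0 < μ) {ϱ : M.Cell → ℝ}
    (hϱ : ∀ K, 0 ≤ ϱ K) (u : M.Cell → Pt d) (i : Fin d) (K : M.Cell) :
    0 ≤ M.area i * ((M.size ^ ε * M.avg i ϱ K + μ / M.step i)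
      * ∑ j, M.jump i (fun L => u L j) K ^ 2) := by
  have h1 : 0 ≤ M.area i := by rw [area_eq]; exact (div_pos M.vol_pos (M.step_pos i)).le
  have h2 := M.avg_nonneg hϱ i K
  have h3 := Real.rpow_nonneg M.size_nonneg ε
  have h4 := (div_pos hμ (M.step_pos i)).le
  positivity

theorem dissipation_nonneg {μ : ℝ} (ε : ℝ) (hμ : 0 < μ) {ϱ : M.Cell → ℝ} (hϱ : ∀ K, 0 ≤ ϱ K)
    (u : M.Cell → Pt d) : 0 ≤ M.dissipation μ ε ϱ u :=
  Finset.sum_nonneg fun i _ => Finset.sum_nonneg fun K _ =>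
    M.dissipation_term_nonneg ε hμ hϱ u i K

theorem sum_area_le_dissipation {μ : ℝ} (ε : ℝ) (hμ : 0 < μ) {ϱ : M.Cell → ℝ}
    (hϱ : ∀ K, 0 ≤ ϱ K) (u : M.Cell → Pt d) (i j : Fin d) :
    ∑ K, M.area i * ((M.size ^ ε * M.avg i ϱ K + μ / M.step i)
      * M.jump i (fun L => u L j) K ^ 2) ≤ M.dissipation μ ε ϱ u := by
  refine le_trans ?_ (Finset.single_le_sum (f := fun i => ∑ K, M.area i *
    ((M.size ^ ε * M.avg i ϱ K + μ / M.step i) * ∑ j, M.jump i (fun L => u L j) K ^ 2))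
    (fun i _ => Finset.sum_nonneg fun K _ => M.dissipation_term_nonneg ε hμ hϱ u i K)
    (Finset.mem_univ i))
  refine Finset.sum_le_sum fun K _ => ?_
  have h1 : 0 ≤ M.area i := by rw [area_eq]; exact (div_pos M.vol_pos (M.step_pos i)).le
  have h2 := M.avg_nonneg hϱ i K
  have h3 := Real.rpow_nonneg M.size_nonneg ε
  have h4 := (div_pos hμ (M.step_pos i)).le
  refine mul_le_mul_of_nonneg_left (mul_le_mul_of_nonneg_left ?_ (by positivity)) h1
  exact Finset.single_le_sum (f := fun j => M.jump i (fun L => u L j) K ^ 2)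
    (fun j _ => sq_nonneg _) (Finset.mem_univ j)

theorem sum_abs_jump_div_step_le {μ : ℝ} (ε : ℝ) (hμ : 0 < μ) {ϱ : M.Cell → ℝ}
    (hϱ : ∀ K, 0 ≤ ϱ K) (u : M.Cell → Pt d) (i j : Fin d) :
    M.vol * ∑ K, |M.jump i (fun L => u L j) K / M.step i| ≤ 1 + M.dissipation μ ε ϱ u / μ := by
  have hs := M.step_pos i
  have hv := M.vol_pos
  calc M.vol * ∑ K, |M.jump i (fun L => u L j) K / M.step i|
      ≤ ∑ K, (M.vol + M.area i * ((M.size ^ ε * M.avg i ϱ K + μ / M.step i)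
        * M.jump i (fun L => u L j) K ^ 2) / μ) := by
        rw [Finset.mul_sum]
        refine Finset.sum_le_sum fun K _ => ?_
        set J := M.jump i (fun L => u L j) K
        have h1 : |J / M.step i| ≤ 1 + (J / M.step i) ^ 2 := by
          rw [abs_le]; constructor <;> nlinarith [sq_nonneg (J / M.step i - 1),
            sq_nonneg (J / M.step i + 1)]
        have h2 : M.area i * (μ / M.step i * J ^ 2) / μ = M.vol * (J / M.step i) ^ 2 := by
          rw [area_eq]; field_simp
        have h3 : M.area i * (μ / M.step i * J ^ 2) / μ
            ≤ M.area i * ((M.size ^ ε * M.avg i ϱ K + μ / M.step i) * J ^ 2) / μ := by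
          have h4 : 0 ≤ M.area i := by rw [area_eq]; exact (div_pos hv hs).le
          have h5 := mul_nonneg (Real.rpow_nonneg M.size_nonneg ε) (M.avg_nonneg hϱ i K)
          gcongr
          linarith
        calc M.vol * |J / M.step i| ≤ M.vol * (1 + (J / M.step i) ^ 2) := by gcongr
          _ = M.vol + M.area i * (μ / M.step i * J ^ 2) / μ := by rw [h2]; ring
          _ ≤ _ := by linarith
    _ ≤ 1 + M.dissipation μ ε ϱ u / μ := by
        rw [Finset.sum_add_distrib, sum_vol, ← Finset.sum_div]
        have := M.sum_area_le_dissipation ε hμ hϱ u i j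
        gcongr

theorem sum_density_mul_jump_sq_le {μ ε : ℝ} (hμ : 0 < μ) {ϱ : M.Cell → ℝ} (hϱ : ∀ K, 0 ≤ ϱ K)
    (u : M.Cell → Pt d) (i j : Fin d) :
    M.vol * ∑ K, (ϱ K + ϱ (M.next i K)) * M.jump i (fun L => u L j) K ^ 2
      ≤ 2 * (M.size ^ ((1 - ε) / 2)) ^ 2 * M.dissipation μ ε ϱ u := by
  have hs := M.step_pos i
  have hv := M.vol_pos
  have hh := M.size_pos i
  have hp : (M.size ^ ((1 - ε) / 2)) ^ 2 = M.size / M.size ^ ε := by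
    rw [← Real.rpow_natCast, ← Real.rpow_mul hh.le]
    have : (1 - ε) / 2 * ((2 : ℕ) : ℝ) = 1 - ε := by push_cast; ring
    rw [this, Real.rpow_sub hh, Real.rpow_one]
  have hpe := Real.rpow_pos_of_pos hh ε
  rw [hp]
  calc M.vol * ∑ K, (ϱ K + ϱ (M.next i K)) * M.jump i (fun L => u L j) K ^ 2
      ≤ ∑ K, 2 * (M.size / M.size ^ ε) * (M.area i * ((M.size ^ ε * M.avg i ϱ K + μ / M.step i)
        * M.jump i (fun L => u L j) K ^ 2)) := by
        rw [Finset.mul_sum]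
        refine Finset.sum_le_sum fun K _ => ?_
        set J := M.jump i (fun L => u L j) K
        have ha := M.avg_nonneg hϱ i K
        have h1 : M.vol ≤ M.area i * M.size := by
          rw [area_eq, div_mul_eq_mul_div, le_div_iff₀ hs]
          exact mul_le_mul_of_nonneg_left (M.step_le_size i) hv.le
        have h2 := (div_pos hμ hs).le
        have h3 : 0 ≤ M.area i := by rw [area_eq]; exact (div_pos hv hs).le
        calc M.vol * ((ϱ K + ϱ (M.next i K)) * J ^ 2) = M.vol * (2 * M.avg i ϱ K * J ^ 2) := by
              rw [avg]; ring
          _ ≤ M.area i * M.size * (2 * M.avg i ϱ K * J ^ 2) := by gcongr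
          _ = 2 * (M.size / M.size ^ ε) * (M.area i * ((M.size ^ ε * M.avg i ϱ K + 0)
              * J ^ 2)) := by field_simp; ring
          _ ≤ _ := by gcongr
    _ ≤ _ := by
        rw [← Finset.mul_sum]
        exact mul_le_mul_of_nonneg_left (M.sum_area_le_dissipation ε hμ hϱ u i j) (by positivity)

/-- Young's inequality for the products of jumps. -/
theorem vol_mul_jumpWeight_le {μ ε S : ℝ} (hμ : 0 < μ) {ϱ : M.Cell → ℝ} (hϱ : ∀ K, 0 ≤ ϱ K)
    (u : M.Cell → Pt d) (i j : Fin d) (w : M.Cell → ℝ)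
    (hw : M.vol * ∑ K, ϱ K * w K ^ 2 ≤ S) :
    M.vol * M.jumpWeight i (fun K => ϱ K * w K) (fun L => u L j)
      ≤ M.size ^ ((1 - ε) / 2) * (2 * S + 2 * M.dissipation μ ε ϱ u) := by
  have hv := M.vol_pos
  have hκ : 0 < M.size ^ ((1 - ε) / 2) := Real.rpow_pos_of_pos (M.size_pos i) _
  set κ := M.size ^ ((1 - ε) / 2) with hκdef
  have h1 := M.sum_density_mul_jump_sq_le (ε := ε) hμ hϱ u i j
  rw [← hκdef] at h1
  have hpt : ∀ (r y J : ℝ), 0 ≤ r → |r * y| * |J| ≤ κ * (r * y ^ 2) + r * J ^ 2 / κ := by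
    intro r y J hr
    rw [abs_mul, abs_of_nonneg hr, ← sub_nonneg]
    have e : κ * (r * y ^ 2) + r * J ^ 2 / κ - r * |y| * |J|
        = r / κ * ((κ * |y|) ^ 2 + |J| ^ 2 - (κ * |y|) * |J|) := by
      rw [mul_pow, sq_abs, sq_abs]; field_simp
    rw [e]
    refine mul_nonneg (div_nonneg hr hκ.le) ?_
    nlinarith [sq_nonneg (κ * |y| - |J|), sq_nonneg (κ * |y|), sq_nonneg |J|]
  calc M.vol * M.jumpWeight i (fun K => ϱ K * w K) (fun L => u L j)
      ≤ M.vol * ∑ K, (κ * (ϱ K * w K ^ 2) + κ * (ϱ (M.next i K) * w (M.next i K) ^ 2)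
        + ((ϱ K + ϱ (M.next i K)) * M.jump i (fun L => u L j) K ^ 2) / κ) := by
        rw [jumpWeight]
        refine mul_le_mul_of_nonneg_left (Finset.sum_le_sum fun K _ => ?_) hv.le
        have a1 := hpt (ϱ K) (w K) (M.jump i (fun L => u L j) K) (hϱ K)
        have a2 := hpt (ϱ (M.next i K)) (w (M.next i K)) (M.jump i (fun L => u L j) K) (hϱ _)
        rw [add_mul, add_mul, add_div]
        linarith
    _ = 2 * κ * (M.vol * ∑ K, ϱ K * w K ^ 2)
        + (M.vol * ∑ K, (ϱ K + ϱ (M.next i K)) * M.jump i (fun L => u L j) K ^ 2) / κ := by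
        rw [Finset.sum_add_distrib, Finset.sum_add_distrib, ← Finset.sum_div, ← Finset.mul_sum,
          ← Finset.mul_sum, M.sum_next i (fun K => ϱ K * w K ^ 2)]
        ring
    _ ≤ 2 * κ * S + (2 * κ ^ 2 * M.dissipation μ ε ϱ u) / κ := by gcongr
    _ = _ := by field_simp

section

variable {a γ 𝓔 : ℝ} {ϱ : M.Cell → ℝ} {u : M.Cell → Pt d}

theorem sum_density_rpow_le (ha : 0 < a) (hγ : 1 < γ) (hϱ : ∀ K, 0 ≤ ϱ K)
    (hE : M.energy a γ ϱ u ≤ 𝓔) : M.vol * ∑ K, ϱ K ^ γ ≤ (γ - 1) / a * 𝓔 := by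
  have hg : 0 < γ - 1 := by linarith
  rw [energy_eq] at hE
  have h1 := M.momentumEnergy_nonneg hϱ u
  have h2 : a / (γ - 1) * (M.vol * ∑ K, ϱ K ^ γ) ≤ 𝓔 := by linarith
  have h3 := mul_le_mul_of_nonneg_left h2 (div_pos hg ha).le
  have h4 : (γ - 1) / a * (a / (γ - 1) * (M.vol * ∑ K, ϱ K ^ γ)) = M.vol * ∑ K, ϱ K ^ γ := by
    field_simp
  rwa [h4] at h3

theorem sum_density_le (ha : 0 < a) (hγ : 1 < γ) (hϱ : ∀ K, 0 ≤ ϱ K)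
    (hE : M.energy a γ ϱ u ≤ 𝓔) : M.vol * ∑ K, ϱ K ≤ 1 + (γ - 1) / a * 𝓔 := by
  have h1 := M.sum_density_rpow_le ha hγ hϱ hE
  have h2 : ∀ K, ϱ K ≤ 1 + ϱ K ^ γ := fun K => by
    rcases le_total (ϱ K) 1 with h | h
    · have := Real.rpow_nonneg (hϱ K) γ; linarith
    · have := Real.rpow_le_rpow_of_exponent_le h hγ.le
      rw [Real.rpow_one] at this; linarith
  have h3 : M.vol * ∑ K, ϱ K ≤ M.vol * ∑ K, (1 + ϱ K ^ γ) :=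
    mul_le_mul_of_nonneg_left (Finset.sum_le_sum fun K _ => h2 K) M.vol_pos.le
  have h4 : M.vol * ∑ _K : M.Cell, (1 : ℝ) = 1 := by
    rw [Finset.mul_sum]; simp only [mul_one]; exact M.sum_vol
  rw [Finset.sum_add_distrib, mul_add, h4] at h3
  linarith

theorem sum_density_mul_sq_le (ha : 0 < a) (hγ : 1 < γ) (hϱ : ∀ K, 0 ≤ ϱ K)
    (hE : M.energy a γ ϱ u ≤ 𝓔) (i : Fin d) : M.vol * ∑ K, ϱ K * u K i ^ 2 ≤ 2 * 𝓔 := by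
  rw [energy_eq] at hE
  have h2 : 0 ≤ M.vol * ∑ K, ϱ K ^ γ := mul_nonneg M.vol_pos.le
    (Finset.sum_nonneg fun K _ => Real.rpow_nonneg (hϱ K) γ)
  have h3 : 0 ≤ a / (γ - 1) := div_nonneg ha.le (by linarith)
  have h4 := mul_nonneg h3 h2
  have h5 : M.vol * ∑ K, ϱ K * u K i ^ 2 ≤ M.momentumEnergy ϱ u := by
    rw [momentumEnergy, ← Finset.mul_sum]
    refine mul_le_mul_of_nonneg_left (Finset.sum_le_sum fun K _ => ?_) M.vol_pos.le
    exact mul_le_mul_of_nonneg_left (Finset.single_le_sum (f := fun i => u K i ^ 2)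
      (fun i _ => sq_nonneg _) (Finset.mem_univ i)) (hϱ K)
  linarith

theorem sum_abs_momentum_le (ha : 0 < a) (hγ : 1 < γ) (hϱ : ∀ K, 0 ≤ ϱ K)
    (hE : M.energy a γ ϱ u ≤ 𝓔) (i : Fin d) :
    M.vol * ∑ K, |ϱ K * u K i| ≤ 1 + (γ - 1) / a * 𝓔 + 2 * 𝓔 := by
  have h1 := M.sum_density_le ha hγ hϱ hE
  have h2 := M.sum_density_mul_sq_le ha hγ hϱ hE i
  have h3 : M.vol * ∑ K, |ϱ K * u K i| ≤ M.vol * ∑ K, (ϱ K + ϱ K * u K i ^ 2) := by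
    refine mul_le_mul_of_nonneg_left (Finset.sum_le_sum fun K _ => ?_) M.vol_pos.le
    rw [abs_mul, abs_of_nonneg (hϱ K), ← sq_abs (u K i)]
    nlinarith [hϱ K, sq_nonneg (|u K i| - 1), mul_nonneg (hϱ K) (sq_nonneg (|u K i| - 1)),
      mul_nonneg (hϱ K) (sq_nonneg |u K i|)]
  rw [Finset.sum_add_distrib, mul_add] at h3
  linarith

theorem sum_abs_momentum_mul_le (ha : 0 < a) (hγ : 1 < γ) (hϱ : ∀ K, 0 ≤ ϱ K)
    (hE : M.energy a γ ϱ u ≤ 𝓔) (i j : Fin d) :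
    M.vol * ∑ K, |ϱ K * u K i * u K j| ≤ 4 * 𝓔 := by
  have h1 := M.sum_density_mul_sq_le ha hγ hϱ hE i
  have h2 := M.sum_density_mul_sq_le ha hγ hϱ hE j
  have h3 : M.vol * ∑ K, |ϱ K * u K i * u K j|
      ≤ M.vol * ∑ K, (ϱ K * u K i ^ 2 + ϱ K * u K j ^ 2) := by
    refine mul_le_mul_of_nonneg_left (Finset.sum_le_sum fun K _ => ?_) M.vol_pos.le
    rw [mul_assoc, abs_mul, abs_of_nonneg (hϱ K), ← mul_add]
    refine mul_le_mul_of_nonneg_left ?_ (hϱ K)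
    rw [abs_le]
    constructor <;> nlinarith [sq_nonneg (u K i - u K j), sq_nonneg (u K i + u K j),
      sq_nonneg (u K i), sq_nonneg (u K j)]
  rw [Finset.sum_add_distrib, mul_add] at h3
  linarith

end

section

variable {a γ μ lam ε dt : ℝ} {N : ℕ} {ϱ₀ : Pt d → ℝ} {u₀ : Pt d → Pt d}
  {ϱ : ℕ → M.Cell → ℝ} {u : ℕ → M.Cell → Pt d}

theorem IsNumericalSolution.nonneg (h : M.IsNumericalSolution a γ μ lam ε dt N ϱ₀ u₀ ϱ u)
    (hdt : 0 < dt) (hpos : ∀ᵐ x ∂(volume.restrict (cube d)), 0 < ϱ₀ x) :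
    ∀ k ≤ N, ∀ K, 0 ≤ ϱ k K := by
  intro k
  induction k with
  | zero =>
    intro _ K
    rw [h.init_density, proj]
    refine mul_nonneg (by have := M.vol_pos; positivity) (integral_nonneg_of_ae ?_)
    filter_upwards [ae_restrict_of_ae_restrict_of_subset (M.region_subset_cube K) hpos] with x hx
    exact hx.le
  | succ k ih =>
    intro hk
    exact (h.continuity (k + 1) (by omega) hk).nonneg M hdt (ih (by omega))

theorem IsNumericalSolution.energy_le (h : M.IsNumericalSolution a γ μ lam ε dt N ϱ₀ u₀ ϱ u)
    (hdt : 0 < dt) (ha : 0 < a) (hγ : 1 < γ) (hlam : -μ ≤ lam)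
    (hϱ : ∀ k ≤ N, ∀ K, 0 ≤ ϱ k K) : ∀ k ≤ N, M.energy a γ (ϱ k) (u k)
      + ∑ l ∈ Finset.range k, dt * M.dissipation μ ε (ϱ (l + 1)) (u (l + 1))
      ≤ M.energy a γ (ϱ 0) (u 0) := by
  intro k
  induction k with
  | zero => intro _; simp
  | succ k ih =>
    intro hk
    have h1 := M.energy_step ha hγ hlam hdt (hϱ k (by omega)) (hϱ (k + 1) hk)
      (h.continuity (k + 1) (by omega) hk) (h.momentum (k + 1) (by omega) hk)
    rw [Finset.sum_range_succ]
    have h2 := ih (by omega)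
    simp only [Nat.add_sub_cancel] at h1
    linarith

end

end Mesh
end FVNS

namespace FVNS

variable {d : ℕ}

namespace Mesh

variable (M : Mesh d)

/-- The common bound for the integrals that occur in the consistency errors. -/
def stateBound (a γ 𝓔 : ℝ) : ℝ := 1 + (γ - 1) / a * 𝓔 + 4 * 𝓔

/-- The constant in the bound of the consistency error of one time step. -/
def stepConst (d : ℕ) (a μ lam c S : ℝ) : ℝ :=
  d * (4 * c * S + 2 * (1 + c) * (S + 1)) + 2 * c * (a * S + (μ + lam) * (d * (1 + 1 / μ)))
    + 3 * c * d * (μ + 1)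

theorem stepConst_nonneg (d : ℕ) {a μ lam c S : ℝ} (ha : 0 < a) (hμ : 0 < μ) (hlam : -μ ≤ lam)
    (hc : 0 ≤ c) (hS : 0 ≤ S) : 0 ≤ stepConst d a μ lam c S := by
  have : 0 ≤ μ + lam := by linarith
  unfold stepConst
  positivity

theorem fluxError_le {B δ κ c S X μ a lam ν : ℝ} (hB : 0 ≤ B) (hμ : 0 < μ) (hlam : -μ ≤ lam)
    (hc : 0 ≤ c) (hκ : 0 ≤ κ) (hκ1 : κ ≤ 1) (hS : 0 ≤ S) (ha : 0 < a) (hX : 0 ≤ X) (hδ0 : 0 ≤ δ)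
    (hδ : δ ≤ c * B * κ) (hν0 : 0 ≤ ν) (hν : ν ≤ μ) {q s r : M.Cell → ℝ} {u : M.Cell → Pt d}
    (h1 : M.vol * ∑ K, |q K| ≤ S) (h2 : ∀ j, M.vol * ∑ K, |q K * u K j| ≤ S)
    (h3 : ∀ j, M.vol * M.jumpWeight j q (fun L => u L j) ≤ κ * (2 * S + 2 * X))
    (h4 : M.vol * ∑ K, |s K| ≤ a * S + (μ + lam) * (d * (1 + X / μ)))
    (h5 : ∀ j, M.vol * ∑ K, |M.jump j r K / M.step j| ≤ 1 + X / μ) :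
    M.fluxError B δ ν q s r u ≤ κ * B * stepConst d a μ lam c S * (1 + X) := by
  have hml : 0 ≤ μ + lam := by linarith
  have hBκ : 0 ≤ κ * B := mul_nonneg hκ hB
  have hδB : B + δ ≤ B * (1 + c) := by
    have := mul_le_mul_of_nonneg_left hκ1 (mul_nonneg hc hB)
    linarith
  have e1 : ∑ j : Fin d, (δ * (M.vol * ∑ K, |q K|) + 3 * δ * (M.vol * ∑ K, |q K * u K j|)
      + (B + δ) * (M.vol * M.jumpWeight j q (fun L => u L j)))
      ≤ κ * B * (d * (4 * c * S + 2 * (1 + c) * (S + 1))) * (1 + X) := by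
    have : ∀ j ∈ Finset.univ, (δ * (M.vol * ∑ K, |q K|) + 3 * δ * (M.vol * ∑ K, |q K * u K j|)
      + (B + δ) * (M.vol * M.jumpWeight j q (fun L => u L j)))
      ≤ κ * B * (4 * c * S + 2 * (1 + c) * (S + 1)) * (1 + X) := fun j _ => by
      have hj := M.jumpWeight_nonneg j q (fun L => u L j)
      have hv := M.vol_pos.le
      calc _ ≤ c * B * κ * S + 3 * (c * B * κ) * S + B * (1 + c) * (κ * (2 * S + 2 * X)) := by
            refine add_le_add ?_ (mul_le_mul hδB (h3 j) (by positivity) (by positivity))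
            gcongr
            exact h2 j
        _ = κ * B * (4 * c * S + 2 * (1 + c) * (S + X)) := by ring
        _ ≤ κ * B * ((4 * c * S + 2 * (1 + c) * (S + 1)) * (1 + X)) := by
            refine mul_le_mul_of_nonneg_left ?_ hBκ
            have p1 : 0 ≤ c * S := mul_nonneg hc hS
            have p2 : 0 ≤ c * S * X := mul_nonneg p1 hX
            have p3 : 0 ≤ (1 + c) * (1 + S * X) := by positivity
            nlinarith
        _ = _ := by ring
    refine (Finset.sum_le_sum this).trans (le_of_eq ?_)
    simp
    ring
  have hXμ : 1 + X / μ ≤ (1 + 1 / μ) * (1 + X) := by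
    have : (1 + 1 / μ) * (1 + X) = 1 + X / μ + (X + 1 / μ) := by ring
    have h1 : 0 < 1 / μ := by positivity
    linarith
  have e2 : 2 * δ * (M.vol * ∑ K, |s K|)
      ≤ κ * B * (2 * c * (a * S + (μ + lam) * (d * (1 + 1 / μ)))) * (1 + X) := by
    have hv := M.vol_pos.le
    calc _ ≤ 2 * (c * B * κ) * (a * S + (μ + lam) * (d * (1 + X / μ))) := by gcongr
      _ ≤ 2 * (c * B * κ) * (a * S * (1 + X) + (μ + lam) * (d * ((1 + 1 / μ) * (1 + X)))) := by
          have : a * S ≤ a * S * (1 + X) :=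
            le_mul_of_one_le_right (mul_nonneg ha.le hS) (by linarith)
          gcongr
      _ = _ := by ring
  have e3 : 3 * ν * δ * ∑ j, M.vol * ∑ K, |M.jump j r K / M.step j|
      ≤ κ * B * (3 * c * d * (μ + 1)) * (1 + X) := by
    have h6 : ∑ j, M.vol * ∑ K, |M.jump j r K / M.step j| ≤ d * (1 + X / μ) := by
      refine (Finset.sum_le_sum fun j _ => h5 j).trans (le_of_eq ?_)
      rw [Finset.sum_const, Finset.card_univ, Fintype.card_fin, nsmul_eq_mul]
    have h7 : 0 ≤ ∑ j, M.vol * ∑ K, |M.jump j r K / M.step j| :=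
      Finset.sum_nonneg fun j _ => mul_nonneg M.vol_pos.le
        (Finset.sum_nonneg fun K _ => abs_nonneg _)
    calc _ ≤ 3 * μ * (c * B * κ) * (d * ((1 + 1 / μ) * (1 + X))) := by
          gcongr
          exact h6.trans (mul_le_mul_of_nonneg_left hXμ (Nat.cast_nonneg d))
      _ = _ := by field_simp
  rw [fluxError, stepConst]
  linarith

/-- The constant in the bound of the flux in the initial time step. -/
def initConst (d : ℕ) (a μ lam η S U : ℝ) : ℝ :=
  d * S + a * S + 21 * (μ + lam) * η * U + 49 * μ * η * (d * U)

/-- The residual of a balance law of the scheme is of the order of `h^β`. -/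
theorem abs_weak_residual_le_size {T B : ℝ} {ψ Dt : ℝ → Pt d → ℝ} {Dx : Fin d → ℝ → Pt d → ℝ}
    (h : TestData T B ψ Dt Dx) (hB : 0 ≤ B) {dt ε ν κ c₂ P Q 𝓔 : ℝ} {N : ℕ}
    (hN : 0 < N) (hdt : 0 < dt) (hT : N * dt = T) (hε : 0 < ε) (hν : 0 ≤ ν) (i₀ : Fin d)
    (q s r : ℕ → M.Cell → ℝ) (u : ℕ → M.Cell → Pt d) (X : ℕ → ℝ)
    (hscheme : ∀ k, 1 ≤ k → k ≤ N → ∀ φ : M.Cell → ℝ,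
      ∑ K, M.vol * ((q k K - q (k - 1) K) / dt * φ K)
        = M.discreteFlux ε i₀ ν (q k) (s k) (r k) (u k) φ)
    (hκ : 0 ≤ κ) (hdtκ : dt ≤ c₂ * κ) (hP : 0 ≤ P) (hQ : 0 ≤ Q)
    (hX : ∀ k < N, ∑ l ∈ Finset.range k, dt * X (l + 1) ≤ 𝓔)
    (h0 : ∀ t, |M.weakFlux Dx i₀ ν (q 0) (s 0) (r 0) (u 0) t| ≤ B * P)
    (hE : ∀ k, 1 ≤ k → k < N →
      M.fluxError B (B * (dt + 7 * M.size)) ν (q k) (s k) (r k) (u k)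
        ≤ κ * B * Q * (1 + X k)) :
    |- ∑ K, q 0 K * (∫ x in M.region K, ψ 0 x)
      - ∑ k ∈ Finset.range N, ∫ t in (k * dt)..((k + 1 : ℕ) * dt),
        (∑ K, q k K * (∫ x in M.region K, Dt t x)
          + M.weakFlux Dx i₀ ν (q k) (s k) (r k) (u k) t)|
      ≤ B * κ * (c₂ * P + Q * (T + 𝓔)) := by
  set E : ℕ → ℝ := fun k => if k = 0 then B * P else κ * B * Q * (1 + X k) with hEdef
  have main := M.abs_weak_residual_le h hB hN hdt hT hε hν i₀ q s r u hscheme (E := E)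
    (fun t => by simpa [hEdef] using h0 t) (fun k hk1 hkN => by
      have : k ≠ 0 := by omega
      simpa [hEdef, this] using hE k hk1 hkN)
  refine main.trans ?_
  obtain ⟨n, rfl⟩ := Nat.exists_eq_succ_of_ne_zero hN.ne'
  rw [Nat.succ_eq_add_one] at *
  have e : dt * ∑ k ∈ Finset.range (n + 1), E k
      = κ * B * Q * (n * dt + ∑ l ∈ Finset.range n, dt * X (l + 1)) + dt * (B * P) := by
    rw [Finset.sum_range_succ', mul_add]
    simp only [hEdef, if_true, Nat.add_eq_zero_iff, one_ne_zero, and_false, if_false]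
    rw [← Finset.mul_sum, ← Finset.mul_sum, Finset.sum_add_distrib]
    simp only [Finset.sum_const, Finset.card_range, nsmul_eq_mul, mul_one]
    ring
  rw [e]
  have h1 := hX n (by omega)
  have h2 : (n : ℝ) * dt ≤ T := by
    rw [← hT]; push_cast; linarith
  have h3 : 0 ≤ κ * B * Q := by positivity
  have h4 := mul_le_mul_of_nonneg_left (add_le_add h2 h1) h3
  have h5 := mul_le_mul_of_nonneg_right hdtκ (mul_nonneg hB hP)
  linarith

end Mesh

end FVNS

namespace FVNS

variable {d : ℕ}

namespace Mesh

variable (M : Mesh d)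

section

variable {a γ μ lam ε dt T η c₁ c₂ 𝓔 U : ℝ} {N : ℕ} {ϱ₀ : Pt d → ℝ} {u₀ : Pt d → Pt d}
  {ϱ : ℕ → M.Cell → ℝ} {u : ℕ → M.Cell → Pt d}

/-- The constant in the consistency estimate of a scalar balance law. -/
def consistencyConst (d : ℕ) (T a γ μ lam η c₂ 𝓔 U : ℝ) : ℝ :=
  c₂ * initConst d a μ lam η (stateBound a γ 𝓔) U
    + stepConst d a μ lam (c₂ + 7) (stateBound a γ 𝓔) * (T + 𝓔)

theorem stateBound_nonneg (ha : 0 < a) (hγ : 1 < γ) (h𝓔 : 0 ≤ 𝓔) : 0 ≤ stateBound a γ 𝓔 := by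
  have : 0 < γ - 1 := by linarith
  unfold stateBound
  positivity

theorem initConst_nonneg {S : ℝ} (ha : 0 < a) (hμ : 0 < μ) (hlam : -μ ≤ lam) (hη : 0 ≤ η)
    (hS : 0 ≤ S) (hU : 0 ≤ U) : 0 ≤ initConst d a μ lam η S U := by
  have : 0 ≤ μ + lam := by linarith
  unfold initConst
  positivity

theorem consistencyConst_nonneg (hT : 0 < T) (ha : 0 < a) (hγ : 1 < γ) (hμ : 0 < μ)
    (hlam : -μ ≤ lam) (hη : 0 ≤ η) (hc₂ : 0 < c₂) (h𝓔 : 0 ≤ 𝓔) (hU : 0 ≤ U) :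
    0 ≤ consistencyConst d T a γ μ lam η c₂ 𝓔 U := by
  have hS := stateBound_nonneg ha hγ h𝓔
  have h1 := initConst_nonneg (d := d) ha hμ hlam hη hS hU
  have h2 := stepConst_nonneg d ha hμ hlam (by linarith : 0 ≤ c₂ + 7) hS
  unfold consistencyConst
  positivity

/-- The assumptions of the consistency estimates, with a bound `𝓔` for the initial energy and a
bound `U` for the `L¹` norm of the initial velocity. -/
structure IsBoundedSolution (a γ μ lam ε dt T η c₂ 𝓔 U : ℝ) (N : ℕ) (ϱ : ℕ → M.Cell → ℝ)
    (u : ℕ → M.Cell → Pt d) : Prop where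
  a_pos : 0 < a
  one_lt_γ : 1 < γ
  μ_pos : 0 < μ
  lam_ge : -μ ≤ lam
  ε_pos : 0 < ε
  ε_lt : ε < 1
  dt_pos : 0 < dt
  N_pos : 0 < N
  N_mul_dt : N * dt = T
  dt_le : dt ≤ c₂ * M.size
  c₂_pos : 0 < c₂
  η_nonneg : 0 ≤ η
  regular : M.IsRegular η
  U_nonneg : 0 ≤ U
  velocity_le : ∑ j, M.vol * ∑ K, |u 0 K j| ≤ U
  nonneg : ∀ k ≤ N, ∀ K, 0 ≤ ϱ k K
  energy_le : ∀ k ≤ N, M.energy a γ (ϱ k) (u k)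
      + ∑ l ∈ Finset.range k, dt * M.dissipation μ ε (ϱ (l + 1)) (u (l + 1)) ≤ 𝓔
  continuity : ∀ k, 1 ≤ k → k ≤ N → M.ContinuityStep ε dt (ϱ (k - 1)) (ϱ k) (u k)
  momentum : ∀ k, 1 ≤ k → k ≤ N →
    M.MomentumStep a γ μ lam ε dt (ϱ (k - 1)) (u (k - 1)) (ϱ k) (u k)

namespace IsBoundedSolution

variable {M} {B : ℝ} {ψ Dt : ℝ → Pt d → ℝ} {Dx : Fin d → ℝ → Pt d → ℝ}

theorem energy_le_of_le (h : M.IsBoundedSolution a γ μ lam ε dt T η c₂ 𝓔 U N ϱ u) {k : ℕ}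
    (hk : k ≤ N) : M.energy a γ (ϱ k) (u k) ≤ 𝓔 := by
  refine le_trans (le_add_of_nonneg_right (Finset.sum_nonneg fun l hl => ?_)) (h.energy_le k hk)
  have := Finset.mem_range.1 hl
  exact mul_nonneg h.dt_pos.le (M.dissipation_nonneg ε h.μ_pos (h.nonneg (l + 1) (by omega)) _)

theorem energyBound_nonneg (h : M.IsBoundedSolution a γ μ lam ε dt T η c₂ 𝓔 U N ϱ u) : 0 ≤ 𝓔 :=
  (M.energy_nonneg h.a_pos h.one_lt_γ (h.nonneg 0 (Nat.zero_le _)) _).trans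
    (h.energy_le_of_le (Nat.zero_le _))

theorem sum_dissipation_le (h : M.IsBoundedSolution a γ μ lam ε dt T η c₂ 𝓔 U N ϱ u) (k : ℕ)
    (hk : k < N) :
    ∑ l ∈ Finset.range k, dt * M.dissipation μ ε (ϱ (l + 1)) (u (l + 1)) ≤ 𝓔 := by
  have h1 := h.energy_le k hk.le
  have h2 := M.energy_nonneg h.a_pos h.one_lt_γ (h.nonneg k hk.le) (u k)
  linarith

theorem size_le (h : M.IsBoundedSolution a γ μ lam ε dt T η c₂ 𝓔 U N ϱ u) (i₀ : Fin d) :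
    M.size ≤ M.size ^ ((1 - ε) / 2) := by
  have hε := h.ε_pos
  calc M.size = M.size ^ (1 : ℝ) := (Real.rpow_one _).symm
    _ ≤ _ := Real.rpow_le_rpow_of_exponent_ge (M.size_pos i₀) M.size_le_one (by linarith)

theorem sum_density_le_stateBound (h : M.IsBoundedSolution a γ μ lam ε dt T η c₂ 𝓔 U N ϱ u)
    {k : ℕ} (hk : k ≤ N) : M.vol * ∑ K, ϱ k K ≤ stateBound a γ 𝓔 := by
  have h1 := M.sum_density_le h.a_pos h.one_lt_γ (h.nonneg k hk) (h.energy_le_of_le hk)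
  have h2 := h.energyBound_nonneg
  unfold stateBound
  linarith

theorem sum_momentum_le_stateBound (h : M.IsBoundedSolution a γ μ lam ε dt T η c₂ 𝓔 U N ϱ u)
    {k : ℕ} (hk : k ≤ N) (i : Fin d) : M.vol * ∑ K, |ϱ k K * u k K i| ≤ stateBound a γ 𝓔 := by
  have h1 := M.sum_abs_momentum_le h.a_pos h.one_lt_γ (h.nonneg k hk) (h.energy_le_of_le hk) i
  have h2 := h.energyBound_nonneg
  unfold stateBound
  linarith

theorem four_mul_energyBound_le (h : M.IsBoundedSolution a γ μ lam ε dt T η c₂ 𝓔 U N ϱ u) :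
    4 * 𝓔 ≤ stateBound a γ 𝓔 := by
  have h1 := h.one_lt_γ
  have h2 : 0 ≤ (γ - 1) / a * 𝓔 :=
    mul_nonneg (div_nonneg (by linarith) h.a_pos.le) h.energyBound_nonneg
  unfold stateBound
  linarith

theorem sum_pressure_le (h : M.IsBoundedSolution a γ μ lam ε dt T η c₂ 𝓔 U N ϱ u)
    {k : ℕ} (hk : k ≤ N) : M.vol * ∑ K, |a * ϱ k K ^ γ| ≤ a * stateBound a γ 𝓔 := by
  have h1 := M.sum_density_rpow_le h.a_pos h.one_lt_γ (h.nonneg k hk) (h.energy_le_of_le hk)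
  have h2 := h.energyBound_nonneg
  have e : ∀ K, |a * ϱ k K ^ γ| = a * ϱ k K ^ γ := fun K =>
    abs_of_nonneg (mul_nonneg h.a_pos.le (Real.rpow_nonneg (h.nonneg k hk K) γ))
  simp only [e]
  rw [← Finset.mul_sum, mul_left_comm]
  refine mul_le_mul_of_nonneg_left ?_ h.a_pos.le
  unfold stateBound
  linarith

theorem jumpWeight_density_le (h : M.IsBoundedSolution a γ μ lam ε dt T η c₂ 𝓔 U N ϱ u)
    {k : ℕ} (hk : k ≤ N) (j : Fin d) :
    M.vol * M.jumpWeight j (ϱ k) (fun L => u k L j) ≤ M.size ^ ((1 - ε) / 2)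
      * (2 * stateBound a γ 𝓔 + 2 * M.dissipation μ ε (ϱ k) (u k)) := by
  have h1 := M.vol_mul_jumpWeight_le (ε := ε) h.μ_pos (h.nonneg k hk) (u k) j j (fun _ => 1)
    (S := stateBound a γ 𝓔) (by simpa using h.sum_density_le_stateBound hk)
  simpa only [mul_one] using h1

theorem jumpWeight_momentum_le (h : M.IsBoundedSolution a γ μ lam ε dt T η c₂ 𝓔 U N ϱ u)
    {k : ℕ} (hk : k ≤ N) (i j : Fin d) :
    M.vol * M.jumpWeight j (fun K => ϱ k K * u k K i) (fun L => u k L j)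
      ≤ M.size ^ ((1 - ε) / 2)
        * (2 * stateBound a γ 𝓔 + 2 * M.dissipation μ ε (ϱ k) (u k)) := by
  refine M.vol_mul_jumpWeight_le h.μ_pos (h.nonneg k hk) (u k) j j (fun K => u k K i) ?_
  have h1 := M.sum_density_mul_sq_le h.a_pos h.one_lt_γ (h.nonneg k hk) (h.energy_le_of_le hk) i
  linarith [h.four_mul_energyBound_le, h.energyBound_nonneg]

theorem sum_stress_le (h : M.IsBoundedSolution a γ μ lam ε dt T η c₂ 𝓔 U N ϱ u)
    {k : ℕ} (hk : k ≤ N) :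
    M.vol * ∑ K, |a * ϱ k K ^ γ - (μ + lam) * M.divh (u k) K| ≤ a * stateBound a γ 𝓔
      + (μ + lam) * (d * (1 + M.dissipation μ ε (ϱ k) (u k) / μ)) := by
  have hml : 0 ≤ μ + lam := by linarith [h.lam_ge]
  have hv := M.vol_pos
  have h1 : M.vol * ∑ K, |M.divh (u k) K| ≤ d * (1 + M.dissipation μ ε (ϱ k) (u k) / μ) := by
    calc _ ≤ M.vol * ∑ i, ∑ K, |M.jump i (fun L => u k L i) K / M.step i| :=
          mul_le_mul_of_nonneg_left (M.sum_abs_divh_le (u k)) hv.le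
      _ = ∑ i, M.vol * ∑ K, |M.jump i (fun L => u k L i) K / M.step i| := Finset.mul_sum _ _ _
      _ ≤ ∑ _i : Fin d, (1 + M.dissipation μ ε (ϱ k) (u k) / μ) := Finset.sum_le_sum fun i _ =>
          M.sum_abs_jump_div_step_le ε h.μ_pos (h.nonneg k hk) (u k) i i
      _ = _ := by rw [Finset.sum_const, Finset.card_univ, Fintype.card_fin, nsmul_eq_mul]
  calc M.vol * ∑ K, |a * ϱ k K ^ γ - (μ + lam) * M.divh (u k) K|
      ≤ M.vol * ∑ K, (|a * ϱ k K ^ γ| + (μ + lam) * |M.divh (u k) K|) := by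
        refine mul_le_mul_of_nonneg_left (Finset.sum_le_sum fun K _ => ?_) hv.le
        refine (abs_sub _ _).trans (le_of_eq ?_)
        rw [abs_mul (μ + lam), abs_of_nonneg hml]
    _ = M.vol * ∑ K, |a * ϱ k K ^ γ| + (μ + lam) * (M.vol * ∑ K, |M.divh (u k) K|) := by
        rw [Finset.sum_add_distrib, ← Finset.mul_sum]; ring
    _ ≤ _ := add_le_add (h.sum_pressure_le hk) (mul_le_mul_of_nonneg_left h1 hml)

theorem gradient_defect_le (h : M.IsBoundedSolution a γ μ lam ε dt T η c₂ 𝓔 U N ϱ u)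
    (i₀ : Fin d) (hB : 0 ≤ B) :
    B * (dt + 7 * M.size) ≤ (c₂ + 7) * B * M.size ^ ((1 - ε) / 2) := by
  have h1 := h.dt_le
  have h2 := mul_le_mul_of_nonneg_left (h.size_le i₀)
    (by linarith [h.c₂_pos] : (0 : ℝ) ≤ c₂ + 7)
  calc B * (dt + 7 * M.size) ≤ B * ((c₂ + 7) * M.size ^ ((1 - ε) / 2)) :=
        mul_le_mul_of_nonneg_left (by linarith) hB
    _ = _ := by ring

/-- The residual of the continuity equation. -/
theorem continuity_residual_le (h : M.IsBoundedSolution a γ μ lam ε dt T η c₂ 𝓔 U N ϱ u)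
    (hψ : TestData T B ψ Dt Dx) (hB : 0 ≤ B) (i₀ : Fin d) :
    |- ∑ K, ϱ 0 K * (∫ x in M.region K, ψ 0 x)
      - ∑ k ∈ Finset.range N, ∫ t in (k * dt)..((k + 1 : ℕ) * dt),
        (∑ K, ϱ k K * (∫ x in M.region K, Dt t x)
          + M.weakFlux Dx i₀ 0 (ϱ k) (fun _ => 0) (fun _ => 0) (u k) t)|
      ≤ B * M.size ^ ((1 - ε) / 2) * consistencyConst d T a γ μ lam η c₂ 𝓔 U := by
  have hS := stateBound_nonneg h.a_pos h.one_lt_γ h.energyBound_nonneg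
  have hP := initConst_nonneg (d := d) h.a_pos h.μ_pos h.lam_ge h.η_nonneg hS h.U_nonneg
  have hc : 0 ≤ c₂ + 7 := by linarith [h.c₂_pos]
  have hκ : 0 ≤ M.size ^ ((1 - ε) / 2) := Real.rpow_nonneg M.size_nonneg _
  have hκ1 : M.size ^ ((1 - ε) / 2) ≤ 1 :=
    Real.rpow_le_one M.size_nonneg M.size_le_one (by linarith [h.ε_lt])
  have hml : 0 ≤ μ + lam := by linarith [h.lam_ge]
  have hμ := h.μ_pos
  have ha := h.a_pos
  have hη := h.η_nonneg
  have hU := h.U_nonneg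
  refine M.abs_weak_residual_le_size hψ hB h.N_pos h.dt_pos h.N_mul_dt h.ε_pos le_rfl i₀ ϱ
    (fun _ _ => 0) (fun _ _ => 0) u (fun k => M.dissipation μ ε (ϱ k) (u k))
    (fun k hk1 hk φ => (h.continuity k hk1 hk).eq_discreteFlux M i₀ φ) hκ
    (h.dt_le.trans (mul_le_mul_of_nonneg_left (h.size_le i₀) h.c₂_pos.le)) hP
    (stepConst_nonneg d h.a_pos h.μ_pos h.lam_ge hc hS) h.sum_dissipation_le (fun t => ?_)
    (fun k hk1 hkN => ?_)
  · refine (M.abs_weakFlux_le hψ hB i₀ le_rfl h.regular (ϱ 0) (fun _ => 0) (fun _ => 0)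
      (fun _ => 0) 0 le_rfl (u 0) (fun K => by ring) t).trans
      (mul_le_mul_of_nonneg_left ?_ hB)
    have h1 : ∑ j, M.vol * ∑ K, |ϱ 0 K * u 0 K j| ≤ d * stateBound a γ 𝓔 := by
      refine (Finset.sum_le_sum fun j _ => h.sum_momentum_le_stateBound (Nat.zero_le _) j).trans
        (le_of_eq ?_)
      rw [Finset.sum_const, Finset.card_univ, Fintype.card_fin, nsmul_eq_mul]
    have h2 : 0 ≤ a * stateBound a γ 𝓔 + 21 * (μ + lam) * η * U + 49 * μ * η * (d * U) := by
      positivity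
    simp only [abs_zero, Finset.sum_const_zero, mul_zero, zero_mul, add_zero, initConst]
    linarith
  · have hD := M.dissipation_nonneg ε h.μ_pos (h.nonneg k hkN.le) (u k)
    refine M.fluxError_le hB h.μ_pos h.lam_ge hc hκ hκ1 hS h.a_pos hD
      (mul_nonneg hB (by linarith [h.dt_pos, M.size_nonneg])) (h.gradient_defect_le i₀ hB) le_rfl
      h.μ_pos.le ?_ (h.sum_momentum_le_stateBound hkN.le) (h.jumpWeight_density_le hkN.le) ?_ ?_
    · simp only [abs_of_nonneg (h.nonneg k hkN.le _)]
      exact h.sum_density_le_stateBound hkN.le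
    · simp only [abs_zero, Finset.sum_const_zero, mul_zero]
      positivity
    · intro j
      simp only [jump, sub_self, zero_div, abs_zero, Finset.sum_const_zero, mul_zero]
      positivity

/-- The residual of the momentum equation. -/
theorem momentum_residual_le (h : M.IsBoundedSolution a γ μ lam ε dt T η c₂ 𝓔 U N ϱ u)
    (hψ : TestData T B ψ Dt Dx) (hB : 0 ≤ B) (i : Fin d) :
    |- ∑ K, ϱ 0 K * u 0 K i * (∫ x in M.region K, ψ 0 x)
      - ∑ k ∈ Finset.range N, ∫ t in (k * dt)..((k + 1 : ℕ) * dt),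
        (∑ K, ϱ k K * u k K i * (∫ x in M.region K, Dt t x)
          + M.weakFlux Dx i μ (fun K => ϱ k K * u k K i)
            (fun K => a * ϱ k K ^ γ - (μ + lam) * M.divh (u k) K) (fun K => u k K i) (u k) t)|
      ≤ B * M.size ^ ((1 - ε) / 2) * consistencyConst d T a γ μ lam η c₂ 𝓔 U := by
  have hS := stateBound_nonneg h.a_pos h.one_lt_γ h.energyBound_nonneg
  have hP := initConst_nonneg (d := d) h.a_pos h.μ_pos h.lam_ge h.η_nonneg hS h.U_nonneg
  have hc : 0 ≤ c₂ + 7 := by linarith [h.c₂_pos]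
  have hκ : 0 ≤ M.size ^ ((1 - ε) / 2) := Real.rpow_nonneg M.size_nonneg _
  have hκ1 : M.size ^ ((1 - ε) / 2) ≤ 1 :=
    Real.rpow_le_one M.size_nonneg M.size_le_one (by linarith [h.ε_lt])
  have hml : 0 ≤ μ + lam := by linarith [h.lam_ge]
  have hμ := h.μ_pos
  have hη := h.η_nonneg
  have h4 := h.four_mul_energyBound_le
  have hmm : ∀ k ≤ N, ∀ j, M.vol * ∑ K, |ϱ k K * u k K i * u k K j| ≤ stateBound a γ 𝓔 :=
    fun k hk j => (M.sum_abs_momentum_mul_le h.a_pos h.one_lt_γ (h.nonneg k hk)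
      (h.energy_le_of_le hk) i j).trans h4
  refine M.abs_weak_residual_le_size hψ hB h.N_pos h.dt_pos h.N_mul_dt h.ε_pos h.μ_pos.le i
    (fun k K => ϱ k K * u k K i) (fun k K => a * ϱ k K ^ γ - (μ + lam) * M.divh (u k) K)
    (fun k K => u k K i) u (fun k => M.dissipation μ ε (ϱ k) (u k))
    (fun k hk1 hk φ => (h.momentum k hk1 hk).eq_discreteFlux M i φ) hκ
    (h.dt_le.trans (mul_le_mul_of_nonneg_left (h.size_le i) h.c₂_pos.le)) hP
    (stepConst_nonneg d h.a_pos h.μ_pos h.lam_ge hc hS) h.sum_dissipation_le (fun t => ?_)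
    (fun k hk1 hkN => ?_)
  · refine (M.abs_weakFlux_le hψ hB i h.μ_pos.le h.regular (fun K => ϱ 0 K * u 0 K i)
      (fun K => a * ϱ 0 K ^ γ) _ (fun K => u 0 K i) (μ + lam) hml (u 0) (fun K => rfl) t).trans
      (mul_le_mul_of_nonneg_left ?_ hB)
    have h1 : ∑ j, M.vol * ∑ K, |ϱ 0 K * u 0 K i * u 0 K j| ≤ d * stateBound a γ 𝓔 := by
      refine (Finset.sum_le_sum fun j _ => hmm 0 (Nat.zero_le _) j).trans (le_of_eq ?_)
      rw [Finset.sum_const, Finset.card_univ, Fintype.card_fin, nsmul_eq_mul]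
    have h2 : M.vol * ∑ K, |u 0 K i| ≤ U :=
      (Finset.single_le_sum (f := fun j => M.vol * ∑ K, |u 0 K j|)
        (fun j _ => mul_nonneg M.vol_pos.le (Finset.sum_nonneg fun _ _ => abs_nonneg _))
        (Finset.mem_univ i)).trans h.velocity_le
    have h3 := h.velocity_le
    have h5 := h.sum_pressure_le (Nat.zero_le N)
    unfold initConst
    gcongr
  · have hD := M.dissipation_nonneg ε h.μ_pos (h.nonneg k hkN.le) (u k)
    exact M.fluxError_le hB h.μ_pos h.lam_ge hc hκ hκ1 hS h.a_pos hD
      (mul_nonneg hB (by linarith [h.dt_pos, M.size_nonneg])) (h.gradient_defect_le i hB)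
      h.μ_pos.le le_rfl (h.sum_momentum_le_stateBound hkN.le i) (hmm k hkN.le)
      (h.jumpWeight_momentum_le hkN.le i) (h.sum_stress_le hkN.le)
      (fun j => M.sum_abs_jump_div_step_le ε h.μ_pos (h.nonneg k hkN.le) (u k) j i)

end IsBoundedSolution

end

end Mesh

/-! ### The weak formulations with a residual -/

section

variable {M : Mesh d} {a γ μ lam ε dt T η c₂ 𝓔 U : ℝ} {N : ℕ}
  {ϱ : ℕ → M.Cell → ℝ} {u : ℕ → M.Cell → Pt d}

theorem integral_const_div (hT : 0 < T) (R : ℝ) : ∫ _t in (0 : ℝ)..T, R / T = R := by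
  rw [intervalIntegral.integral_const, smul_eq_mul, sub_zero, mul_div_cancel₀ _ hT.ne']

theorem exists_continuity_residual
    (h : M.IsBoundedSolution a γ μ lam ε dt T η c₂ 𝓔 U N ϱ u) (hT : 0 < T) (i₀ : Fin d)
    {φ : ℝ → Pt d → ℝ} (hφ : IsTest T φ) :
    ∃ e : ℝ → ℝ, IntervalIntegrable e volume 0 T ∧ WeakContinuity M T dt ϱ u φ e ∧
      ∫ t in (0 : ℝ)..T, |e t| ≤ cNorm T 2 φ * M.size ^ ((1 - ε) / 2)
        * Mesh.consistencyConst d T a γ μ lam η c₂ 𝓔 U := by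
  obtain ⟨ψ, Dt, Dx, hψ, e0, et, ex⟩ := hφ.exists_testData hT (ContinuousLinearMap.id ℝ ℝ)
    ContinuousLinearMap.norm_id_le
  simp only [ContinuousLinearMap.id_apply] at e0 et ex
  have hres := h.continuity_residual_le hψ (cNorm_nonneg T 2 φ) i₀
  set R := - ∑ K, ϱ 0 K * (∫ x in M.region K, ψ 0 x)
      - ∑ k ∈ Finset.range N, ∫ t in (k * dt)..((k + 1 : ℕ) * dt),
        (∑ K, ϱ k K * (∫ x in M.region K, Dt t x)
          + M.weakFlux Dx i₀ 0 (ϱ k) (fun _ => 0) (fun _ => 0) (u k) t) with hR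
  refine ⟨fun _ => R / T, intervalIntegrable_const, ?_, ?_⟩
  · rw [WeakContinuity, integral_const_div hT,
      weakContinuity_integral M hψ et ex h.dt_pos h.N_mul_dt i₀ ϱ u, hR]
    have : ∫ x in cube d, ϱ 0 (M.cellAt x) * φ 0 x
        = ∑ K, ϱ 0 K * (∫ x in M.region K, ψ 0 x) := by
      simp only [e0 0 ⟨le_rfl, hT⟩]
      exact M.setIntegral_cellAt_mul _ (hψ.continuous_slice 0)
    rw [this]
    ring
  · simp only [abs_div, abs_of_pos hT]
    rw [integral_const_div hT]
    exact hres

theorem exists_momentum_residual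
    (h : M.IsBoundedSolution a γ μ lam ε dt T η c₂ 𝓔 U N ϱ u) (hT : 0 < T)
    {φ : ℝ → Pt d → Pt d} (hφ : IsTest T φ) :
    ∃ e : ℝ → ℝ, IntervalIntegrable e volume 0 T ∧
      WeakMomentum M a γ μ lam T dt ϱ u φ e ∧
      ∫ t in (0 : ℝ)..T, |e t| ≤ d * (cNorm T 2 φ * M.size ^ ((1 - ε) / 2)
        * Mesh.consistencyConst d T a γ μ lam η c₂ 𝓔 U) := by
  have hproj : ∀ i : Fin d, ‖ContinuousLinearMap.proj (R := ℝ) (φ := fun _ : Fin d => ℝ) i‖ ≤ 1 :=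
    fun i => ContinuousLinearMap.opNorm_le_bound _ zero_le_one fun x => by
      rw [one_mul]; exact norm_le_pi_norm x i
  choose ψ Dt Dx hψ e0 et ex using fun i => hφ.exists_testData hT
    (ContinuousLinearMap.proj (R := ℝ) (φ := fun _ : Fin d => ℝ) i) (hproj i)
  simp only [ContinuousLinearMap.proj_apply] at e0 et ex
  have hres := fun i => h.momentum_residual_le (hψ i) (cNorm_nonneg T 2 φ) i
  set R : Fin d → ℝ := fun i => - ∑ K, ϱ 0 K * u 0 K i * (∫ x in M.region K, ψ i 0 x)
      - ∑ k ∈ Finset.range N, ∫ t in (k * dt)..((k + 1 : ℕ) * dt),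
        (∑ K, ϱ k K * u k K i * (∫ x in M.region K, Dt i t x)
          + M.weakFlux (Dx i) i μ (fun K => ϱ k K * u k K i)
            (fun K => a * ϱ k K ^ γ - (μ + lam) * M.divh (u k) K) (fun K => u k K i) (u k) t)
    with hR
  refine ⟨fun _ => (∑ i, R i) / T, intervalIntegrable_const, ?_, ?_⟩
  · rw [WeakMomentum, integral_const_div hT,
      weakMomentum_integral M hψ et ex h.dt_pos h.N_mul_dt a γ μ lam ϱ u]
    have : ∫ x in cube d, ∑ i, ϱ 0 (M.cellAt x) * u 0 (M.cellAt x) i * φ 0 x i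
        = ∑ i, ∑ K, ϱ 0 K * u 0 K i * (∫ x in M.region K, ψ i 0 x) := by
      simp only [e0 _ 0 ⟨le_rfl, hT⟩]
      have i1 := fun i => M.integrableOn_cellAt_mul (fun K => ϱ 0 K * u 0 K i)
        ((hψ i).continuous_slice 0)
      rw [integral_finsetSum _ fun i _ => i1 i]
      exact Finset.sum_congr rfl fun i _ =>
        M.setIntegral_cellAt_mul (fun K => ϱ 0 K * u 0 K i) ((hψ i).continuous_slice 0)
    rw [this]
    simp only [hR, Finset.sum_sub_distrib, Finset.sum_neg_distrib]
    ring
  · simp only [abs_div, abs_of_pos hT]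
    rw [integral_const_div hT]
    refine (Finset.abs_sum_le_sum_abs _ _).trans ((Finset.sum_le_sum fun i _ => hres i).trans
      (le_of_eq ?_))
    rw [Finset.sum_const, Finset.card_univ, Fintype.card_fin, nsmul_eq_mul]

end

end FVNS

end

theorem mainTheorem3 (d : ℕ) (hd1 : 1 ≤ d) (hd3 : d ≤ 3) (γ ε : ℝ) (hγ1 : 1 < γ) (hγ2 : γ < 2)
    (hε0 : 0 < ε) (hε : ε < min 1 (2 * (γ - 1))) :
    ∃ β : ℝ, 0 < β ∧
      ∀ (T a μ lam η c₁ c₂ E₀ : ℝ) (ϱ₀ : FVNS.Pt d → ℝ) (u₀ : FVNS.Pt d → FVNS.Pt d),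
        0 < T → 0 < a → 0 < μ → -μ ≤ lam → 0 < c₁ → 0 < c₂ →
        MemLp ϱ₀ (ENNReal.ofReal γ) (volume.restrict (FVNS.cube d)) →
        (∀ᵐ x ∂(volume.restrict (FVNS.cube d)), 0 < ϱ₀ x) →
        MemLp u₀ 2 (volume.restrict (FVNS.cube d)) →
        ∃ C : ℝ, 0 < C ∧
          ∀ (M : FVNS.Mesh d) (N : ℕ) (dt : ℝ),
            M.IsRegular η → 0 < N → dt = T / N → c₁ * M.size ≤ dt → dt ≤ c₂ * M.size →
            ∀ (ϱ : ℕ → M.Cell → ℝ) (u : ℕ → M.Cell → FVNS.Pt d),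
              M.IsNumericalSolution a γ μ lam ε dt N ϱ₀ u₀ ϱ u →
              M.momentumEnergy (ϱ 0) (u 0) ≤ E₀ →
              ∃ (e₁ : (ℝ → FVNS.Pt d → ℝ) → ℝ → ℝ)
                (e₂ : (ℝ → FVNS.Pt d → FVNS.Pt d) → ℝ → ℝ),
                (∀ φ : ℝ → FVNS.Pt d → ℝ, FVNS.IsTest T φ →
                  IntervalIntegrable (e₁ φ) volume 0 T ∧
                  FVNS.WeakContinuity M T dt ϱ u φ (e₁ φ) ∧
                  ∫ t in (0 : ℝ)..T, |e₁ φ t|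
                    ≤ C * M.size ^ β * (FVNS.cNorm T 2 φ + M.size * FVNS.cNorm T 3 φ)) ∧
                (∀ φ : ℝ → FVNS.Pt d → FVNS.Pt d, FVNS.IsTest T φ →
                  IntervalIntegrable (e₂ φ) volume 0 T ∧
                  FVNS.WeakMomentum M a γ μ lam T dt ϱ u φ (e₂ φ) ∧
                  ∫ t in (0 : ℝ)..T, |e₂ φ t|
                    ≤ C * M.size ^ β * (FVNS.cNorm T 2 φ + M.size * FVNS.cNorm T 3 φ)) := by
  have hε1 : ε < 1 := hε.trans_le (min_le_left _ _)
  have i₀ : Fin d := ⟨0, hd1⟩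
  refine ⟨(1 - ε) / 2, by linarith, ?_⟩
  intro T a μ lam η c₁ c₂ E₀ ϱ₀ u₀ hT ha hμ hlam _ hc₂ hϱ₀ hpos hu₀
  have : IsFiniteMeasure (volume.restrict (FVNS.cube d)) :=
    ⟨by rw [Measure.restrict_apply_univ]; exact FVNS.Mesh.volume_cube_lt_top⟩
  have hg : 0 < γ - 1 := by linarith
  have hϱi : IntegrableOn ϱ₀ (FVNS.cube d) :=
    hϱ₀.integrable (by rw [ENNReal.one_le_ofReal]; exact hγ1.le)
  have hϱγ : IntegrableOn (fun x => ‖ϱ₀ x‖ ^ γ) (FVNS.cube d) := by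
    have := hϱ₀.integrable_norm_rpow (by simpa using by linarith) ENNReal.ofReal_ne_top
    rwa [ENNReal.toReal_ofReal (by linarith)] at this
  have hui : ∀ j, IntegrableOn (fun x => u₀ x j) (FVNS.cube d) := fun j =>
    (hu₀.integrable (by norm_num)).eval j
  set 𝓔 := |E₀| / 2 + a / (γ - 1) * ∫ x in FVNS.cube d, ‖ϱ₀ x‖ ^ γ with h𝓔
  set U := ∑ j, ∫ x in FVNS.cube d, |u₀ x j| with hU
  have hU0 : 0 ≤ U := Finset.sum_nonneg fun j _ => integral_nonneg fun x => abs_nonneg _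
  have h𝓔0 : 0 ≤ 𝓔 := by
    have : 0 ≤ ∫ x in FVNS.cube d, ‖ϱ₀ x‖ ^ γ :=
      integral_nonneg fun x => Real.rpow_nonneg (norm_nonneg _) γ
    positivity
  set C := FVNS.Mesh.consistencyConst d T a γ μ lam |η| c₂ 𝓔 U with hC
  have hC0 : 0 ≤ C :=
    FVNS.Mesh.consistencyConst_nonneg hT ha hγ1 hμ hlam (abs_nonneg η) hc₂ h𝓔0 hU0
  refine ⟨(d + 1) * C + 1, by positivity, ?_⟩
  intro M N dt hreg hN hdt _ hdt₂ ϱ u hsol hE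
  have hN' : (0 : ℝ) < N := by exact_mod_cast hN
  have hdt0 : 0 < dt := by rw [hdt]; positivity
  have hnn := hsol.nonneg M hdt0 hpos
  have hen := hsol.energy_le M hdt0 ha hγ1 hlam hnn
  have hen0 : M.energy a γ (ϱ 0) (u 0) ≤ 𝓔 := by
    rw [FVNS.Mesh.energy_eq, h𝓔]
    have h1 := M.sum_vol_mul_proj_rpow_le hγ1 hϱi hϱγ hpos
    simp only [← hsol.init_density] at h1
    have h2 := le_abs_self E₀
    have h3 := mul_le_mul_of_nonneg_left h1 (div_pos ha hg).le
    linarith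
  have hB : M.IsBoundedSolution a γ μ lam ε dt T |η| c₂ 𝓔 U N ϱ u := by
    refine ⟨ha, hγ1, hμ, hlam, hε0, hε1, hdt0, hN, ?_, hdt₂, hc₂, abs_nonneg η,
      fun i => (hreg i).trans (le_abs_self η), hU0, ?_, hnn, fun k hk => (hen k hk).trans hen0,
      hsol.continuity, hsol.momentum⟩
    · rw [hdt]; field_simp
    · refine Finset.sum_le_sum fun j _ => ?_
      have := M.sum_vol_mul_abs_proj_le (hui j)
      simp only [← hsol.init_velocity] at this
      exact this
  have hκ : 0 ≤ M.size ^ ((1 - ε) / 2) := Real.rpow_nonneg M.size_nonneg _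
  have hfin : ∀ {F : Type} [NormedAddCommGroup F] [NormedSpace ℝ F] (φ : ℝ → FVNS.Pt d → F) (b : ℝ),
      b ≤ (d + 1) * C + 1 → FVNS.cNorm T 2 φ * M.size ^ ((1 - ε) / 2) * b
        ≤ ((d + 1) * C + 1) * M.size ^ ((1 - ε) / 2)
          * (FVNS.cNorm T 2 φ + M.size * FVNS.cNorm T 3 φ) := by
    intro F _ _ φ b hb
    have h2 := FVNS.cNorm_nonneg T 2 φ
    have h3 := mul_nonneg M.size_nonneg (FVNS.cNorm_nonneg T 3 φ)
    calc FVNS.cNorm T 2 φ * M.size ^ ((1 - ε) / 2) * b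
        ≤ FVNS.cNorm T 2 φ * M.size ^ ((1 - ε) / 2) * ((d + 1) * C + 1) := by gcongr
      _ = ((d + 1) * C + 1) * M.size ^ ((1 - ε) / 2) * FVNS.cNorm T 2 φ := by ring
      _ ≤ _ := by gcongr; linarith
  have hdC : 0 ≤ d * C := mul_nonneg (Nat.cast_nonneg d) hC0
  classical
  refine ⟨fun φ => if hφ : FVNS.IsTest T φ then
      (FVNS.exists_continuity_residual hB hT i₀ hφ).choose else 0,
    fun φ => if hφ : FVNS.IsTest T φ then
      (FVNS.exists_momentum_residual hB hT hφ).choose else 0, fun φ hφ => ?_, fun φ hφ => ?_⟩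
  · have hs := (FVNS.exists_continuity_residual hB hT i₀ hφ).choose_spec
    simp only [dif_pos hφ]
    exact ⟨hs.1, hs.2.1, hs.2.2.trans (hfin φ C (by linarith))⟩
  · have hs := (FVNS.exists_momentum_residual hB hT hφ).choose_spec
    simp only [dif_pos hφ]
    refine ⟨hs.1, hs.2.1, hs.2.2.trans ?_⟩
    rw [mul_left_comm]
    exact hfin φ (d * C) (by linarith)
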